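/- Let $V,U_s:\mathbb R^3\to\mathbb R$ ($s\in I$, $I\subseteq\mathbb R$ an interval) be potentials that are infinitesimally bounded with respect to $-\Delta$ (i.e. each such potential $W$ maps $H^2(\mathbb R^3)$ into $L^2(\mathbb R^3)$, and for every $\varepsilon>0$ there is $C$ with $\|W\psi\|\le\varepsilon\|\Delta\psi\|+C\|\psi\|$ for all $\psi\in H^2(\mathbb R^3)$). Assume, for almost every $x$: - $V(x)\ge 0$, and $V(x)=0$ for $|x|>R$, for some $R$; - $U_s(x)>0$, $U_s(x)\le U_t(x)$ for $s\le t$, and each $U_s$ tends to zero at infinity, i.e. $\operatorname{ess\,sup}_{|x|>\rho}U_s(x)\to0$ as $\rho\to\infty$. For example, $U_s=sW$, $s\in(0,\infty)$, where $W>0$ is infinitesimally bounded and tends to zero at infinity. Consider the one-particle operators $$H_s=-\Delta-V+U_s\quad\text{on } L^2(\mathbb R^3),\qquad D(H_s)=H^2(\mathbb R^3).$$ Let $c\in I$, not the smallest element of $I$, be the critical value of the parameter, that is, $\inf\sigma(H_s)<\inf\sigma_{\rm ess}(H_s)$ for all $s\in I$ with $s<c$, and $\inf\sigma(H_s)=\inf\sigma_{\rm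 ess}(H_s)$ for all $s\in I$ with $s\ge c$. Suppose that $U_s(x)\to U_c(x)$ as $s\uparrow c$ for almost every $x$, and that the critical repulsion $U_c$ decays slowly: there are $\delta>0$ and $\rho$ such that $$U_c(x)\ \ge\ \frac{3/4+\delta}{|x|^{2}}\qquad\text{for almost every } x \text{ with } |x|>\rho .$$ Then $H_c$ has a ground state at the threshold of its essential spectrum: $\inf\sigma_{\rm ess}(H_c)=0=\inf\sigma(H_c)$, and there is $\psi\in D(H_c)$ with $\|\psi\|=1$ and $H_c\psi=0$. -/

import Mathlib

open MeasureTheory Filter Topology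
open scoped SchwartzMap Laplacian

noncomputable section

/-! ### Spectral notions for unbounded operators -/

section Spectral

variable {E : Type*} [NormedAddCommGroup E] [NormedSpace ℂ E]

/-- The resolvent set of an unbounded operator `T`: the `z` for which `T - z` is a bijection from
the domain of `T` onto the whole space with an everywhere defined bounded inverse. -/
def resolventSetOf (T : E →ₗ.[ℂ] E) : Set ℂ :=
  {z | ∃ S : E →L[ℂ] E,
    (∀ f : E, ∃ h : S f ∈ T.domain, T ⟨S f, h⟩ - z • S f = f) ∧
    ∀ ψ : T.domain, S (T ψ - z • (ψ : E)) = ψ}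

/-- The spectrum of an unbounded operator. -/
def spectrumOf (T : E →ₗ.[ℂ] E) : Set ℂ := (resolventSetOf T)ᶜ

/-- The eigenspace `{ψ ∈ D(T) | T ψ = z ψ}`. -/
def eigenspaceOf (T : E →ₗ.[ℂ] E) (z : ℂ) : Submodule ℂ T.domain :=
  LinearMap.ker (T.toFun - z • T.domain.subtype)

/-- The discrete spectrum: isolated points of the spectrum that are eigenvalues of finite
multiplicity. -/
def discreteSpectrum (T : E →ₗ.[ℂ] E) : Set ℂ :=
  {z | z ∈ spectrumOf T ∧ (∃ r > 0, spectrumOf T ∩ Metric.ball z r = {z}) ∧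
    eigenspaceOf T z ≠ ⊥ ∧ FiniteDimensional ℂ (eigenspaceOf T z)}

/-- The essential spectrum (of a self-adjoint operator): the complement of the discrete spectrum
in the spectrum. -/
def essentialSpectrum (T : E →ₗ.[ℂ] E) : Set ℂ := spectrumOf T \ discreteSpectrum T

/-- `inf σ(T)`, as an extended real number, for an operator with real spectrum. -/
def spectralBottom (T : E →ₗ.[ℂ] E) : EReal :=
  sInf {e | ∃ t : ℝ, (t : ℂ) ∈ spectrumOf T ∧ e = (t : EReal)}

/-- The threshold `inf σ_ess(T)` of the essential spectrum, as an extended real number, for an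
operator with real spectrum. -/
def essentialThreshold (T : E →ₗ.[ℂ] E) : EReal :=
  sInf {e | ∃ t : ℝ, (t : ℂ) ∈ essentialSpectrum T ∧ e = (t : EReal)}

/-- `c` is the critical coupling of the family `(T s)`, `s ∈ I`: below `c` the spectrum of `T s`
begins strictly below the essential spectrum, and from `c` on it does not. -/
def IsCriticalCoupling (T : ℝ → (E →ₗ.[ℂ] E)) (I : Set ℝ) (c : ℝ) : Prop :=
  c ∈ I ∧ (∃ s ∈ I, s < c) ∧
  (∀ s ∈ I, s < c → spectralBottom (T s) < essentialThreshold (T s)) ∧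
  (∀ s ∈ I, c ≤ s → spectralBottom (T s) = essentialThreshold (T s))

end Spectral

/-! ### Schrödinger operators on `L²(ℝ³)` -/

/-- Three-dimensional Euclidean space. -/
abbrev R3 : Type := EuclideanSpace ℝ (Fin 3)

/-- The complex Hilbert space `L²(ℝ³)`. -/
abbrev L2R3 : Type := Lp ℂ 2 (volume : Measure R3)

/-- The Sobolev space `H²(ℝ³)` as a subspace of `L²(ℝ³)`. -/
def H2R3 : Submodule ℂ L2R3 where
  carrier := {ψ | TemperedDistribution.MemSobolev 2 2 (ψ : 𝓢'(R3, ℂ))}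
  add_mem' {a b} ha hb := by
    have h := ha.add hb
    simp only [← Lp.toTemperedDistributionCLM_apply, ← map_add] at h
    exact h
  zero_mem' := by
    have h := TemperedDistribution.memSobolev_fun_zero R3 ℂ 2 2
    rw [← map_zero (Lp.toTemperedDistributionCLM ℂ (volume : Measure R3) 2)] at h
    exact h
  smul_mem' c a ha := by
    have h := ha.smul c
    simp only [← Lp.toTemperedDistributionCLM_apply, ← map_smul] at h
    exact h

/-- The distributional Laplacian of an `H²` function is an `L²` function. -/
theorem exists_laplacian (ψ : H2R3) :
    ∃ g : L2R3, (Δ ((ψ : L2R3) : 𝓢'(R3, ℂ)) : 𝓢'(R3, ℂ)) = (g : 𝓢'(R3, ℂ)) := by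
  have h := TemperedDistribution.MemSobolev.laplacian ψ.2
  rw [sub_self] at h
  exact TemperedDistribution.memSobolev_zero_iff.mp h

theorem toTemperedDistribution_inj {f g : L2R3}
    (h : (f : 𝓢'(R3, ℂ)) = (g : 𝓢'(R3, ℂ))) : f = g :=
  LinearMap.ker_eq_bot.mp
    (Lp.ker_toTemperedDistributionCLM_eq_bot (F := ℂ) (μ := (volume : Measure R3)) (p := 2)) h

/-- The Laplacian `Δ : H²(ℝ³) → L²(ℝ³)`. -/
def laplacianL2 : H2R3 →ₗ[ℂ] L2R3 where
  toFun ψ := (exists_laplacian ψ).choose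
  map_add' a b := by
    apply toTemperedDistribution_inj
    rw [← (exists_laplacian (a + b)).choose_spec]
    have ha := (exists_laplacian a).choose_spec
    have hb := (exists_laplacian b).choose_spec
    simp only [← Lp.toTemperedDistributionCLM_apply, map_add, Submodule.coe_add,
      ← TemperedDistribution.laplacianCLM_apply] at ha hb ⊢
    exact congrArg₂ (· + ·) ha hb
  map_smul' c a := by
    apply toTemperedDistribution_inj
    rw [← (exists_laplacian (c • a)).choose_spec]
    have ha := (exists_laplacian a).choose_spec
    simp only [← Lp.toTemperedDistributionCLM_apply, map_smul, Submodule.coe_smul,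
      RingHom.id_apply, ← TemperedDistribution.laplacianCLM_apply] at ha ⊢
    exact congrArg (c • ·) ha

/-- The defining property of `laplacianL2`. -/
theorem laplacianL2_spec (ψ : H2R3) :
    ((laplacianL2 ψ : L2R3) : 𝓢'(R3, ℂ)) = Δ ((ψ : L2R3) : 𝓢'(R3, ℂ)) :=
  (exists_laplacian ψ).choose_spec.symm

/-- The product `W ψ` of a real potential and a complex function. -/
def potentialMul (W : R3 → ℝ) (ψ : L2R3) : R3 → ℂ := fun x ↦ (W x : ℂ) * ψ x

theorem potentialMul_add (W : R3 → ℝ) (a b : L2R3) :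
    potentialMul W (a + b) =ᵐ[volume] potentialMul W a + potentialMul W b := by
  filter_upwards [Lp.coeFn_add a b] with x hx
  simp only [potentialMul, Pi.add_apply, mul_add, hx]

theorem potentialMul_smul (W : R3 → ℝ) (c : ℂ) (a : L2R3) :
    potentialMul W (c • a) =ᵐ[volume] c • potentialMul W a := by
  filter_upwards [Lp.coeFn_smul c a] with x hx
  simp [potentialMul, hx, mul_left_comm]

theorem potentialMul_zero (W : R3 → ℝ) :
    potentialMul W 0 =ᵐ[volume] 0 := by
  filter_upwards [Lp.coeFn_zero ℂ 2 (volume : Measure R3)] with x hx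
  simp only [potentialMul, hx, Pi.zero_apply, mul_zero]

/-- `W` is infinitesimally bounded with respect to `-Δ`: its domain contains `H²(ℝ³)`, and its
relative bound with respect to `-Δ` is zero. -/
def InfinitesimallyBounded (W : R3 → ℝ) : Prop :=
  ∀ ε : ℝ, 0 < ε → ∃ C : ℝ, ∀ ψ : H2R3,
    ∃ h : MemLp (potentialMul W ψ) 2 volume,
      ‖h.toLp (potentialMul W ψ)‖ ≤ ε * ‖laplacianL2 ψ‖ + C * ‖(ψ : L2R3)‖

/-- The domain `{ψ ∈ H²(ℝ³) | W ψ ∈ L²(ℝ³)}` of `-Δ + W`; it is `H²(ℝ³)` when `W` is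
infinitesimally bounded with respect to `-Δ`. -/
def schrodingerDomain (W : R3 → ℝ) : Submodule ℂ L2R3 where
  carrier := {ψ | ψ ∈ H2R3 ∧ MemLp (potentialMul W ψ) 2 volume}
  add_mem' {a b} ha hb :=
    ⟨H2R3.add_mem ha.1 hb.1, (memLp_congr_ae (potentialMul_add W a b)).mpr (ha.2.add hb.2)⟩
  zero_mem' :=
    ⟨H2R3.zero_mem, (memLp_congr_ae (potentialMul_zero W)).mpr MemLp.zero⟩
  smul_mem' c a ha :=
    ⟨H2R3.smul_mem c ha.1, (memLp_congr_ae (potentialMul_smul W c a)).mpr (ha.2.const_smul c)⟩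

/-- The Schrödinger operator `-Δ + W` on `L²(ℝ³)`. -/
def schrodinger (W : R3 → ℝ) : L2R3 →ₗ.[ℂ] L2R3 where
  domain := schrodingerDomain W
  toFun :=
    { toFun := fun ψ ↦ -laplacianL2 ⟨ψ.1, ψ.2.1⟩ + ψ.2.2.toLp (potentialMul W ψ.1)
      map_add' := fun a b ↦ by
        have h1 : laplacianL2 ⟨(a + b).1, (a + b).2.1⟩
            = laplacianL2 ⟨a.1, a.2.1⟩ + laplacianL2 ⟨b.1, b.2.1⟩ := by
          rw [← map_add]; rfl
        have h2 : (a + b).2.2.toLp (potentialMul W (a + b).1)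
            = a.2.2.toLp (potentialMul W a.1) + b.2.2.toLp (potentialMul W b.1) := by
          rw [← MemLp.toLp_add]
          exact MemLp.toLp_congr _ _ (potentialMul_add W a.1 b.1)
        rw [h1, h2]; abel
      map_smul' := fun c a ↦ by
        have h1 : laplacianL2 ⟨(c • a).1, (c • a).2.1⟩ = c • laplacianL2 ⟨a.1, a.2.1⟩ := by
          rw [← map_smul]; rfl
        have h2 : (c • a).2.2.toLp (potentialMul W (c • a).1)
            = c • a.2.2.toLp (potentialMul W a.1) := by
          rw [← MemLp.toLp_const_smul]
          exact MemLp.toLp_congr _ _ (potentialMul_smul W c a.1)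
        rw [h1, h2, RingHom.id_apply, smul_add, smul_neg] }

/-- The one-particle Hamiltonian `H = -Δ - V + U`. -/
def oneParticleHamiltonian (V U : R3 → ℝ) : L2R3 →ₗ.[ℂ] L2R3 :=
  schrodinger fun x ↦ -V x + U x

end

/-! Let s_n ↑ c. Below c there are bound states H_{s_n} ψ_n = E_n ψ_n with E_n < 0, and only an
escape of their mass to infinity could keep them from converging to a zero mode of H_c. The slow
decay of U_c forbids this. Put θ = L²/(L² + |x|²) and test the eigenvalue equation against |x|²θψ. A
Hardy inequality with this weight (`hardy_schwartz`, `hardy_H2`) bounds the kinetic term below by ∫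
θ(1/4 - θ²)|ψ|², formally -(3/4) ∫ |ψ|² as L → ∞; this is the origin of the constant 3/4. A
repulsion above (3/4 + δ)/|x|² leaves at least δθ, the energy has the favourable sign, and V costs
only local mass. Hence ⟨θψ, ψ⟩ is controlled by the local mass of ψ, uniformly in L
(`pointwise_lower_bound`, `localization_form`).

The lower bound is assumed for U_c, whereas ψ_n feels the smaller U_{s_n}. The defect is absorbed
because (U_c - U_{s_n})(1 - Δ/(2π)²)⁻¹ tends to zero in operator norm along a subsequence
(`exists_subseq_tendsto_mulBessel`), but how close s_n must be to c depends on L. So compactness is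
applied not to ψ_n, whose L² norms are not controlled, but to the cut-off states θψ_n, with L
growing along the sequence. The commutator [Δ, θ] is of order 1/L relative to localized norms
(`commutator_schwartz`), so these states are bounded approximate eigenvectors of H_c that keep their
local mass (`exists_approximate_eigenvector`). By Rellich's theorem their weak limit is nonzero; it
solves H_c ψ = eψ with e ≤ 0 (`exists_eigenvector_of_approximate`), and e = 0 because the spectrum
of H_c begins at 0.

The spectral input is that W(1 - Δ/(2π)²)⁻¹ is completely continuous for each potential W involved.
The abstract theory of `IsCompactPerturbation` then gives threshold 0 for the essential spectrum and
turns negative spectrum into eigenvectors. -/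

/-! ### Compact perturbations of the Laplacian in a Hilbert space -/

section HilbertSpace

variable {E : Type*} [NormedAddCommGroup E] [InnerProductSpace ℂ E]

/-- Bounded sequences in a separable Hilbert space have weakly convergent subsequences. -/
theorem exists_weakly_convergent_subseq [CompleteSpace E] [TopologicalSpace.SeparableSpace E] {f : ℕ → E} {C : ℝ}
    (hf : ∀ n, ‖f n‖ ≤ C) :
    ∃ a : E, ‖a‖ ≤ C ∧ ∃ k : ℕ → ℕ, StrictMono k ∧
      ∀ g, Tendsto (fun n ↦ inner ℂ g (f (k n))) atTop (𝓝 (inner ℂ g a)) := by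
  -- Sequential Banach–Alaoglu for the functionals ⟨f n, ·⟩; the limit functional is turned back
  -- into a vector by Riesz.
  have h := WeakDual.isSeqCompact_closedBall ℂ E 0 C
  obtain ⟨a, ha, k, hk, hlim⟩ := @h
    (fun n ↦ StrongDual.toWeakDual (InnerProductSpace.toDual ℂ E (f n)))
    (fun n ↦ by simpa using hf n)
  refine ⟨(InnerProductSpace.toDual ℂ E).symm (WeakDual.toStrongDual a), by simpa using ha, k, hk,
    fun g ↦ ?_⟩
  have h1 : Tendsto (fun n ↦ inner ℂ (f (k n)) g) atTop (𝓝 (WeakDual.toStrongDual a g)) :=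
    ((WeakDual.eval_continuous g).tendsto a).comp hlim
  have h2 := (Complex.continuous_conj.tendsto _).comp h1
  have h3 : inner ℂ g ((InnerProductSpace.toDual ℂ E).symm (WeakDual.toStrongDual a))
      = (starRingEnd ℂ) (WeakDual.toStrongDual a g) := by
    rw [← inner_conj_symm, InnerProductSpace.toDual_symm_apply]
  rw [h3]
  refine h2.congr fun n ↦ ?_
  simp

/-- An orthonormal sequence converges weakly to zero. -/
theorem Orthonormal.tendsto_inner_zero {f : ℕ → E} (hf : Orthonormal ℂ f) (g : E) :
    Tendsto (fun n ↦ inner ℂ g (f n)) atTop (𝓝 0) := by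
  have h := (hf.inner_products_summable g).tendsto_atTop_zero
  rw [tendsto_zero_iff_norm_tendsto_zero]
  have h2 := (Real.continuous_sqrt.tendsto 0).comp h
  rw [Real.sqrt_zero] at h2
  refine h2.congr fun n ↦ ?_
  simp [Real.sqrt_sq, norm_inner_symm]

/-- `K` maps bounded weak null sequences to norm null sequences. -/
def IsCompletelyContinuous (K : E →L[ℂ] E) : Prop :=
  ∀ (f : ℕ → E) (C : ℝ), (∀ n, ‖f n‖ ≤ C) →
    (∀ g, Tendsto (fun n ↦ inner ℂ g (f n)) atTop (𝓝 0)) → Tendsto (fun n ↦ K (f n)) atTop (𝓝 0)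

theorem IsCompletelyContinuous.tendsto {K : E →L[ℂ] E} (hK : IsCompletelyContinuous K)
    {f : ℕ → E} {C : ℝ} (hf : ∀ n, ‖f n‖ ≤ C) {a : E}
    (h : ∀ g, Tendsto (fun n ↦ inner ℂ g (f n)) atTop (𝓝 (inner ℂ g a))) :
    Tendsto (fun n ↦ K (f n)) atTop (𝓝 (K a)) := by
  have h1 := hK (fun n ↦ f n - a) (C + ‖a‖)
    (fun n ↦ (norm_sub_le _ _).trans (by gcongr; exact hf n))
    (fun g ↦ by simpa [inner_sub_right] using (h g).sub_const (inner ℂ g a))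
  simpa using h1.add_const (K a)

/-- A sequence in the unit ball has a subsequence with a weak limit in the ball, and `K` makes the
convergence strong. So the image of the closed ball is itself compact, not merely its closure. -/
theorem IsCompletelyContinuous.isCompactOperator [CompleteSpace E] [TopologicalSpace.SeparableSpace E]
    {K : E →L[ℂ] E} (hK : IsCompletelyContinuous K) : IsCompactOperator K := by
  have h := (isCompactOperator_iff_image_closedBall_subset_compact (r := 1)
    (K : E →ₗ[ℂ] E) one_pos).2
  refine h ⟨K '' Metric.closedBall 0 1, IsSeqCompact.isCompact ?_, subset_rfl⟩
  intro y hy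
  choose x hx hxy using hy
  have hx' : ∀ n, ‖x n‖ ≤ 1 := fun n ↦ by simpa using hx n
  obtain ⟨a, ha, k, hk, hlim⟩ := exists_weakly_convergent_subseq hx'
  refine ⟨K a, ⟨a, by simpa using ha, rfl⟩, k, hk, ?_⟩
  refine (hK.tendsto (fun n ↦ hx' (k n)) hlim).congr fun n ↦ hxy (k n)

/-- `T = κ (B⁻¹ - 1) + K B⁻¹`, where `0 ≤ B ≤ 1` is injective and `K` is completely continuous:
the abstract form of a Schrödinger operator whose potential is relatively compact. -/
structure IsCompactPerturbation (κ : ℝ) (B K : E →L[ℂ] E) (T : E →ₗ.[ℂ] E) : Prop where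
  pos : 0 < κ
  inner_comm : ∀ f g, inner ℂ (B f) g = inner ℂ f (B g)
  norm_sq_le : ∀ f, ‖B f‖ ^ 2 ≤ (inner ℂ (B f) f).re
  injective : Function.Injective B
  mem_domain : ∀ f, B f ∈ T.domain
  exists_eq : ∀ ψ : T.domain, ∃ f, B f = ψ
  apply_eq : ∀ f, T ⟨B f, mem_domain f⟩ = (κ : ℂ) • (f - B f) + K f
  inner_comm_right : ∀ f g, inner ℂ (K f) (B g) = inner ℂ (B f) (K g)
  bound : ∃ C, 0 ≤ C ∧ ∀ f, ‖K f‖ ≤ κ / 2 * ‖f‖ + C * ‖B f‖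
  completelyContinuous : IsCompletelyContinuous K

namespace IsCompactPerturbation

variable {κ : ℝ} {B K : E →L[ℂ] E} {T : E →ₗ.[ℂ] E}

theorem norm_le (h : IsCompactPerturbation κ B K T) (f : E) : ‖B f‖ ≤ ‖f‖ := by
  by_contra! hlt
  have h1 := h.norm_sq_le f
  have h2 : (inner ℂ (B f) f).re ≤ ‖B f‖ * ‖f‖ := re_inner_le_norm (𝕜 := ℂ) (B f) f
  nlinarith [norm_nonneg f]

open scoped ComplexOrder in
theorem spectrum_subset [CompleteSpace E] (h : IsCompactPerturbation κ B K T) {w : ℂ} (hw : w ∈ spectrum ℂ B) :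
    ∃ r : ℝ, w = r ∧ 0 ≤ r ∧ r ≤ 1 := by
  have hpos : B.IsPositive := by
    refine ⟨fun f g ↦ h.inner_comm f g, fun f ↦ ?_⟩
    exact (sq_nonneg _).trans (h.norm_sq_le f)
  have h0 : 0 ≤ w := spectrum_nonneg_of_nonneg
    ((ContinuousLinearMap.nonneg_iff_isPositive B).2 hpos) hw
  have h1 : ‖w‖ ≤ 1 := by
    have hB : ‖B‖ ≤ 1 := B.opNorm_le_bound zero_le_one fun f ↦ by simpa using h.norm_le f
    refine (spectrum.norm_le_norm_mul_of_mem hw).trans ?_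
    have : ‖(1 : E →L[ℂ] E)‖ ≤ 1 := ContinuousLinearMap.norm_id_le
    nlinarith [norm_nonneg B, norm_nonneg (1 : E →L[ℂ] E)]
  obtain ⟨h2, h3⟩ := Complex.nonneg_iff.1 h0
  refine ⟨w.re, Complex.ext rfl h3.symm, h2, (Complex.re_le_norm w).trans h1⟩

/-- The free operator has no spectrum off the half line `[0, ∞)`. -/
theorem isUnit_free [CompleteSpace E] (h : IsCompactPerturbation κ B K T) {z : ℂ}
    (hz : ∀ r : ℝ, 0 ≤ r → z ≠ r) : IsUnit ((κ : ℂ) • (1 : E →L[ℂ] E) - (κ + z) • B) := by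
  have hκ : (κ : ℂ) ≠ 0 := by exact_mod_cast h.pos.ne'
  -- If κ + z ≠ 0, the operator is (κ + z)(κ/(κ + z) - B). A spectral value r = κ/(κ + z) of B lies
  -- in (0, 1], which forces z = κ/r - κ ≥ 0.
  by_cases hc : (κ : ℂ) + z = 0
  · rw [hc, zero_smul, sub_zero]
    exact (isUnit_one (M := E →L[ℂ] E)).smul (Units.mk0 _ hκ)
  · have h1 : (κ : ℂ) / (κ + z) ∉ spectrum ℂ B := by
      intro hw
      obtain ⟨r, hr, hr0, hr1⟩ := h.spectrum_subset hw
      have hr' : r ≠ 0 := by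
        rintro rfl
        rw [Complex.ofReal_zero, div_eq_zero_iff] at hr
        exact hr.elim hκ hc
      have hrp : 0 < r := lt_of_le_of_ne hr0 hr'.symm
      have : z = ((κ / r - κ : ℝ) : ℂ) := by
        have hrc : (r : ℂ) ≠ 0 := by exact_mod_cast hr'
        push_cast
        field_simp at hr ⊢
        linear_combination -hr
      refine hz _ ?_ this
      have : κ ≤ κ / r := by rw [le_div_iff₀ hrp]; nlinarith [h.pos]
      linarith
    rw [spectrum.notMem_iff] at h1
    have h2 := h1.smul (Units.mk0 _ hc)
    convert h2 using 1
    rw [Units.smul_mk0, smul_sub, Algebra.algebraMap_eq_smul_one, smul_smul, mul_div_cancel₀ _ hc]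

/-- Composition with B makes T - z a bounded operator: an operator invertible off [0, ∞), plus the
completely continuous K. -/
theorem apply_sub (h : IsCompactPerturbation κ B K T) (z : ℂ) (f : E) (hf : B f ∈ T.domain) :
    T ⟨B f, hf⟩ - z • B f = ((κ : ℂ) • (1 : E →L[ℂ] E) - (κ + z) • B + K) f := by
  rw [h.apply_eq]
  simp only [add_apply, sub_apply,
    smul_apply, one_apply_eq_self]
  module

/-- Off the half line `[0, ∞)` the spectrum consists of eigenvalues. -/
theorem exists_eigenvector [CompleteSpace E] [TopologicalSpace.SeparableSpace E]
    (h : IsCompactPerturbation κ B K T) {z : ℂ}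
    (hz : ∀ r : ℝ, 0 ≤ r → z ≠ r) (hmem : z ∈ spectrumOf T) :
    ∃ ψ : T.domain, ψ ≠ 0 ∧ T ψ = z • (ψ : E) := by
  obtain ⟨P, hP⟩ := h.isUnit_free hz
  set Q : E →L[ℂ] E := (↑P⁻¹ : E →L[ℂ] E) with hQ
  have hPQ : ∀ f, (P : E →L[ℂ] E) (Q f) = f := fun f ↦ by
    rw [← mul_apply_eq_comp, hQ, Units.mul_inv, one_apply_eq_self]
  have hQP : ∀ f, Q ((P : E →L[ℂ] E) f) = f := fun f ↦ by
    rw [← mul_apply_eq_comp, hQ, Units.inv_mul, one_apply_eq_self]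
  -- P + K = P(1 + QK), so the Fredholm alternative for QK at -1 decides between an eigenvector of T
  -- and a bounded resolvent.
  have hcomp : IsCompactOperator (Q * K) :=
    h.completelyContinuous.isCompactOperator.clm_comp Q
  rcases hcomp.hasEigenvalue_or_mem_resolventSet (μ := (-1 : ℂ)) (by norm_num) with he | hr
  · obtain ⟨g, hg⟩ := he.exists_hasEigenvector
    have hg1 : Q (K g) = -g := by simpa using! hg.apply_eq_smul
    have hg2 : (P : E →L[ℂ] E) g + K g = 0 := by
      have := congrArg (P : E →L[ℂ] E) hg1
      rw [hPQ, map_neg] at this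
      rw [this, add_neg_cancel]
    refine ⟨⟨B g, h.mem_domain g⟩, ?_, ?_⟩
    · intro h0
      have : B g = 0 := congrArg Subtype.val h0
      exact hg.2 (h.injective (by rw [this, map_zero]))
    · have h3 := h.apply_sub z g (h.mem_domain g)
      rw [add_apply, ← hP, hg2] at h3
      exact sub_eq_zero.1 h3
  · exfalso
    apply hmem
    rw [spectrum.mem_resolventSet_iff] at hr
    -- The unit provided is -1 - QK; its negative R = 1 + QK yields the resolvent B R⁻¹ Q,
    -- contradicting that z is in the spectrum.
    obtain ⟨R, hR⟩ := hr.neg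
    have hM : ∀ f, (P : E →L[ℂ] E) ((R : E →L[ℂ] E) f)
        = ((κ : ℂ) • (1 : E →L[ℂ] E) - (κ + z) • B + K) f := fun f ↦ by
      rw [hR, add_apply, ← hP]
      simp [hPQ, add_comm]
    have hRl : ∀ f, (R : E →L[ℂ] E) ((↑R⁻¹ : E →L[ℂ] E) f) = f := fun f ↦ by
      rw [← mul_apply_eq_comp, Units.mul_inv, one_apply_eq_self]
    have hRr : ∀ f, (↑R⁻¹ : E →L[ℂ] E) ((R : E →L[ℂ] E) f) = f := fun f ↦ by
      rw [← mul_apply_eq_comp, Units.inv_mul, one_apply_eq_self]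
    refine ⟨B * (↑R⁻¹ : E →L[ℂ] E) * Q, fun f ↦ ⟨h.mem_domain _, ?_⟩, fun ψ ↦ ?_⟩
    · have h3 := h.apply_sub z ((↑R⁻¹ : E →L[ℂ] E) (Q f)) (h.mem_domain _)
      rw [← hM, hRl, hPQ] at h3
      exact h3
    · obtain ⟨f, hf⟩ := h.exists_eq ψ
      obtain ⟨ψ, hψ⟩ := ψ
      simp only at hf
      subst hf
      rw [h.apply_sub z f hψ, ← hM]
      simp [hQP, hRr]

theorem inner_apply_comm (h : IsCompactPerturbation κ B K T) (φ ψ : T.domain) :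
    inner ℂ (T φ) (ψ : E) = inner ℂ (φ : E) (T ψ) := by
  obtain ⟨f, hf⟩ := h.exists_eq φ
  obtain ⟨g, hg⟩ := h.exists_eq ψ
  obtain ⟨φ, hφ⟩ := φ
  obtain ⟨ψ, hψ⟩ := ψ
  simp only at hf hg
  subst hf hg
  rw [h.apply_eq, h.apply_eq]
  simp only [inner_add_left, inner_add_right, inner_smul_left, inner_smul_right, inner_sub_left,
    inner_sub_right, h.inner_comm_right, Complex.conj_ofReal, h.inner_comm f (B g)]
  rw [h.inner_comm f g]

theorem eigenvalue_real (h : IsCompactPerturbation κ B K T) {z : ℂ} {ψ : T.domain} (hψ : ψ ≠ 0)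
    (hT : T ψ = z • (ψ : E)) : z = z.re := by
  have h1 := h.inner_apply_comm ψ ψ
  rw [hT, inner_smul_left, inner_smul_right] at h1
  have h2 : inner ℂ (ψ : E) (ψ : E) ≠ 0 := by simpa using hψ
  exact (Complex.conj_eq_iff_real.1 (mul_right_cancel₀ h2 h1)).elim fun r hr ↦ by simp [hr]

theorem inner_eigenvectors (h : IsCompactPerturbation κ B K T) {s t : ℝ} (hst : s ≠ t)
    {φ ψ : T.domain} (hφ : T φ = (s : ℂ) • (φ : E)) (hψ : T ψ = (t : ℂ) • (ψ : E)) :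
    inner ℂ (φ : E) (ψ : E) = 0 := by
  have h1 := h.inner_apply_comm φ ψ
  rw [hφ, hψ, inner_smul_left, inner_smul_right, Complex.conj_ofReal] at h1
  have h2 : ((s : ℂ) - t) * inner ℂ (φ : E) (ψ : E) = 0 := by linear_combination h1
  exact (mul_eq_zero.1 h2).resolve_left (sub_ne_zero.2 (by exact_mod_cast hst))

/-- `B⁻¹` is bounded on the eigenvectors to bounded eigenvalues. -/
theorem norm_le_of_eigenvector (h : IsCompactPerturbation κ B K T) {C : ℝ}
    (hC : ∀ f, ‖K f‖ ≤ κ / 2 * ‖f‖ + C * ‖B f‖) {t M : ℝ} (ht : |t| ≤ M) {f : E}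
    (hf : ((κ : ℂ) • (1 : E →L[ℂ] E) - ((κ : ℂ) + t) • B + K) f = 0) :
    κ / 2 * ‖f‖ ≤ (κ + M + C) * ‖B f‖ := by
  have h1 : (κ : ℂ) • f = ((κ + t : ℝ) : ℂ) • B f - K f := by
    simp only [add_apply, sub_apply,
      smul_apply, one_apply_eq_self] at hf
    rw [← sub_eq_zero, ← hf]
    push_cast
    module
  have h2 : κ * ‖f‖ ≤ (κ + M) * ‖B f‖ + ‖K f‖ := by
    have := norm_sub_le (((κ + t : ℝ) : ℂ) • B f) (K f)
    rw [← h1, norm_smul, norm_smul, Complex.norm_real, Complex.norm_real, Real.norm_eq_abs,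
      abs_of_pos h.pos] at this
    refine this.trans ?_
    gcongr
    rw [Real.norm_eq_abs]
    exact (abs_add_le _ _).trans (by rw [abs_of_pos h.pos]; gcongr)
  linarith [hC f]

/-- There is no orthonormal sequence of eigenvectors with eigenvalues in `[-M, -τ]`, `τ > 0`. -/
theorem not_orthonormal_eigenvectors [CompleteSpace E] [TopologicalSpace.SeparableSpace E]
    (h : IsCompactPerturbation κ B K T) {M τ : ℝ} (hτ : 0 < τ) {t : ℕ → ℝ}
    (ht : ∀ n, -M ≤ t n ∧ t n ≤ -τ) {ψ : ℕ → T.domain} (hψ : ∀ n, T (ψ n) = (t n : ℂ) • (ψ n : E))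
    (hon : Orthonormal ℂ fun n ↦ (ψ n : E)) : False := by
  choose f hf using fun n ↦ h.exists_eq (ψ n)
  obtain ⟨C, hC0, hC⟩ := h.bound
  have heq : ∀ n, ((κ : ℂ) • (1 : E →L[ℂ] E) - ((κ : ℂ) + t n) • B + K) (f n) = 0 := fun n ↦ by
    have h1 : B (f n) ∈ T.domain := h.mem_domain _
    have h2 : (⟨B (f n), h1⟩ : T.domain) = ψ n := Subtype.ext (hf n)
    rw [← h.apply_sub _ _ h1, h2, hψ, hf n, sub_self]
  have hb : ∀ n, ‖f n‖ ≤ 2 / κ * (κ + M + C) := fun n ↦ by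
    have h1 := h.norm_le_of_eigenvector hC (M := M)
      (abs_le.2 ⟨(ht n).1, by linarith [(ht n).1, (ht n).2]⟩) (heq n)
    have h2 : ‖B (f n)‖ = 1 := by rw [hf]; exact hon.1 n
    rw [h2, mul_one] at h1
    have := h.pos
    field_simp
    linarith
  obtain ⟨a, -, k, hk, hlim⟩ := exists_weakly_convergent_subseq hb
  have hweak : ∀ g, Tendsto (fun n ↦ inner ℂ g (B (f (k n)))) atTop (𝓝 (inner ℂ g (B a))) :=
    fun g ↦ by simpa only [h.inner_comm] using hlim (B g)
  have hzero : ∀ g, Tendsto (fun n ↦ inner ℂ g (B (f (k n)))) atTop (𝓝 0) := fun g ↦ by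
    simp only [hf]
    exact (hon.tendsto_inner_zero g).comp hk.tendsto_atTop
  have ha : a = 0 := by
    apply h.injective
    rw [map_zero]
    exact inner_self_eq_zero.1 (tendsto_nhds_unique (hweak (B a)) (hzero (B a)))
  have hK := h.completelyContinuous.tendsto (fun n ↦ hb (k n)) hlim
  rw [ha, map_zero] at hK
  -- Pairing the eigenvalue equation with Bf and using κ Re⟨Bf, f⟩ ≥ κ‖Bf‖² = κ leaves Re⟨Bf, Kf⟩ ≤
  -- t ≤ -τ. This contradicts Kf → 0.
  have key : ∀ n, τ ≤ ‖K (f (k n))‖ := fun n ↦ by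
    have h1 := congrArg (fun v ↦ (inner ℂ (B (f (k n))) v).re) (heq (k n))
    have h2 : ‖B (f (k n))‖ = 1 := by rw [hf]; exact hon.1 _
    simp only [add_apply, sub_apply,
      smul_apply, one_apply_eq_self, inner_add_right,
      inner_sub_right, inner_smul_right, inner_zero_right, ← Complex.ofReal_add,
      Complex.add_re, Complex.sub_re, Complex.re_ofReal_mul, Complex.zero_re] at h1
    have h6 : (inner ℂ (B (f (k n))) (B (f (k n)))).re = 1 := by
      have := inner_self_eq_norm_sq (𝕜 := ℂ) (B (f (k n)))
      rw [h2] at this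
      simpa using this
    have h3 := h.norm_sq_le (f (k n))
    have h4 : |(inner ℂ (B (f (k n))) (K (f (k n)))).re| ≤ ‖K (f (k n))‖ := by
      refine (Complex.abs_re_le_norm _).trans ((norm_inner_le_norm _ _).trans ?_)
      rw [h2, one_mul]
    rw [h2] at h3
    rw [h6] at h1
    have h5 := (abs_le.1 h4).1
    nlinarith [h.pos, (ht (k n)).2]
  have := le_of_tendsto_of_tendsto' tendsto_const_nhds hK.norm key
  rw [norm_zero] at this
  linarith

/-- Infinitely many points would be distinct real eigenvalues, whose normalized eigenvectors are
orthogonal by symmetry; `not_orthonormal_eigenvectors` excludes this. -/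
theorem finite_spectrum_inter [CompleteSpace E] [TopologicalSpace.SeparableSpace E]
    (h : IsCompactPerturbation κ B K T) {M τ : ℝ} (hτ : 0 < τ) :
    {z : ℂ | z ∈ spectrumOf T ∧ -M ≤ z.re ∧ z.re ≤ -τ}.Finite := by
  by_contra hinf
  set S := {z : ℂ | z ∈ spectrumOf T ∧ -M ≤ z.re ∧ z.re ≤ -τ} with hS
  have hS' : S.Infinite := hinf
  let e := hS'.natEmbedding
  have hev : ∀ n, ∃ ψ : T.domain, ‖(ψ : E)‖ = 1 ∧ T ψ = (((e n : ℂ).re : ℝ) : ℂ) • (ψ : E) ∧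
      (e n : ℂ) = (e n : ℂ).re := fun n ↦ by
    have hn : (e n : ℂ) ∈ S := (e n).2
    obtain ⟨ψ, hψ0, hψ⟩ := h.exists_eigenvector (z := e n)
      (fun r hr hz ↦ by
        have := hn.2.2
        rw [hz, Complex.ofReal_re] at this
        linarith) hn.1
    have hre := h.eigenvalue_real hψ0 hψ
    have hne : ‖(ψ : E)‖ ≠ 0 := by simpa using hψ0
    refine ⟨((‖(ψ : E)‖⁻¹ : ℝ) : ℂ) • ψ, ?_, ?_, hre⟩
    · rw [Submodule.coe_smul, norm_smul, Complex.norm_real, norm_inv, norm_norm,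
        inv_mul_cancel₀ hne]
    · rw [LinearPMap.map_smul, hψ, ← hre, Submodule.coe_smul, smul_comm]
  choose ψ hn hψ hre using hev
  refine h.not_orthonormal_eigenvectors hτ (t := fun n ↦ (e n : ℂ).re)
    (fun n ↦ ⟨(e n).2.2.1, (e n).2.2.2⟩) hψ ⟨hn, fun m n hmn ↦ ?_⟩
  refine h.inner_eigenvectors (fun heq ↦ hmn ?_) (hψ m) (hψ n)
  apply e.injective
  apply Subtype.ext
  rw [hre m, hre n]
  exact congrArg _ heq

/-- Gram–Schmidt in an infinite-dimensional eigenspace would give an orthonormal sequence with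
constant eigenvalue `t`, again excluded. -/
theorem finiteDimensional_eigenspace [CompleteSpace E] [TopologicalSpace.SeparableSpace E]
    (h : IsCompactPerturbation κ B K T) {t : ℝ} (ht : t < 0) :
    FiniteDimensional ℂ (eigenspaceOf T t) := by
  set N : Submodule ℂ E := (eigenspaceOf T t).map T.domain.subtype with hN
  have hequiv : eigenspaceOf T t ≃ₗ[ℂ] N :=
    Submodule.equivMapOfInjective _ T.domain.injective_subtype _
  suffices FiniteDimensional ℂ N from hequiv.symm.finiteDimensional
  by_contra hfin
  have hrank : Cardinal.aleph0 ≤ Module.rank ℂ N := by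
    rwa [← not_lt, Module.rank_lt_aleph0_iff]
  obtain ⟨s, hs, hli⟩ := le_rank_iff_exists_linearIndependent.1 hrank
  have hinf : Infinite s := Cardinal.infinite_iff.2 hs.ge
  let e := Infinite.natEmbedding s
  have hon := InnerProductSpace.gramSchmidtNormed_orthonormal
    (f := fun n ↦ ((e n : s) : N)) (hli.linearIndependent.comp e e.injective)
  set g := InnerProductSpace.gramSchmidtNormed ℂ fun n ↦ ((e n : s) : N)
  have hmem : ∀ n, ∃ ψ : T.domain, (ψ : E) = g n ∧ T ψ = (t : ℂ) • (ψ : E) := fun n ↦ by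
    obtain ⟨ψ, hψ, hψg⟩ := (g n).2
    refine ⟨ψ, hψg, ?_⟩
    have : T.toFun ψ - (t : ℂ) • (ψ : E) = 0 := hψ
    exact sub_eq_zero.1 this
  choose ψ hψg hψ using hmem
  refine h.not_orthonormal_eigenvectors (M := -t) (τ := -t) (by linarith) (t := fun _ ↦ t)
    (fun _ ↦ ⟨by simp, by simp⟩) hψ ?_
  simp only [hψg]
  exact hon.comp_linearIsometry N.subtypeₗᵢ

/-- The essential spectrum is contained in `[0, ∞)`. -/
theorem nonneg_of_mem_essentialSpectrum [CompleteSpace E] [TopologicalSpace.SeparableSpace E]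
    (h : IsCompactPerturbation κ B K T) {t : ℝ} (ht : (t : ℂ) ∈ essentialSpectrum T) : 0 ≤ t := by
  by_contra! hneg
  refine ht.2 ⟨ht.1, ?_, ?_, h.finiteDimensional_eigenspace hneg⟩
  -- The strip 2t ≤ Re z ≤ t/2 surrounds t and contains finitely many spectral points, so t is
  -- isolated.
  · have hfin := (h.finite_spectrum_inter (M := -(2 * t)) (τ := -(t / 2)) (by linarith)).sdiff
      (t := {(t : ℂ)})
    obtain ⟨r, hr, hball⟩ := Metric.isOpen_iff.1 hfin.isClosed.isOpen_compl (t : ℂ) (by simp)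
    refine ⟨min r (-(t / 2)), lt_min hr (by linarith), ?_⟩
    ext z
    simp only [Set.mem_inter_iff, Metric.mem_ball, lt_min_iff, Set.mem_singleton_iff]
    refine ⟨fun ⟨hz, hz1, hz2⟩ ↦ ?_, ?_⟩
    · have h1 := hball hz1
      by_contra hne
      refine h1 ⟨⟨hz, ?_⟩, hne⟩
      have h2 : |(z - t).re| < -(t / 2) := (Complex.abs_re_le_norm _).trans_lt (by
        rwa [← dist_eq_norm])
      rw [Complex.sub_re, Complex.ofReal_re, abs_lt] at h2
      constructor <;> linarith
    · rintro rfl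
      exact ⟨ht.1, by simpa using hr, by rw [dist_self]; linarith⟩
  · obtain ⟨ψ, hψ0, hψ⟩ := h.exists_eigenvector (z := (t : ℂ))
      (fun r hr hz ↦ by
        have : t = r := by exact_mod_cast hz
        linarith) ht.1
    refine (Submodule.ne_bot_iff _).2 ⟨ψ, ?_, hψ0⟩
    change T.toFun ψ - (t : ℂ) • (ψ : E) = 0
    exact sub_eq_zero.2 hψ

/-- Weyl's criterion for the unperturbed operator gives points of the spectrum. -/
theorem mem_spectrumOf_of_orthonormal (h : IsCompactPerturbation κ B K T) {t : ℝ}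
    {f : ℕ → E} (hf : Orthonormal ℂ f)
    (hlim : Tendsto (fun n ↦ (κ : ℂ) • f n - (κ + t : ℂ) • B (f n)) atTop (𝓝 0)) :
    (t : ℂ) ∈ spectrumOf T := by
  rintro ⟨S, -, hS⟩
  -- Orthonormality gives K f_n → 0, hence (T - t)B f_n → 0. An inverse `S` would force B f_n → 0
  -- and then κ f_n → 0, against ‖f_n‖ = 1.
  have hK := h.completelyContinuous f 1 (fun n ↦ (hf.1 n).le) hf.tendsto_inner_zero
  have h1 : Tendsto (fun n ↦ B (f n)) atTop (𝓝 0) := by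
    have h2 := (S.continuous.tendsto _).comp (hlim.add hK)
    rw [add_zero, map_zero] at h2
    refine h2.congr fun n ↦ ?_
    have h3 := hS ⟨B (f n), h.mem_domain _⟩
    rw [h.apply_sub] at h3
    simpa using h3
  have h4 := hlim.add (h1.const_smul (κ + t : ℂ))
  simp only [sub_add_cancel, smul_zero, add_zero] at h4
  have h5 := h4.norm
  simp only [norm_smul, hf.1, mul_one, norm_zero, Complex.norm_real] at h5
  have := tendsto_nhds_unique h5 tendsto_const_nhds
  exact h.pos.ne' (abs_eq_zero.1 (by simpa using this.symm))

end IsCompactPerturbation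

end HilbertSpace

/-! ### Multiplication operators and the resolvent of the Laplacian -/

noncomputable section Resolvent

open FourierTransform TemperedDistribution

instance : Fact ((2 : ENNReal) ≠ ⊤) := ⟨by simp⟩

instance : TopologicalSpace.SeparableSpace L2R3 :=
  haveI : SecondCountableTopology L2R3 := Lp.SecondCountableTopology
  inferInstance

theorem integrable_inner (f g : L2R3) : Integrable (fun x : R3 ↦ inner ℂ (f x : ℂ) (g x)) :=
  L2.integrable_inner f g

theorem re_inner_eq_integral (f g : L2R3) :
    (inner ℂ f g).re = ∫ x : R3, (inner ℂ (f x : ℂ) (g x : ℂ)).re := by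
  rw [L2.inner_def]
  exact (integral_re (𝕜 := ℂ) (L2.integrable_inner (𝕜 := ℂ) f g)).symm

theorem integrable_norm_sq (f : L2R3) : Integrable (fun x ↦ ‖f x‖ ^ 2) :=
  (Lp.memLp f).integrable_norm_pow two_ne_zero

theorem norm_sq_eq_integral (f : L2R3) : ‖f‖ ^ 2 = ∫ x, ‖f x‖ ^ 2 := by
  have h := re_inner_eq_integral f f
  have h1 : (inner ℂ f f).re = ‖f‖ ^ 2 := inner_self_eq_norm_sq (𝕜 := ℂ) f
  rw [← h1, h]
  refine integral_congr_ae (ae_of_all _ fun x ↦ ?_)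
  exact inner_self_eq_norm_sq (𝕜 := ℂ) (f x)

/-- The weight `L² / (L² + |x|²)`. -/
def weight (L : ℝ) (x : R3) : ℝ := L ^ 2 / (L ^ 2 + ‖x‖ ^ 2)

theorem weight_nonneg (L : ℝ) (x : R3) : 0 ≤ weight L x := by unfold weight; positivity

theorem weight_le_one (L : ℝ) (x : R3) : weight L x ≤ 1 := by
  unfold weight
  exact div_le_one_of_le₀ (by nlinarith [sq_nonneg ‖x‖]) (by positivity)

theorem weight_pos {L : ℝ} (hL : L ≠ 0) (x : R3) : 0 < weight L x := by unfold weight; positivity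

/-- Replaces the multiplier |x|²θ by L²(1 - θ), a bounded smooth function of temperate growth that
preserves L². Most later estimates rest on this identity. -/
theorem norm_sq_mul_weight {L : ℝ} (hL : L ≠ 0) (x : R3) :
    ‖x‖ ^ 2 * weight L x = L ^ 2 * (1 - weight L x) := by
  unfold weight
  have : L ^ 2 + ‖x‖ ^ 2 ≠ 0 := by positivity
  field_simp
  ring

theorem weight_eq_rpow {L : ℝ} (hL : L ≠ 0) (x : R3) :
    weight L x = (1 + ‖L⁻¹ • x‖ ^ 2) ^ (-1 : ℝ) := by
  rw [Real.rpow_neg_one, norm_smul, mul_pow, norm_inv, Real.norm_eq_abs, inv_pow, sq_abs]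
  unfold weight
  field_simp

theorem weight_hasTemperateGrowth {L : ℝ} (hL : L ≠ 0) :
    (weight L).HasTemperateGrowth := by
  have h1 : weight L = (fun y : R3 ↦ (1 + ‖y‖ ^ 2) ^ (-1 : ℝ)) ∘
      (L⁻¹ • ContinuousLinearMap.id ℝ R3) := by
    ext x
    simp [weight_eq_rpow hL]
  rw [h1]
  exact (Function.hasTemperateGrowth_one_add_norm_sq_rpow R3 (-1)).comp
    (ContinuousLinearMap.hasTemperateGrowth _)

theorem ofReal_weight_hasTemperateGrowth {L : ℝ} (hL : L ≠ 0) :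
    (fun x ↦ (weight L x : ℂ)).HasTemperateGrowth :=
  Function.Complex.hasTemperateGrowth_ofReal.comp (weight_hasTemperateGrowth hL)

theorem continuous_weight (L : ℝ) : Continuous (weight L) := by
  rcases eq_or_ne L 0 with rfl | hL
  · have : weight 0 = fun _ ↦ 0 := by ext x; simp [weight]
    rw [this]
    exact continuous_const
  · exact (weight_hasTemperateGrowth hL).1.continuous

theorem memLp_top_weight (L : ℝ) : MemLp (fun x ↦ (weight L x : ℂ)) ⊤ (volume : Measure R3) := by
  refine memLp_top_of_bound
    (Complex.continuous_ofReal.comp (continuous_weight L)).aestronglyMeasurable 1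
    (ae_of_all _ fun x ↦ ?_)
  rw [Complex.norm_real, Real.norm_eq_abs, abs_of_nonneg (weight_nonneg L x)]
  exact weight_le_one L x

/-- Dimension three enters here: (1 + |x|²)⁻² decays like |x|⁻⁴, and 4 > 3. -/
theorem memLp_two_weight_one : MemLp (weight 1) 2 (volume : Measure R3) := by
  rw [memLp_two_iff_integrable_sq (continuous_weight 1).aestronglyMeasurable]
  have h := integrable_rpow_neg_one_add_norm_sq (E := R3) (μ := volume) (r := 4)
    (by simp; norm_num)
  refine h.congr (ae_of_all _ fun x ↦ ?_)
  simp only [weight_eq_rpow one_ne_zero, inv_one, one_smul]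
  rw [← Real.rpow_mul_natCast (by positivity)]
  norm_num

/-- Multiplication by `weight L` in `L²(ℝ³)`. -/
def weightMul (L : ℝ) : L2R3 →L[ℂ] L2R3 :=
  LinearMap.mkContinuous
    { toFun := fun f ↦ ((memLp_top_weight L).toLp _ • f : Lp ℂ 2 volume)
      map_add' := fun f g ↦ Lp.add_smul _ f g
      map_smul' := fun c f ↦ (Lp.smul_comm c _ f).symm }
    1 (fun f ↦ by
      rw [one_mul]
      refine Lp.norm_le_norm_of_ae_le ?_
      filter_upwards [Lp.coeFn_lpSMul (r := 2) ((memLp_top_weight L).toLp _) f,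
        (memLp_top_weight L).coeFn_toLp] with x h1 h2
      simp only [LinearMap.coe_mk, AddHom.coe_mk, h1, Pi.smul_apply', h2, smul_eq_mul, norm_mul,
        Complex.norm_real, Real.norm_eq_abs, abs_of_nonneg (weight_nonneg L x)]
      exact mul_le_of_le_one_left (norm_nonneg _) (weight_le_one L x))

theorem coeFn_weightMul (L : ℝ) (f : L2R3) :
    weightMul L f =ᵐ[volume] fun x ↦ (weight L x : ℂ) * f x := by
  filter_upwards [Lp.coeFn_lpSMul (r := 2) ((memLp_top_weight L).toLp _) f,
    (memLp_top_weight L).coeFn_toLp] with x h1 h2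
  change ((memLp_top_weight L).toLp _ • f : Lp ℂ 2 volume) x = _
  simp [h1, h2]

theorem norm_weightMul_le (L : ℝ) (f : L2R3) : ‖weightMul L f‖ ≤ ‖f‖ := by
  refine Lp.norm_le_norm_of_ae_le ?_
  filter_upwards [coeFn_weightMul L f] with x h
  rw [h, norm_mul, Complex.norm_real, Real.norm_eq_abs, abs_of_nonneg (weight_nonneg L x)]
  exact mul_le_of_le_one_left (norm_nonneg _) (weight_le_one L x)

theorem toTemperedDistribution_weightMul {L : ℝ} (hL : L ≠ 0) (f : L2R3) :
    ((weightMul L f : L2R3) : 𝓢'(R3, ℂ))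
      = smulLeftCLM ℂ (fun x ↦ (weight L x : ℂ)) (f : 𝓢'(R3, ℂ)) :=
  Lp.toTemperedDistribution_smul_eq (ofReal_weight_hasTemperateGrowth hL) (memLp_top_weight L) f

theorem inner_weightMul_comm (L : ℝ) (f g : L2R3) :
    inner ℂ (weightMul L f) g = inner ℂ f (weightMul L g) := by
  rw [L2.inner_def, L2.inner_def]
  refine integral_congr_ae ?_
  filter_upwards [coeFn_weightMul L f, coeFn_weightMul L g] with x h1 h2
  simp only [h1, h2, RCLike.inner_apply, map_mul, Complex.conj_ofReal]
  ring

/-- The square of the frequency unit `2π`. -/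
abbrev freqSq : ℝ := (2 * Real.pi) ^ 2

/-- The operator `(1 - Δ / (2π)²)⁻¹`. -/
def besselInv : L2R3 →L[ℂ] L2R3 :=
  fourierInvCLM ℂ L2R3 ∘L weightMul 1 ∘L fourierCLM ℂ L2R3

theorem besselInv_apply (f : L2R3) : besselInv f = 𝓕⁻ (weightMul 1 (𝓕 f)) := rfl

theorem fourier_besselInv (f : L2R3) : 𝓕 (besselInv f) = weightMul 1 (𝓕 f) := by
  rw [besselInv_apply, fourier_fourierInv_eq]

theorem toTemperedDistribution_besselInv (f : L2R3) :
    ((besselInv f : L2R3) : 𝓢'(R3, ℂ)) = besselPotential R3 ℂ (-2) (f : 𝓢'(R3, ℂ)) := by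
  rw [besselInv_apply, ← Lp.fourierInv_toTemperedDistribution_eq,
    toTemperedDistribution_weightMul one_ne_zero, ← Lp.fourier_toTemperedDistribution_eq,
    besselPotential, fourierMultiplierCLM_apply]
  congr 3
  ext x
  rw [weight_eq_rpow one_ne_zero]
  norm_num

/-- The Fourier transform carries 2π in its exponent, so -Δ has symbol (2π)²|ξ|² and the symbol 1 +
|ξ|² belongs to 1 - Δ/(2π)². -/
theorem besselPotential_two_eq (u : 𝓢'(R3, ℂ)) :
    besselPotential R3 ℂ 2 u = u - ((freqSq⁻¹ : ℝ) : ℂ) • Δ u := by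
  have h1 : besselPotential R3 ℂ 2 u = fourierMultiplierCLM ℂ (fun _ : R3 ↦ (1 : ℂ)) u
      + fourierMultiplierCLM ℂ (fun x : R3 ↦ Complex.ofReal (‖x‖ ^ 2)) u := by
    simp only [besselPotential, fourierMultiplierCLM_apply]
    rw [← FourierTransform.fourierInv_add, ← add_apply, ← smulLeftCLM_add
      (by fun_prop) (by fun_prop)]
    congr 3
    ext x
    simp
  have h2 : ((freqSq⁻¹ : ℝ) : ℂ) • Δ u
      = -fourierMultiplierCLM ℂ (fun x : R3 ↦ Complex.ofReal (‖x‖ ^ 2)) u := by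
    rw [laplacian_eq_fourierMultiplierCLM, ← Complex.coe_smul (-(2 * Real.pi) ^ 2), smul_smul,
      ← Complex.ofReal_mul]
    have : freqSq⁻¹ * -(2 * Real.pi) ^ 2 = -1 := by
      have : (2 * Real.pi) ^ 2 ≠ 0 := by positivity
      unfold freqSq
      field_simp
    rw [this, Complex.ofReal_neg, Complex.ofReal_one, neg_one_smul]
  rw [h1, h2, fourierMultiplierCLM_const]
  simp

theorem besselInv_mem (f : L2R3) : besselInv f ∈ H2R3 := by
  refine ⟨f, ?_⟩
  rw [toTemperedDistribution_besselInv, besselPotential_besselPotential_apply]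
  simp

theorem exists_besselInv_eq {ψ : L2R3} (hψ : ψ ∈ H2R3) : ∃ f, besselInv f = ψ := by
  obtain ⟨f, hf⟩ := hψ
  refine ⟨f, toTemperedDistribution_inj ?_⟩
  rw [toTemperedDistribution_besselInv, ← hf, besselPotential_besselPotential_apply]
  simp

theorem besselInv_injective : Function.Injective besselInv := by
  intro f g hfg
  apply toTemperedDistribution_inj
  have h : ∀ f : L2R3, besselPotential R3 ℂ 2 ((besselInv f : L2R3) : 𝓢'(R3, ℂ)) = f := fun f ↦ by
    rw [toTemperedDistribution_besselInv, besselPotential_besselPotential_apply]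
    simp
  rw [← h f, ← h g, hfg]

theorem laplacianL2_besselInv (f : L2R3) (hf : besselInv f ∈ H2R3) :
    laplacianL2 ⟨besselInv f, hf⟩ = (freqSq : ℂ) • (besselInv f - f) := by
  apply toTemperedDistribution_inj
  rw [laplacianL2_spec]
  have h : besselPotential R3 ℂ 2 ((besselInv f : L2R3) : 𝓢'(R3, ℂ)) = f := by
    rw [toTemperedDistribution_besselInv, besselPotential_besselPotential_apply]
    simp
  rw [besselPotential_two_eq] at h
  have h2 : ((freqSq : ℂ)) * ((freqSq⁻¹ : ℝ) : ℂ) = 1 := by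
    rw [← Complex.ofReal_mul, mul_inv_cancel₀ (by unfold freqSq; positivity), Complex.ofReal_one]
  simp only [← Lp.toTemperedDistributionCLM_apply, map_smul, map_sub] at h ⊢
  rw [← h, sub_sub_cancel, smul_smul, h2, one_smul]

theorem besselInv_inner_comm (f g : L2R3) :
    inner ℂ (besselInv f) g = inner ℂ f (besselInv g) := by
  rw [← Lp.inner_fourier_eq, ← Lp.inner_fourier_eq f, fourier_besselInv, fourier_besselInv,
    inner_weightMul_comm]

theorem besselInv_norm_sq_le (f : L2R3) :
    ‖besselInv f‖ ^ 2 ≤ (inner ℂ (besselInv f) f).re := by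
  rw [← Lp.inner_fourier_eq, ← Lp.norm_fourier_eq, fourier_besselInv, norm_sq_eq_integral,
    re_inner_eq_integral]
  refine integral_mono_ae (integrable_norm_sq _) (integrable_inner _ _).re ?_
  filter_upwards [coeFn_weightMul 1 (𝓕 f)] with x hx
  have h0 := weight_nonneg 1 x
  have h1 := weight_le_one 1 x
  have h2 : (inner ℂ ((weight 1 x : ℂ) * (𝓕 f : L2R3) x) ((𝓕 f : L2R3) x : ℂ)).re
      = weight 1 x * ‖(𝓕 f : L2R3) x‖ ^ 2 := by
    rw [← smul_eq_mul, inner_smul_left, Complex.conj_ofReal, Complex.re_ofReal_mul]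
    congr 1
    exact inner_self_eq_norm_sq (𝕜 := ℂ) ((𝓕 f : L2R3) x)
  simp only [hx]
  refine le_of_le_of_eq ?_ h2.symm
  rw [norm_mul, Complex.norm_real, Real.norm_eq_abs, abs_of_nonneg h0, mul_pow]
  gcongr
  nlinarith

end Resolvent

/-! ### Local compactness and Weyl sequences for the free Laplacian. -/

noncomputable section Rellich

open FourierTransform TemperedDistribution
open scoped ContDiff

/-- The Fourier kernel of the operator `besselInv`. -/
def besselKernel (x ξ : R3) : ℂ := (weight 1 ξ : ℂ) * (Real.fourierChar (-inner ℝ ξ x) : ℂ)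

theorem memLp_besselKernel (x : R3) : MemLp (besselKernel x) 2 volume := by
  refine memLp_two_weight_one.of_le ?_ (ae_of_all _ fun ξ ↦ ?_)
  · apply Continuous.aestronglyMeasurable
    unfold besselKernel
    have := continuous_weight 1
    fun_prop
  · rw [besselKernel, norm_mul, Circle.norm_coe, mul_one, Complex.norm_real]

theorem integrable_weight_one_mul (f : L2R3) : Integrable fun ξ ↦ (weight 1 ξ : ℂ) * f ξ :=
  memLp_two_weight_one.ofReal.integrable_mul (Lp.memLp f)

theorem inner_besselKernel (f : L2R3) (x : R3) :
    inner ℂ ((memLp_besselKernel x).toLp _) f = VectorFourier.fourierIntegral Real.fourierChar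
      volume (-innerₗ R3) (fun ξ ↦ (weight 1 ξ : ℂ) * f ξ) x := by
  rw [L2.inner_def, VectorFourier.fourierIntegral]
  refine integral_congr_ae ?_
  filter_upwards [(memLp_besselKernel x).coeFn_toLp] with ξ hξ
  rw [hξ, RCLike.inner_apply, besselKernel, map_mul, Circle.smul_def]
  simp only [Complex.conj_ofReal, ← Circle.coe_inv_eq_conj, ← AddChar.map_neg_eq_inv, neg_neg,
    LinearMap.neg_apply, innerₗ_apply_apply, smul_eq_mul]
  ring

/-- Pointwise representation of `besselInv f`. -/
theorem besselInv_ae_eq (f : L2R3) :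
    ∀ᵐ x, besselInv f x = inner ℂ ((memLp_besselKernel x).toLp _) (𝓕 f) := by
  simp only [inner_besselKernel]
  set h : R3 → ℂ := fun ξ ↦ (weight 1 ξ : ℂ) * (𝓕 f : L2R3) ξ with hh
  have hint : Integrable h := integrable_weight_one_mul _
  have hcont : Continuous fun p : R3 × R3 ↦ (-innerₗ R3) p.1 p.2 := by
    simp only [LinearMap.neg_apply, innerₗ_apply_apply]
    fun_prop
  -- Both sides are tested against smooth compactly supported functions. The inverse Fourier
  -- transform, encoded by the pairing `-innerₗ R3`, is moved onto the test function and back, the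
  -- weighted transform being integrable.
  refine ae_eq_of_integral_contDiff_smul_eq
    ((Lp.memLp (besselInv f)).locallyIntegrable (by norm_num))
    (VectorFourier.fourierIntegral_continuous Real.continuous_fourierChar hcont
      hint).locallyIntegrable fun g hg hgs ↦ ?_
  have hgs' : HasCompactSupport fun x ↦ (g x : ℂ) := hgs.comp_left Complex.ofReal_zero
  have hg' : ContDiff ℝ ∞ fun x ↦ (g x : ℂ) := Complex.ofRealCLM.contDiff.comp hg
  set φ : 𝓢(R3, ℂ) := hgs'.toSchwartzMap hg' with hφ
  have h1 : ((besselInv f : L2R3) : 𝓢'(R3, ℂ)) φ = ∫ x, g x • besselInv f x := by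
    rw [Lp.toTemperedDistribution_apply]
    rfl
  have h2 : ((besselInv f : L2R3) : 𝓢'(R3, ℂ)) φ = ∫ ξ, (𝓕⁻ φ) ξ • h ξ := by
    rw [besselInv_apply, ← Lp.fourierInv_toTemperedDistribution_eq,
      TemperedDistribution.fourierInv_apply, Lp.toTemperedDistribution_apply]
    refine integral_congr_ae ?_
    filter_upwards [coeFn_weightMul 1 (𝓕 f)] with ξ hξ
    rw [hξ]
  have h3 : ∀ ξ, (𝓕⁻ φ) ξ = VectorFourier.fourierIntegral Real.fourierChar volume (-innerₗ R3)
      φ ξ := fun ξ ↦ by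
    rw [SchwartzMap.fourierInv_coe, Real.fourierInv_eq, VectorFourier.fourierIntegral]
    simp
  rw [← h1, h2]
  simp only [h3]
  rw [VectorFourier.integral_fourierIntegral_smul_eq_flip Real.continuous_fourierChar hcont
    φ.integrable hint]
  refine integral_congr_ae (ae_of_all _ fun x ↦ ?_)
  have h4 : (-innerₗ R3).flip = -innerₗ R3 := by
    ext a b
    simp [real_inner_comm]
  simp only [h4]
  rfl

theorem norm_besselKernel_le (x : R3) :
    ‖(memLp_besselKernel x).toLp _‖ ≤ (eLpNorm (weight 1) 2 (volume : Measure R3)).toReal := by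
  rw [Lp.norm_toLp]
  refine ENNReal.toReal_mono memLp_two_weight_one.2.ne (eLpNorm_mono fun ξ ↦ ?_)
  rw [besselKernel, norm_mul, Circle.norm_coe, mul_one, Complex.norm_real]

/-- A local form of Rellich's theorem. -/
theorem isCompletelyContinuous_weightMul_besselInv :
    IsCompletelyContinuous (weightMul 1 ∘L besselInv) := by
  intro f C hf hweak
  set D := (eLpNorm (weight 1) 2 (volume : Measure R3)).toReal with hD
  have hrep : ∀ᵐ x, ∀ n, besselInv (f n) x = inner ℂ ((memLp_besselKernel x).toLp _) (𝓕 (f n)) :=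
    ae_all_iff.2 fun n ↦ besselInv_ae_eq (f n)
  have hmul : ∀ᵐ x, ∀ n, weightMul 1 (besselInv (f n)) x = (weight 1 x : ℂ) * besselInv (f n) x :=
    ae_all_iff.2 fun n ↦ coeFn_weightMul 1 (besselInv (f n))
  -- The value of B f_n at x is a pairing with a fixed L² kernel, so weak convergence becomes
  -- pointwise convergence. Since the kernel norms are bounded in x, the square-integrable weight
  -- dominates.
  have hpt : ∀ x : R3, Tendsto (fun n ↦ inner ℂ ((memLp_besselKernel x).toLp _) (𝓕 (f n)))
      atTop (𝓝 0) := fun x ↦ by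
    have h := hweak (𝓕⁻ ((memLp_besselKernel x).toLp _ : L2R3))
    refine h.congr fun n ↦ ?_
    rw [← Lp.inner_fourier_eq, fourier_fourierInv_eq]
  have hbd : ∀ (x : R3) n, ‖inner ℂ ((memLp_besselKernel x).toLp _) (𝓕 (f n))‖ ≤ D * C :=
    fun x n ↦ (norm_inner_le_norm _ _).trans (by
      rw [Lp.norm_fourier_eq]
      exact mul_le_mul (norm_besselKernel_le x) (hf n) (norm_nonneg _) ENNReal.toReal_nonneg)
  have hlim : Tendsto (fun n ↦ ∫ x, ‖(weightMul 1 ∘L besselInv) (f n) x‖ ^ 2) atTop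
      (𝓝 (∫ _ : R3, (0 : ℝ))) := by
    refine tendsto_integral_of_dominated_convergence (fun x ↦ (weight 1 x) ^ 2 * (D * C) ^ 2)
      (fun n ↦ (integrable_norm_sq _).1) ?_ (fun n ↦ ?_) ?_
    · exact ((memLp_two_iff_integrable_sq memLp_two_weight_one.1).1
        memLp_two_weight_one).mul_const _
    · filter_upwards [hrep, hmul] with x h1 h2
      rw [ContinuousLinearMap.comp_apply, h2, h1, norm_mul, Complex.norm_real,
        Real.norm_of_nonneg (weight_nonneg 1 x), Real.norm_of_nonneg (by positivity), mul_pow]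
      have := hbd x n
      have := weight_nonneg 1 x
      gcongr
    · filter_upwards [hrep, hmul] with x h1 h2
      simp only [ContinuousLinearMap.comp_apply, h2, h1]
      have h3 := (((hpt x).const_mul (weight 1 x : ℂ)).norm.pow 2)
      simpa using h3
  rw [integral_zero] at hlim
  rw [tendsto_zero_iff_norm_tendsto_zero]
  have h4 := (Real.continuous_sqrt.tendsto 0).comp hlim
  rw [Real.sqrt_zero] at h4
  refine h4.congr fun n ↦ ?_
  simp only [Function.comp_apply, ← norm_sq_eq_integral]
  exact Real.sqrt_sq (norm_nonneg _)

/-- The multiplier `κ - (κ + t) (1 + |ξ|²)⁻¹` has approximate zero modes for `t ≥ 0`. -/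
theorem exists_orthonormal_tendsto_zero {t : ℝ} (ht : 0 ≤ t) :
    ∃ f : ℕ → L2R3, Orthonormal ℂ f ∧
      Tendsto (fun n ↦ (freqSq : ℂ) • f n - (freqSq + t : ℂ) • besselInv (f n)) atTop (𝓝 0) := by
  set κ : ℝ := freqSq
  have hκ : 0 < κ := by unfold κ freqSq; positivity
  -- A zero of the symbol: κ - (κ + t)/(1 + |ξ|²) vanishes exactly when |ξ|² = t/κ.
  set ξ₀ : R3 := EuclideanSpace.single 0 (Real.sqrt (t / κ)) with hξ₀
  set q : R3 → ℝ := fun ξ ↦ κ - (κ + t) * weight 1 ξ with hq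
  have hqc : Continuous q := by
    have := continuous_weight 1
    unfold q
    fun_prop
  have hq0 : q ξ₀ = 0 := by
    have : ‖ξ₀‖ ^ 2 = t / κ := by
      rw [hξ₀, PiLp.norm_single, Real.norm_eq_abs, sq_abs, Real.sq_sqrt (by positivity)]
    simp only [hq, weight, this]
    field_simp
    ring
  -- Disjoint open shells shrinking to ξ₀: their normalized indicators are orthonormal, and the
  -- symbol tends to zero uniformly on them.
  set A : ℕ → Set R3 := fun n ↦ Metric.ball ξ₀ (1 / ((n : ℝ) + 1)) \
    Metric.closedBall ξ₀ (1 / ((n : ℝ) + 2)) with hA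
  have hAo : ∀ n, IsOpen (A n) := fun n ↦ Metric.isOpen_ball.sdiff Metric.isClosed_closedBall
  have hlt : ∀ n : ℕ, 1 / ((n : ℝ) + 2) < 1 / ((n : ℝ) + 1) := fun n ↦ by
    apply one_div_lt_one_div_of_lt <;> linarith [(Nat.cast_nonneg n : (0 : ℝ) ≤ n)]
  have hAne : ∀ n, (A n).Nonempty := fun n ↦ by
    set r := (1 / ((n : ℝ) + 2) + 1 / ((n : ℝ) + 1)) / 2 with hr
    have h0 : 0 < 1 / ((n : ℝ) + 2) := by positivity
    have hd : dist (ξ₀ + EuclideanSpace.single 0 r) ξ₀ = r := by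
      rw [dist_eq_norm, add_sub_cancel_left, PiLp.norm_single, Real.norm_eq_abs,
        abs_of_nonneg (by positivity)]
    refine ⟨ξ₀ + EuclideanSpace.single 0 r, ?_, ?_⟩
    · rw [Metric.mem_ball, hd]
      linarith [hlt n]
    · rw [Metric.mem_closedBall, hd, not_le]
      linarith [hlt n]
  have hAfin : ∀ n, volume (A n) ≠ ⊤ := fun n ↦
    ((measure_mono Set.sdiff_subset).trans_lt measure_ball_lt_top).ne
  have hApos : ∀ n, volume (A n) ≠ 0 := fun n ↦ ((hAo n).measure_pos volume (hAne n)).ne'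
  have hdisj : ∀ m n, m < n → Disjoint (A m) (A n) := fun m n hmn ↦ by
    rw [Set.disjoint_left]
    rintro ξ ⟨-, h1⟩ ⟨h2, -⟩
    apply h1
    rw [Metric.mem_ball] at h2
    rw [Metric.mem_closedBall]
    refine h2.le.trans (one_div_le_one_div_of_le (by positivity) ?_)
    have : (m : ℝ) + 1 ≤ n := by exact_mod_cast hmn
    linarith
  set e : ℕ → L2R3 := fun n ↦ indicatorConstLp 2 (hAo n).measurableSet (hAfin n)
    (((volume.real (A n)) ^ (-(1 / 2 : ℝ)) : ℝ) : ℂ) with he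
  have hnorm : ∀ n, ‖e n‖ = 1 := fun n ↦ by
    have h0 : 0 < volume.real (A n) := ENNReal.toReal_pos (hApos n) (hAfin n)
    rw [he, norm_indicatorConstLp two_ne_zero ENNReal.ofNat_ne_top, Complex.norm_real,
      Real.norm_eq_abs, abs_of_nonneg (by positivity)]
    rw [ENNReal.toReal_ofNat, ← Real.rpow_add h0]
    norm_num
  have hon : Orthonormal ℂ e := by
    refine ⟨hnorm, ?_⟩
    have h1 : ∀ m n, m < n → inner ℂ (e m) (e n) = 0 := fun m n hmn ↦ by
      rw [L2.inner_def]
      refine integral_eq_zero_of_ae ?_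
      filter_upwards [indicatorConstLp_coeFn (p := 2) (hs := (hAo m).measurableSet)
        (hμs := hAfin m) (c := (((volume.real (A m)) ^ (-(1 / 2 : ℝ)) : ℝ) : ℂ)),
        indicatorConstLp_coeFn (p := 2) (hs := (hAo n).measurableSet)
        (hμs := hAfin n) (c := (((volume.real (A n)) ^ (-(1 / 2 : ℝ)) : ℝ) : ℂ))] with ξ h1 h2
      rw [he, h1, h2]
      by_cases hm : ξ ∈ A m
      · rw [Set.indicator_of_notMem (s := A n) (Set.disjoint_left.1 (hdisj m n hmn) hm),
          inner_zero_right]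
        rfl
      · rw [Set.indicator_of_notMem hm, inner_zero_left]
        rfl
    intro m n hmn
    rcases lt_or_gt_of_ne hmn with h | h
    · exact h1 m n h
    · rw [← inner_conj_symm, h1 n m h, map_zero]
  refine ⟨fun n ↦ 𝓕⁻ (e n), ?_, ?_⟩
  · exact hon.comp_linearIsometry (Lp.fourierTransformₗᵢ R3 ℂ).symm.toLinearIsometry
  · rw [Metric.tendsto_atTop]
    intro ε hε
    obtain ⟨δ, hδ, hball⟩ := Metric.continuous_iff.1 hqc ξ₀ (ε / 2) (by linarith)
    obtain ⟨N, hN⟩ := exists_nat_one_div_lt hδ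
    refine ⟨N, fun n hn ↦ ?_⟩
    rw [dist_zero_right, ← Lp.norm_fourier_eq]
    have h1 : 𝓕 ((κ : ℂ) • (𝓕⁻ (e n) : L2R3) - (κ + t : ℂ) • besselInv (𝓕⁻ (e n)))
        = (κ : ℂ) • e n - (κ + t : ℂ) • weightMul 1 (e n) := by
      have h2 := fourier_besselInv (𝓕⁻ (e n))
      rw [fourier_fourierInv_eq] at h2
      have h3 := map_sub (fourierCLM ℂ L2R3) ((κ : ℂ) • (𝓕⁻ (e n) : L2R3))
        ((κ + t : ℂ) • besselInv (𝓕⁻ (e n)))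
      simp only [fourierCLM_apply] at h3
      rw [h3, FourierTransform.fourier_smul, FourierTransform.fourier_smul, h2,
        fourier_fourierInv_eq]
    rw [h1]
    refine lt_of_le_of_lt (b := ε / 2 * ‖e n‖) ?_ (by rw [hnorm]; linarith)
    refine Lp.norm_le_mul_norm_of_ae_le_mul ?_
    filter_upwards [Lp.coeFn_sub ((κ : ℂ) • e n) ((κ + t : ℂ) • weightMul 1 (e n)),
      Lp.coeFn_smul (κ : ℂ) (e n), Lp.coeFn_smul (κ + t : ℂ) (weightMul 1 (e n)),
      coeFn_weightMul 1 (e n), indicatorConstLp_coeFn (p := 2) (hs := (hAo n).measurableSet)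
        (hμs := hAfin n) (c := (((volume.real (A n)) ^ (-(1 / 2 : ℝ)) : ℝ) : ℂ))]
      with ξ h2 h3 h4 h5 h6
    have h7 : ((κ : ℂ) • e n - (κ + t : ℂ) • weightMul 1 (e n) : L2R3) ξ
        = (q ξ : ℂ) * e n ξ := by
      rw [h2, Pi.sub_apply, h3, h4, Pi.smul_apply, Pi.smul_apply, h5, hq]
      push_cast
      simp only [smul_eq_mul]
      ring
    rw [h7, norm_mul, Complex.norm_real]
    by_cases hm : ξ ∈ A n
    · gcongr
      have h8 : dist ξ ξ₀ < δ := by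
        refine (Metric.mem_ball.1 hm.1).trans_le (le_trans ?_ hN.le)
        apply one_div_le_one_div_of_le (by positivity)
        have : (N : ℝ) ≤ n := by exact_mod_cast hn
        linarith
      have h9 := hball ξ h8
      rw [hq0, dist_zero_right] at h9
      exact h9.le
    · have : e n ξ = 0 := by rw [he, h6, Set.indicator_of_notMem hm]
      rw [this]
      simp

end Rellich

/-! ### Hardy, Caccioppoli and commutator identities on Schwartz functions. -/

noncomputable section SchwartzCalculus

open LineDeriv

/-- The coordinate directions. -/
abbrev coordVec (i : Fin 3) : R3 := EuclideanSpace.single i 1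

theorem hasLineDerivAt_norm_sq (x : R3) (i : Fin 3) :
    HasLineDerivAt ℝ (fun y : R3 ↦ ‖y‖ ^ 2) (2 * x i) x (coordVec i) := by
  have h : HasFDerivAt (fun y : R3 ↦ ‖y‖ ^ 2) _ x := (hasStrictFDerivAt_norm_sq x).hasFDerivAt
  have h1 : (2 • (innerSL ℝ) x) (coordVec i) = 2 * x i := by
    simp [EuclideanSpace.inner_single_right]
  rw [← h1]
  exact h.hasLineDerivAt (coordVec i)

theorem hasLineDerivAt_coord (x : R3) (i : Fin 3) :
    HasLineDerivAt ℝ (fun y : R3 ↦ y i) 1 x (coordVec i) := by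
  have h : HasFDerivAt (fun y : R3 ↦ y i) _ x := (EuclideanSpace.proj (𝕜 := ℝ) i).hasFDerivAt
  have h1 : EuclideanSpace.proj (𝕜 := ℝ) i (coordVec i) = (1 : ℝ) := by simp
  rw [← h1]
  exact h.hasLineDerivAt (coordVec i)

theorem hasLineDerivAt_weight {L : ℝ} (hL : L ≠ 0) (x : R3) (i : Fin 3) :
    HasLineDerivAt ℝ (weight L) (-(2 * x i * weight L x ^ 2 / L ^ 2)) x (coordVec i) := by
  have h0 : L ^ 2 + ‖x‖ ^ 2 ≠ 0 := by positivity
  have h := hasLineDerivAt_norm_sq x i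
  unfold HasLineDerivAt at h ⊢
  refine ((hasDerivAt_const 0 (L ^ 2)).fun_div (h.const_add (L ^ 2)) (by simpa using h0)).congr_deriv ?_
  simp only [weight, zero_smul, add_zero]
  field_simp
  ring

theorem HasLineDerivAt.mul_real {f g : R3 → ℝ} {f' g' : ℝ} {x v : R3}
    (hf : HasLineDerivAt ℝ f f' x v) (hg : HasLineDerivAt ℝ g g' x v) :
    HasLineDerivAt ℝ (fun y ↦ f y * g y) (f' * g x + f x * g') x v := by
  unfold HasLineDerivAt at *
  simpa using hf.fun_mul hg

theorem SchwartzMap.hasLineDerivAt_lineDerivOp (φ : 𝓢(R3, ℂ)) (x v : R3) :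
    HasLineDerivAt ℝ φ (∂_{v} φ x) x v := by
  rw [SchwartzMap.lineDerivOp_apply]
  exact φ.differentiableAt.lineDifferentiableAt.hasLineDerivAt

/-- Multiplication of a Schwartz function by a real function of temperate growth. -/
abbrev mulSchwartz (g : R3 → ℝ) (φ : 𝓢(R3, ℂ)) : 𝓢(R3, ℂ) := SchwartzMap.smulLeftCLM ℂ g φ

/-- The Leibniz rule. -/
theorem lineDerivOp_mulSchwartz {g g' : R3 → ℝ} (hg : g.HasTemperateGrowth)
    (hg' : g'.HasTemperateGrowth) {v : R3} (hd : ∀ x, HasLineDerivAt ℝ g (g' x) x v)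
    (φ : 𝓢(R3, ℂ)) :
    ∂_{v} (mulSchwartz g φ) = mulSchwartz g (∂_{v} φ) + mulSchwartz g' φ := by
  ext x
  have h := φ.hasLineDerivAt_lineDerivOp x v
  have h1 := hd x
  have h2 := (mulSchwartz g φ).hasLineDerivAt_lineDerivOp x v
  have h3 : HasLineDerivAt ℝ (fun y ↦ g y • φ y) (g x • ∂_{v} φ x + g' x • φ x) x v := by
    unfold HasLineDerivAt at *
    simpa using h1.fun_smul h
  have h4 : (mulSchwartz g φ : R3 → ℂ) = fun y ↦ g y • φ y := SchwartzMap.smulLeftCLM_apply hg φ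
  rw [h4] at h2
  rw [h2.unique h3, add_apply, SchwartzMap.smulLeftCLM_apply_apply hg,
    SchwartzMap.smulLeftCLM_apply_apply hg']

theorem integrable_inner_schwartz (φ ψ : 𝓢(R3, ℂ)) :
    Integrable fun x ↦ inner ℝ (φ x) (ψ x) := by
  have h := (φ.memLp 2 volume).norm.integrable_mul (ψ.memLp 2 volume).norm
  refine h.mono' ?_ (ae_of_all _ fun x ↦ ?_)
  · exact (φ.continuous.inner ψ.continuous).aestronglyMeasurable
  · exact norm_inner_le_norm _ _

theorem laplacian_schwartz_eq (φ : 𝓢(R3, ℂ)) :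
    Δ φ = ∑ i, ∂_{coordVec i} (∂_{coordVec i} φ) := by
  rw [SchwartzMap.laplacian_eq_sum (EuclideanSpace.basisFun (Fin 3) ℝ)]
  simp

theorem integral_inner_lineDerivOp (φ ψ : 𝓢(R3, ℂ)) (v : R3) :
    ∫ x, inner ℝ (φ x) (∂_{v} ψ x) = -∫ x, inner ℝ (∂_{v} φ x) (ψ x) :=
  SchwartzMap.integral_bilinear_lineDerivOp_right_eq_neg_left φ ψ (innerSL ℝ) v

/-- The density of the weighted Dirichlet form. -/
def greenDensity (G : R3 → ℝ) (G' : Fin 3 → R3 → ℝ) (φ : 𝓢(R3, ℂ)) (x : R3) : ℝ :=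
  ∑ i, (G x * ‖∂_{coordVec i} φ x‖ ^ 2 + G' i x * inner ℝ (φ x) (∂_{coordVec i} φ x))

section Green

variable {G : R3 → ℝ} {G' : Fin 3 → R3 → ℝ} (hG : G.HasTemperateGrowth)
  (hG' : ∀ i, (G' i).HasTemperateGrowth)

include hG hG' in
theorem integrable_greenDensity (φ : 𝓢(R3, ℂ)) : Integrable (greenDensity G G' φ) := by
  refine integrable_finsetSum _ fun i _ ↦ Integrable.add ?_ ?_
  · refine (integrable_inner_schwartz (mulSchwartz G (∂_{coordVec i} φ))
      (∂_{coordVec i} φ)).congr (ae_of_all _ fun x ↦ ?_)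
    simp only [SchwartzMap.smulLeftCLM_apply_apply hG, real_inner_smul_left,
      real_inner_self_eq_norm_sq]
  · refine (integrable_inner_schwartz (mulSchwartz (G' i) φ)
      (∂_{coordVec i} φ)).congr (ae_of_all _ fun x ↦ ?_)
    simp only [SchwartzMap.smulLeftCLM_apply_apply (hG' i), real_inner_smul_left]

include hG hG' in
/-- Green's identity with a weight. -/
theorem integral_inner_mulSchwartz_laplacian
    (hd : ∀ i x, HasLineDerivAt ℝ G (G' i x) x (coordVec i)) (φ : 𝓢(R3, ℂ)) :
    -∫ x, G x * inner ℝ (φ x) (Δ φ x) = ∫ x, greenDensity G G' φ x := by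
  have h1 : ∀ x, G x * inner ℝ (φ x) (Δ φ x)
      = ∑ i, inner ℝ (mulSchwartz G φ x) (∂_{coordVec i} (∂_{coordVec i} φ) x) := fun x ↦ by
    rw [laplacian_schwartz_eq, SchwartzMap.smulLeftCLM_apply_apply hG, ← inner_sum,
      real_inner_smul_left, sum_apply]
  simp only [h1]
  rw [integral_finsetSum _ fun i _ ↦ integrable_inner_schwartz _ _]
  have h2 : ∀ i, ∫ x, inner ℝ (mulSchwartz G φ x) (∂_{coordVec i} (∂_{coordVec i} φ) x)
      = -∫ x, inner ℝ (∂_{coordVec i} (mulSchwartz G φ) x) (∂_{coordVec i} φ x) :=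
    fun i ↦ integral_inner_lineDerivOp _ _ _
  simp only [h2, Finset.sum_neg_distrib, neg_neg]
  rw [← integral_finsetSum _ fun i _ ↦
    integrable_inner_schwartz (∂_{coordVec i} (mulSchwartz G φ)) (∂_{coordVec i} φ)]
  refine integral_congr_ae (ae_of_all _ fun x ↦ ?_)
  refine Finset.sum_congr rfl fun i _ ↦ ?_
  rw [lineDerivOp_mulSchwartz hG (hG' i) (hd i), add_apply,
    SchwartzMap.smulLeftCLM_apply_apply hG, SchwartzMap.smulLeftCLM_apply_apply (hG' i),
    inner_add_left, real_inner_smul_left, real_inner_smul_left, real_inner_self_eq_norm_sq]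

/-- The divergence of `F |φ|²`. -/
def divDensity (F F' : Fin 3 → R3 → ℝ) (φ : 𝓢(R3, ℂ)) (x : R3) : ℝ :=
  ∑ i, (2 * F i x * inner ℝ (φ x) (∂_{coordVec i} φ x) + F' i x * ‖φ x‖ ^ 2)

theorem integrable_divDensity {F F' : Fin 3 → R3 → ℝ} (hF : ∀ i, (F i).HasTemperateGrowth)
    (hF' : ∀ i, (F' i).HasTemperateGrowth) (φ : 𝓢(R3, ℂ)) : Integrable (divDensity F F' φ) := by
  refine integrable_finsetSum _ fun i _ ↦ Integrable.add ?_ ?_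
  · refine ((integrable_inner_schwartz (mulSchwartz (F i) φ)
      (∂_{coordVec i} φ)).const_mul 2).congr (ae_of_all _ fun x ↦ ?_)
    simp only [SchwartzMap.smulLeftCLM_apply_apply (hF i), real_inner_smul_left]
    ring
  · refine (integrable_inner_schwartz (mulSchwartz (F' i) φ) φ).congr (ae_of_all _ fun x ↦ ?_)
    simp only [SchwartzMap.smulLeftCLM_apply_apply (hF' i), real_inner_smul_left,
      real_inner_self_eq_norm_sq]

theorem integral_divDensity {F F' : Fin 3 → R3 → ℝ} (hF : ∀ i, (F i).HasTemperateGrowth)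
    (hF' : ∀ i, (F' i).HasTemperateGrowth)
    (hd : ∀ i x, HasLineDerivAt ℝ (F i) (F' i x) x (coordVec i)) (φ : 𝓢(R3, ℂ)) :
    ∫ x, divDensity F F' φ x = 0 := by
  have h1 : ∀ x, divDensity F F' φ x = ∑ i, (inner ℝ (mulSchwartz (F i) φ x) (∂_{coordVec i} φ x)
      + inner ℝ (∂_{coordVec i} (mulSchwartz (F i) φ) x) (φ x)) := fun x ↦ by
    refine Finset.sum_congr rfl fun i _ ↦ ?_
    rw [lineDerivOp_mulSchwartz (hF i) (hF' i) (hd i), add_apply,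
      SchwartzMap.smulLeftCLM_apply_apply (hF i), SchwartzMap.smulLeftCLM_apply_apply (hF i),
      SchwartzMap.smulLeftCLM_apply_apply (hF' i),
      inner_add_left, real_inner_smul_left, real_inner_smul_left, real_inner_smul_left,
      real_inner_self_eq_norm_sq, real_inner_comm (φ x)]
    ring
  simp only [h1]
  rw [integral_finsetSum (f := fun i x ↦ inner ℝ (mulSchwartz (F i) φ x) (∂_{coordVec i} φ x)
      + inner ℝ (∂_{coordVec i} (mulSchwartz (F i) φ) x) (φ x)) _ fun i _ ↦
    (integrable_inner_schwartz _ _).add (integrable_inner_schwartz _ _)]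
  refine Finset.sum_eq_zero fun i _ ↦ ?_
  rw [integral_add (integrable_inner_schwartz _ _) (integrable_inner_schwartz _ _),
    integral_inner_lineDerivOp]
  ring

end Green

section Weight

variable {L : ℝ} (hL : L ≠ 0)

include hL in
/-- A weighted Hardy inequality. -/
theorem hardy_schwartz (φ : 𝓢(R3, ℂ)) :
    ∫ x, weight L x * (1 / 4 - weight L x ^ 2) * ‖φ x‖ ^ 2
      ≤ -∫ x, L ^ 2 * (1 - weight L x) * inner ℝ (φ x) (Δ φ x) := by
  have hw := weight_hasTemperateGrowth hL
  have hx : ∀ i : Fin 3, (fun x : R3 ↦ x i).HasTemperateGrowth := fun i ↦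
    (EuclideanSpace.proj (𝕜 := ℝ) i).hasTemperateGrowth
  -- G = |x|²θ, and G' is its gradient 2xθ².
  set G : R3 → ℝ := fun x ↦ L ^ 2 * (1 - weight L x) with hGdef
  set G' : Fin 3 → R3 → ℝ := fun i x ↦ 2 * x i * weight L x ^ 2 with hG'def
  -- The integral of div(F|φ|²) is zero. The field F = xθ/2 is chosen so that adding this divergence
  -- produces a perfect square.
  set F : Fin 3 → R3 → ℝ := fun i x ↦ x i * (weight L x / 2) with hFdef
  set F' : Fin 3 → R3 → ℝ := fun i x ↦ weight L x / 2 - x i ^ 2 * weight L x ^ 2 / L ^ 2 with hF'def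
  have hG : G.HasTemperateGrowth := by fun_prop
  have hG' : ∀ i, (G' i).HasTemperateGrowth := fun i ↦ by have := hx i; fun_prop
  have hF : ∀ i, (F i).HasTemperateGrowth := fun i ↦ by
    have := hx i
    change (fun x : R3 ↦ x i * (weight L x * 2⁻¹)).HasTemperateGrowth
    fun_prop
  have hF' : ∀ i, (F' i).HasTemperateGrowth := fun i ↦ by
    have := hx i
    change (fun x : R3 ↦ weight L x * 2⁻¹ - x i ^ 2 * weight L x ^ 2 * (L ^ 2)⁻¹).HasTemperateGrowth
    fun_prop
  have hGd : ∀ i x, HasLineDerivAt ℝ G (G' i x) x (coordVec i) := fun i x ↦ by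
    have h := hasLineDerivAt_weight hL x i
    unfold HasLineDerivAt at *
    refine ((h.const_sub 1).const_mul (L ^ 2)).congr_deriv ?_
    simp only [hG'def]
    field_simp
  have hFd : ∀ i x, HasLineDerivAt ℝ (F i) (F' i x) x (coordVec i) := fun i x ↦ by
    have h := hasLineDerivAt_weight hL x i
    have h2 : HasLineDerivAt ℝ (fun y ↦ weight L y / 2)
        (-(2 * x i * weight L x ^ 2 / L ^ 2) / 2) x (coordVec i) := by
      unfold HasLineDerivAt at *
      exact h.div_const 2
    convert (hasLineDerivAt_coord x i).mul_real h2 using 1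
    simp only [hF'def]
    ring
  rw [integral_inner_mulSchwartz_laplacian hG hG' hGd φ]
  have h0 := integral_divDensity hF hF' hFd φ
  rw [← add_zero (∫ x, greenDensity G G' φ x), ← h0, ← integral_add
    (integrable_greenDensity hG hG' φ) (integrable_divDensity hF hF' φ)]
  refine integral_mono ?_ ((integrable_greenDensity hG hG' φ).add
    (integrable_divDensity hF hF' φ)) fun x ↦ ?_
  · have hc : (fun x ↦ weight L x * (1 / 4 - weight L x ^ 2)).HasTemperateGrowth := by fun_prop
    refine (integrable_inner_schwartz
      (mulSchwartz (fun x ↦ weight L x * (1 / 4 - weight L x ^ 2)) φ) φ).congr (ae_of_all _ fun x ↦ ?_)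
    simp only [SchwartzMap.smulLeftCLM_apply_apply hc, real_inner_smul_left,
      real_inner_self_eq_norm_sq]
  · set p : Fin 3 → ℂ := fun i ↦ ∂_{coordVec i} φ x with hp
    set θ := weight L x with hθ
    have hθ0 : 0 ≤ θ := weight_nonneg L x
    have hr : ‖x‖ ^ 2 * θ = L ^ 2 * (1 - θ) := norm_sq_mul_weight hL x
    have hrx : ‖x‖ ^ 2 = ∑ i, x i ^ 2 := by
      rw [EuclideanSpace.norm_sq_eq]
      simp
    set w : ℂ := ∑ i, x i • p i with hw'
    have hwn : ‖w‖ ^ 2 ≤ ‖x‖ ^ 2 * ∑ i, ‖p i‖ ^ 2 := by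
      have h1 : ‖w‖ ≤ ∑ i, |x i| * ‖p i‖ :=
        (norm_sum_le _ _).trans (Finset.sum_le_sum fun i _ ↦ by rw [norm_smul, Real.norm_eq_abs])
      have h2 := Finset.sum_mul_sq_le_sq_mul_sq Finset.univ (fun i ↦ |x i|) (fun i ↦ ‖p i‖)
      simp only [sq_abs] at h2
      rw [hrx]
      exact (pow_le_pow_left₀ (norm_nonneg _) h1 2).trans h2
    have hwi : inner ℝ (φ x) w = ∑ i, x i * inner ℝ (φ x) (p i) := by
      rw [hw', inner_sum]
      simp only [real_inner_smul_right]
    -- With w = x·∇φ, this is ‖w + (θ + 1/2)φ‖² ≥ 0. Subtracting θ(θ + 1/2)² from div F = θ/2 + θ²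
    -- leaves θ/4 - θ³.
    have hsq : 0 ≤ ‖w‖ ^ 2 + 2 * (θ + 1 / 2) * inner ℝ (φ x) w + (θ + 1 / 2) ^ 2 * ‖φ x‖ ^ 2 := by
      have h1 := sq_nonneg ‖w + (θ + 1 / 2) • φ x‖
      rw [norm_add_sq_real, norm_smul, mul_pow, Real.norm_eq_abs, sq_abs, real_inner_smul_right,
        real_inner_comm] at h1
      linarith
    have hgreen : greenDensity G G' φ x + divDensity F F' φ x
        = θ * (‖x‖ ^ 2 * ∑ i, ‖p i‖ ^ 2) + θ * (2 * (θ + 1 / 2)) * inner ℝ (φ x) w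
          + (3 * θ / 2 - ‖x‖ ^ 2 * θ ^ 2 / L ^ 2) * ‖φ x‖ ^ 2 := by
      rw [hwi, ← mul_assoc, mul_comm θ, hr, hrx]
      simp only [greenDensity, divDensity, hGdef, hG'def, hFdef, hF'def, Fin.sum_univ_three]
      ring
    have hdiv : 3 * θ / 2 - ‖x‖ ^ 2 * θ ^ 2 / L ^ 2 = θ / 2 + θ ^ 2 := by
      have : ‖x‖ ^ 2 * θ ^ 2 = L ^ 2 * (1 - θ) * θ := by rw [← hr]; ring
      rw [this]
      field_simp
      ring
    change θ * (1 / 4 - θ ^ 2) * ‖φ x‖ ^ 2 ≤ greenDensity G G' φ x + divDensity F F' φ x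
    rw [hgreen, hdiv]
    have h1 := mul_le_mul_of_nonneg_left hwn hθ0
    have h2 := mul_nonneg hθ0 hsq
    linarith

include hL in
-- The left side is |∇θ|² = (θ²/L²)·4θ(1 - θ), and 4θ(1 - θ) ≤ 1. The surviving factor θ² keeps all
-- later errors localized.
theorem weight_gradient_sq_le (x : R3) : 4 * ‖x‖ ^ 2 * weight L x ^ 4 / L ^ 4
    ≤ weight L x ^ 2 / L ^ 2 := by
  have hr := norm_sq_mul_weight hL x
  have h1 : 4 * ‖x‖ ^ 2 * weight L x ^ 4 / L ^ 4
      = weight L x ^ 2 / L ^ 2 * (4 * (weight L x * (1 - weight L x))) := by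
    have : ‖x‖ ^ 2 * weight L x ^ 4 = L ^ 2 * (1 - weight L x) * weight L x ^ 3 := by
      rw [← hr]; ring
    rw [mul_assoc, this]
    field_simp
  rw [h1]
  refine mul_le_of_le_one_right (by positivity) ?_
  nlinarith [sq_nonneg (2 * weight L x - 1)]

/-- The density of the weighted kinetic energy. -/
def kineticDensity (L : ℝ) (φ : 𝓢(R3, ℂ)) (x : R3) : ℝ :=
  weight L x ^ 2 * ∑ i, ‖∂_{coordVec i} φ x‖ ^ 2

include hL in
-- Cauchy–Schwarz: the sum is -∇θ·∇φ.
theorem norm_sum_gradient_le (φ : 𝓢(R3, ℂ)) (x : R3) :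
    ‖∑ i, (2 * x i * weight L x ^ 2 / L ^ 2) • ∂_{coordVec i} φ x‖ ^ 2
      ≤ kineticDensity L φ x / L ^ 2 := by
  set p : Fin 3 → ℂ := fun i ↦ ∂_{coordVec i} φ x with hp
  have hrx : ‖x‖ ^ 2 = ∑ i, x i ^ 2 := by
    rw [EuclideanSpace.norm_sq_eq]
    simp
  have h1 : ‖∑ i, (2 * x i * weight L x ^ 2 / L ^ 2) • p i‖
      ≤ ∑ i, |2 * x i * weight L x ^ 2 / L ^ 2| * ‖p i‖ :=
    (norm_sum_le _ _).trans (Finset.sum_le_sum fun i _ ↦ by rw [norm_smul, Real.norm_eq_abs])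
  have h2 := Finset.sum_mul_sq_le_sq_mul_sq Finset.univ
    (fun i ↦ |2 * x i * weight L x ^ 2 / L ^ 2|) (fun i ↦ ‖p i‖)
  simp only [sq_abs] at h2
  have h3 : ∑ i : Fin 3, (2 * x i * weight L x ^ 2 / L ^ 2) ^ 2
      = 4 * ‖x‖ ^ 2 * weight L x ^ 4 / L ^ 4 := by
    rw [hrx, Fin.sum_univ_three, Fin.sum_univ_three]
    field_simp
    ring
  rw [h3] at h2
  refine (pow_le_pow_left₀ (norm_nonneg _) h1 2).trans (h2.trans ?_)
  have h4 := mul_le_mul_of_nonneg_right (weight_gradient_sq_le hL x)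
    (Finset.sum_nonneg fun i (_ : i ∈ Finset.univ) ↦ sq_nonneg ‖p i‖)
  refine h4.trans_eq ?_
  rw [kineticDensity]
  ring

include hL in
theorem integrable_kineticDensity (φ : 𝓢(R3, ℂ)) : Integrable (kineticDensity L φ) := by
  have hw := weight_hasTemperateGrowth hL
  have hG : (fun x ↦ weight L x ^ 2).HasTemperateGrowth := by fun_prop
  refine (integrable_greenDensity (G' := fun _ _ ↦ 0) hG (fun _ ↦ by fun_prop) φ).congr
    (ae_of_all _ fun x ↦ ?_)
  simp [greenDensity, kineticDensity, Finset.mul_sum]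

include hL in
/-- The Caccioppoli inequality. -/
theorem integral_kineticDensity_le (φ : 𝓢(R3, ℂ)) :
    ∫ x, kineticDensity L φ x ≤ -2 * (∫ x, weight L x ^ 2 * inner ℝ (φ x) (Δ φ x))
      + 4 / L ^ 2 * ∫ x, weight L x ^ 2 * ‖φ x‖ ^ 2 := by
  have hw := weight_hasTemperateGrowth hL
  have hx : ∀ i : Fin 3, (fun x : R3 ↦ x i).HasTemperateGrowth := fun i ↦
    (EuclideanSpace.proj (𝕜 := ℝ) i).hasTemperateGrowth
  set G : R3 → ℝ := fun x ↦ weight L x ^ 2 with hGdef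
  set G' : Fin 3 → R3 → ℝ := fun i x ↦ -(4 * x i * weight L x ^ 3 * (L ^ 2)⁻¹) with hG'def
  have hG : G.HasTemperateGrowth := by fun_prop
  have hG' : ∀ i, (G' i).HasTemperateGrowth := fun i ↦ by
    have := hx i
    change (fun x : R3 ↦ -(4 * x i * weight L x ^ 3 * (L ^ 2)⁻¹)).HasTemperateGrowth
    fun_prop
  have hGd : ∀ i x, HasLineDerivAt ℝ G (G' i x) x (coordVec i) := fun i x ↦ by
    have h := hasLineDerivAt_weight hL x i
    unfold HasLineDerivAt at *
    refine (h.fun_pow 2).congr_deriv ?_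
    simp only [hG'def, zero_smul, add_zero]
    field_simp
    norm_num
    ring
  have hg := integral_inner_mulSchwartz_laplacian hG hG' hGd φ
  have hint : Integrable fun x ↦ weight L x ^ 2 * ‖φ x‖ ^ 2 := by
    refine (integrable_inner_schwartz (mulSchwartz G φ) φ).congr (ae_of_all _ fun x ↦ ?_)
    simp only [SchwartzMap.smulLeftCLM_apply_apply hG, real_inner_smul_left,
      real_inner_self_eq_norm_sq]
    rfl
  have hle : ∫ x, kineticDensity L φ x / 2 - 2 / L ^ 2 * (weight L x ^ 2 * ‖φ x‖ ^ 2)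
      ≤ ∫ x, greenDensity G G' φ x := by
    refine integral_mono (((integrable_kineticDensity hL φ).div_const 2).sub (hint.const_mul _))
      (integrable_greenDensity hG hG' φ) fun x ↦ ?_
    set v : ℂ := ∑ i, (2 * x i * weight L x ^ 2 / L ^ 2) • ∂_{coordVec i} φ x with hv
    have h1 : greenDensity G G' φ x = kineticDensity L φ x
        - 2 * weight L x * inner ℝ (φ x) v := by
      rw [hv, inner_sum]
      simp only [greenDensity, kineticDensity, real_inner_smul_right, hGdef, hG'def,
        Fin.sum_univ_three]
      field_simp
      ring
    have h2 := norm_sum_gradient_le hL φ x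
    -- Young's inequality, with the coefficient L²/2 chosen so that ‖v‖² ≤ (kinetic density)/L²
    -- costs half of the kinetic density.
    have h3 : 2 * weight L x * inner ℝ (φ x) v
        ≤ L ^ 2 / 2 * ‖v‖ ^ 2 + 2 / L ^ 2 * (weight L x ^ 2 * ‖φ x‖ ^ 2) := by
      have h4 := sq_nonneg ‖(L / 2) • v - (weight L x / L) • φ x‖
      rw [norm_sub_sq_real, norm_smul, norm_smul, mul_pow, mul_pow, Real.norm_eq_abs,
        Real.norm_eq_abs, sq_abs, sq_abs, real_inner_smul_left, real_inner_smul_right,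
        real_inner_comm] at h4
      have h5 : L / 2 * (weight L x / L * inner ℝ (φ x) v)
          = weight L x / 2 * inner ℝ (φ x) v := by field_simp
      rw [h5] at h4
      have h6 : 2 / L ^ 2 * (weight L x ^ 2 * ‖φ x‖ ^ 2)
        = 2 * ((weight L x / L) ^ 2 * ‖φ x‖ ^ 2) := by field_simp
      rw [h6]
      linarith
    have h7 : L ^ 2 / 2 * ‖v‖ ^ 2 ≤ kineticDensity L φ x / 2 := by
      have := mul_le_mul_of_nonneg_left h2 (by positivity : 0 ≤ L ^ 2 / 2)
      refine this.trans_eq ?_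
      field_simp
    simp only
    rw [h1]
    linarith
  rw [integral_sub ((integrable_kineticDensity hL φ).div_const 2) (hint.const_mul _),
    integral_div, integral_const_mul, ← hg] at hle
  simp only [hGdef] at hle
  have h8 : 4 / L ^ 2 * ∫ x, weight L x ^ 2 * ‖φ x‖ ^ 2
      = 2 * (2 / L ^ 2 * ∫ x, weight L x ^ 2 * ‖φ x‖ ^ 2) := by ring
  rw [h8]
  linarith

include hL in
/-- The commutator of the Laplacian with the weight. -/
theorem laplacian_mulSchwartz_weight (φ : 𝓢(R3, ℂ)) (x : R3) :
    Δ (mulSchwartz (weight L) φ) x - weight L x • Δ φ x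
      = -((2 : ℝ) • ∑ i, (2 * x i * weight L x ^ 2 / L ^ 2) • ∂_{coordVec i} φ x)
        + (weight L x ^ 2 * (2 - 8 * weight L x) / L ^ 2) • φ x := by
  have hw := weight_hasTemperateGrowth hL
  have hx : ∀ i : Fin 3, (fun x : R3 ↦ x i).HasTemperateGrowth := fun i ↦
    (EuclideanSpace.proj (𝕜 := ℝ) i).hasTemperateGrowth
  set d : Fin 3 → R3 → ℝ := fun i x ↦ -(2 * x i * weight L x ^ 2 / L ^ 2) with hd
  set d' : Fin 3 → R3 → ℝ := fun i x ↦
    -(2 * weight L x ^ 2 / L ^ 2) + 8 * x i ^ 2 * weight L x ^ 3 / L ^ 4 with hd'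
  have hdt : ∀ i, (d i).HasTemperateGrowth := fun i ↦ by
    have := hx i
    change (fun x : R3 ↦ -(2 * x i * weight L x ^ 2 * (L ^ 2)⁻¹)).HasTemperateGrowth
    fun_prop
  have hdt' : ∀ i, (d' i).HasTemperateGrowth := fun i ↦ by
    have := hx i
    change (fun x : R3 ↦ -(2 * weight L x ^ 2 * (L ^ 2)⁻¹)
      + 8 * x i ^ 2 * weight L x ^ 3 * (L ^ 4)⁻¹).HasTemperateGrowth
    fun_prop
  have hdd : ∀ i x, HasLineDerivAt ℝ (d i) (d' i x) x (coordVec i) := fun i x ↦ by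
    have h1 := hasLineDerivAt_weight hL x i
    have h2 := hasLineDerivAt_coord x i
    unfold HasLineDerivAt at *
    refine (((h2.const_mul 2).fun_mul (h1.fun_pow 2)).div_const (L ^ 2)).fun_neg.congr_deriv ?_
    simp only [hd', zero_smul, add_zero]
    field_simp
    norm_num
    ring
  have hrx : ‖x‖ ^ 2 = ∑ i, x i ^ 2 := by
    rw [EuclideanSpace.norm_sq_eq]
    simp
  -- This sum is Δθ; in absolute value it is at most 6θ/L² because |2 - 8θ| ≤ 6.
  have hsum : ∑ i, d' i x = weight L x ^ 2 * (2 - 8 * weight L x) / L ^ 2 := by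
    have h1 : ∑ i, d' i x = -(6 * weight L x ^ 2 / L ^ 2)
        + 8 * (‖x‖ ^ 2 * weight L x) * weight L x ^ 2 / L ^ 4 := by
      rw [hrx]
      simp only [hd', Fin.sum_univ_three]
      ring
    rw [h1, norm_sq_mul_weight hL]
    field_simp
    ring
  rw [← hsum, laplacian_schwartz_eq, laplacian_schwartz_eq, sum_apply, sum_apply, Finset.smul_sum,
    ← Finset.sum_sub_distrib, Finset.smul_sum, Finset.sum_smul, ← Finset.sum_neg_distrib,
    ← Finset.sum_add_distrib]
  refine Finset.sum_congr rfl fun i _ ↦ ?_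
  have e1 := lineDerivOp_mulSchwartz hw (hdt i) (fun x ↦ hasLineDerivAt_weight hL x i) φ
  have e2 := lineDerivOp_mulSchwartz hw (hdt i) (fun x ↦ hasLineDerivAt_weight hL x i)
    (∂_{coordVec i} φ)
  have e3 := lineDerivOp_mulSchwartz (hdt i) (hdt' i) (hdd i) φ
  rw [e1, lineDerivOp_add, e2, e3]
  simp only [add_apply, SchwartzMap.smulLeftCLM_apply_apply hw,
    SchwartzMap.smulLeftCLM_apply_apply (hdt i), SchwartzMap.smulLeftCLM_apply_apply (hdt' i)]
  simp only [hd]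
  module

include hL in
theorem norm_laplacian_mulSchwartz_sub_le (φ : 𝓢(R3, ℂ)) (x : R3) :
    ‖Δ (mulSchwartz (weight L) φ) x - weight L x • Δ φ x‖ ^ 2
      ≤ 8 / L ^ 2 * kineticDensity L φ x + 72 / L ^ 4 * (weight L x ^ 2 * ‖φ x‖ ^ 2) := by
  rw [laplacian_mulSchwartz_weight hL]
  have h1 := norm_sum_gradient_le hL φ x
  set v : ℂ := ∑ i, (2 * x i * weight L x ^ 2 / L ^ 2) • ∂_{coordVec i} φ x with hv
  have hw0 := weight_nonneg L x
  have hw1 := weight_le_one L x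
  have h2 : ‖(weight L x ^ 2 * (2 - 8 * weight L x) / L ^ 2) • φ x‖
      ≤ 6 / L ^ 2 * (weight L x * ‖φ x‖) := by
    rw [norm_smul, ← mul_assoc]
    gcongr
    rw [Real.norm_eq_abs, abs_div, abs_of_pos (by positivity : 0 < L ^ 2), div_mul_eq_mul_div]
    gcongr
    rw [abs_mul, abs_of_nonneg (by positivity), mul_comm]
    refine mul_le_mul (abs_le.2 ⟨by linarith, by linarith⟩) ?_ (by positivity) (by norm_num)
    exact pow_le_of_le_one hw0 hw1 two_ne_zero
  have h3 : ‖-((2 : ℝ) • v)‖ = 2 * ‖v‖ := by rw [norm_neg, norm_smul]; norm_num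
  have h4 := norm_add_le (-((2 : ℝ) • v)) ((weight L x ^ 2 * (2 - 8 * weight L x) / L ^ 2) • φ x)
  rw [h3] at h4
  calc _ ≤ (2 * ‖v‖ + 6 / L ^ 2 * (weight L x * ‖φ x‖)) ^ 2 :=
        pow_le_pow_left₀ (norm_nonneg _) (h4.trans (by gcongr)) 2
    _ ≤ 8 * ‖v‖ ^ 2 + 2 * (6 / L ^ 2 * (weight L x * ‖φ x‖)) ^ 2 := by
        nlinarith [sq_nonneg (2 * ‖v‖ - 6 / L ^ 2 * (weight L x * ‖φ x‖))]
    _ ≤ 8 * (kineticDensity L φ x / L ^ 2) + 2 * (6 / L ^ 2 * (weight L x * ‖φ x‖)) ^ 2 := by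
        gcongr
    _ = _ := by
        field_simp
        ring

end Weight

theorem re_inner_toLp (φ ψ : 𝓢(R3, ℂ)) :
    (inner ℂ (φ.toLp 2 : L2R3) (ψ.toLp 2)).re = ∫ x, inner ℝ (φ x) (ψ x) := by
  rw [re_inner_eq_integral]
  refine integral_congr_ae ?_
  filter_upwards [φ.coeFn_toLp 2, ψ.coeFn_toLp 2] with x h1 h2
  rw [h1, h2]
  rfl

theorem norm_sq_toLp (φ : 𝓢(R3, ℂ)) : ‖(φ.toLp 2 : L2R3)‖ ^ 2 = ∫ x, ‖φ x‖ ^ 2 := by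
  rw [norm_sq_eq_integral]
  refine integral_congr_ae ?_
  filter_upwards [φ.coeFn_toLp 2] with x h1
  rw [h1]

theorem toLp_mulSchwartz_weight {L : ℝ} (hL : L ≠ 0) (φ : 𝓢(R3, ℂ)) :
    ((mulSchwartz (weight L) φ).toLp 2 : L2R3) = weightMul L (φ.toLp 2) := by
  apply Lp.ext
  filter_upwards [φ.coeFn_toLp 2, (mulSchwartz (weight L) φ).coeFn_toLp 2,
    coeFn_weightMul L (φ.toLp 2 : L2R3)] with x h1 h2 h3
  rw [h2, h3, h1, SchwartzMap.smulLeftCLM_apply_apply (weight_hasTemperateGrowth hL),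
    Complex.real_smul]

end SchwartzCalculus

/-! ### The commutator [Δ, θ] is of order 1/L in localized norms. -/

noncomputable section SchwartzCommutator

open LineDeriv

section

variable {L : ℝ} (hL : L ≠ 0) (φ : 𝓢(R3, ℂ))

include hL

theorem toLp_laplacian_sub_weightMul :
    ((Δ (mulSchwartz (weight L) φ)).toLp 2 : L2R3) - weightMul L ((Δ φ).toLp 2)
      = (Δ (mulSchwartz (weight L) φ) - mulSchwartz (weight L) (Δ φ)).toLp 2 := by
  rw [← toLp_mulSchwartz_weight hL]
  exact (map_sub (SchwartzMap.toLpCLM ℂ ℂ 2 (volume : Measure R3)) _ _).symm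

theorem inner_mulSchwartz_weight (ψ : 𝓢(R3, ℂ)) (x : R3) :
    inner ℝ (mulSchwartz (weight L) φ x) (mulSchwartz (weight L) ψ x)
      = weight L x ^ 2 * inner ℝ (φ x) (ψ x) := by
  rw [SchwartzMap.smulLeftCLM_apply_apply (weight_hasTemperateGrowth hL),
    SchwartzMap.smulLeftCLM_apply_apply (weight_hasTemperateGrowth hL), real_inner_smul_left,
    real_inner_smul_right]
  ring

theorem norm_sq_mulSchwartz_weight (x : R3) :
    ‖mulSchwartz (weight L) φ x‖ ^ 2 = weight L x ^ 2 * ‖φ x‖ ^ 2 := by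
  rw [← real_inner_self_eq_norm_sq, inner_mulSchwartz_weight hL, real_inner_self_eq_norm_sq]

theorem norm_sq_weightMul_toLp :
    ‖weightMul L (φ.toLp 2)‖ ^ 2 = ∫ x, weight L x ^ 2 * ‖φ x‖ ^ 2 := by
  rw [← toLp_mulSchwartz_weight hL, norm_sq_toLp]
  exact integral_congr_ae (ae_of_all _ fun x ↦ norm_sq_mulSchwartz_weight hL φ x)

theorem neg_integral_weight_sq_inner_laplacian_le :
    -∫ x, weight L x ^ 2 * inner ℝ (φ x) (Δ φ x)
      ≤ ‖weightMul L (φ.toLp 2)‖ * ‖weightMul L ((Δ φ).toLp 2)‖ := by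
  have h4 := re_inner_toLp (mulSchwartz (weight L) φ) (mulSchwartz (weight L) (Δ φ))
  rw [integral_congr_ae (ae_of_all _ fun x ↦ inner_mulSchwartz_weight hL φ (Δ φ) x)] at h4
  rw [← h4, toLp_mulSchwartz_weight hL, toLp_mulSchwartz_weight hL]
  exact (neg_le_abs _).trans ((Complex.abs_re_le_norm _).trans (norm_inner_le_norm _ _))

theorem integrable_weight_sq_mul_norm_sq : Integrable fun x ↦ weight L x ^ 2 * ‖φ x‖ ^ 2 :=
  (integrable_inner_schwartz (mulSchwartz (weight L) φ) (mulSchwartz (weight L) φ)).congr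
    (ae_of_all _ fun x ↦ by
      simp only [real_inner_self_eq_norm_sq]; exact norm_sq_mulSchwartz_weight hL φ x)

theorem norm_sq_laplacian_commutator_le (x : R3) :
    ‖(Δ (mulSchwartz (weight L) φ) - mulSchwartz (weight L) (Δ φ)) x‖ ^ 2
      ≤ 8 / L ^ 2 * kineticDensity L φ x + 72 / L ^ 4 * (weight L x ^ 2 * ‖φ x‖ ^ 2) := by
  have h : (Δ (mulSchwartz (weight L) φ) - mulSchwartz (weight L) (Δ φ)) x
      = Δ (mulSchwartz (weight L) φ) x - weight L x • Δ φ x := by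
    rw [sub_apply, SchwartzMap.smulLeftCLM_apply_apply (weight_hasTemperateGrowth hL)]
  exact h ▸ norm_laplacian_mulSchwartz_sub_le hL φ x

theorem norm_sq_commutator_le :
    ‖((Δ (mulSchwartz (weight L) φ)).toLp 2 : L2R3) - weightMul L ((Δ φ).toLp 2)‖ ^ 2
      ≤ 8 / L ^ 2 * (∫ x, kineticDensity L φ x)
        + 72 / L ^ 4 * ∫ x, weight L x ^ 2 * ‖φ x‖ ^ 2 := by
  rw [toLp_laplacian_sub_weightMul hL, norm_sq_toLp]
  have hk := (integrable_kineticDensity hL φ).const_mul (8 / L ^ 2)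
  have hi := (integrable_weight_sq_mul_norm_sq hL φ).const_mul (72 / L ^ 4)
  rw [← integral_const_mul, ← integral_const_mul, ← integral_add hk hi]
  exact integral_mono_of_nonneg (ae_of_all _ fun x ↦ sq_nonneg _) (hk.add hi)
    (ae_of_all _ fun x ↦ norm_sq_laplacian_commutator_le hL φ x)

end

/-- Here a = ‖θφ‖, b = ‖θΔφ‖, k is the weighted kinetic energy and e = ∫ θ²⟨φ, Δφ⟩. Caccioppoli
eliminates k, and 8·4 + 72 = 104. -/
theorem commutator_arith {L a b k e : ℝ} (hL : 1 ≤ L) (ha : 0 ≤ a) (hb : 0 ≤ b)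
    (hk : k ≤ -2 * e + 4 / L ^ 2 * a ^ 2) (he : -e ≤ a * b) :
    8 / L ^ 2 * k + 72 / L ^ 4 * a ^ 2 ≤ 104 / L ^ 2 * (a * b + a ^ 2) := by
  have hL0 : L ≠ 0 := by positivity
  have h8 : 1 / L ^ 4 ≤ 1 / L ^ 2 :=
    one_div_le_one_div_of_le (by positivity) (pow_le_pow_right₀ hL (by norm_num))
  calc 8 / L ^ 2 * k + 72 / L ^ 4 * a ^ 2
      ≤ 8 / L ^ 2 * (2 * (a * b) + 4 / L ^ 2 * a ^ 2) + 72 / L ^ 4 * a ^ 2 := by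
        gcongr
        linarith
    _ = 16 * (1 / L ^ 2) * (a * b) + 104 * (1 / L ^ 4) * a ^ 2 := by
        field_simp
        ring
    _ ≤ 104 * (1 / L ^ 2) * (a * b) + 104 * (1 / L ^ 2) * a ^ 2 := by
        gcongr
        norm_num
    _ = _ := by ring

/-- Only localized norms appear on the right, so the bound survives for eigenfunctions without a
uniform L² bound. -/
theorem commutator_schwartz {L : ℝ} (hL : 1 ≤ L) (φ : 𝓢(R3, ℂ)) :
    ‖((Δ (mulSchwartz (weight L) φ)).toLp 2 : L2R3) - weightMul L ((Δ φ).toLp 2)‖ ^ 2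
      ≤ 104 / L ^ 2 * (‖weightMul L (φ.toLp 2)‖ * ‖weightMul L ((Δ φ).toLp 2)‖
        + ‖weightMul L (φ.toLp 2)‖ ^ 2) := by
  have hL0 : L ≠ 0 := by positivity
  have h1 := norm_sq_commutator_le hL0 φ
  have h2 := integral_kineticDensity_le hL0 φ
  rw [← norm_sq_weightMul_toLp hL0] at h1 h2
  exact h1.trans (commutator_arith hL (norm_nonneg _) (norm_nonneg _) h2
    (neg_integral_weight_sq_inner_laplacian_le hL0 φ))

end SchwartzCommutator

/-! ### Extension of the estimates from Schwartz functions to H². -/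

noncomputable section SobolevExtension

open FourierTransform TemperedDistribution

theorem freqSq_pos : 0 < freqSq := by unfold freqSq; positivity

theorem freqSq_ne_zero : (freqSq : ℂ) ≠ 0 := Complex.ofReal_ne_zero.2 freqSq_pos.ne'

/-- A Schwartz function as an element of `L²(ℝ³)`. -/
abbrev schwartzL2 (φ : 𝓢(R3, ℂ)) : L2R3 := φ.toLp 2

theorem besselInv_schwartz (φ : 𝓢(R3, ℂ)) :
    besselInv (schwartzL2 φ - ((freqSq⁻¹ : ℝ) : ℂ) • schwartzL2 (Δ φ)) = schwartzL2 φ := by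
  have h1 : ∀ φ : 𝓢(R3, ℂ), ((schwartzL2 φ : L2R3) : 𝓢'(R3, ℂ)) = (φ : 𝓢'(R3, ℂ)) := fun φ ↦
    Lp.toTemperedDistribution_toLp_eq φ
  apply toTemperedDistribution_inj
  have h2 : besselPotential R3 ℂ 2 ((schwartzL2 φ : L2R3) : 𝓢'(R3, ℂ))
      = ((schwartzL2 φ - ((freqSq⁻¹ : ℝ) : ℂ) • schwartzL2 (Δ φ) : L2R3) : 𝓢'(R3, ℂ)) := by
    rw [besselPotential_two_eq]
    have h3 := h1 (Δ φ)
    have h4 := h1 φ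
    simp only [← Lp.toTemperedDistributionCLM_apply, map_smul, map_sub] at h3 h4 ⊢
    rw [h3, h4, TemperedDistribution.laplacian_toTemperedDistributionCLM_eq]
  rw [toTemperedDistribution_besselInv, ← h2, besselPotential_besselPotential_apply]
  simp

theorem schwartzL2_mem (φ : 𝓢(R3, ℂ)) : schwartzL2 φ ∈ H2R3 := by
  rw [← besselInv_schwartz φ]
  exact besselInv_mem _

theorem laplacianL2_congr {a b : L2R3} (h : a = b) (ha : a ∈ H2R3) (hb : b ∈ H2R3) :
    laplacianL2 ⟨a, ha⟩ = laplacianL2 ⟨b, hb⟩ := by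
  subst h
  rfl

theorem laplacianL2_schwartz (φ : 𝓢(R3, ℂ)) (h : schwartzL2 φ ∈ H2R3) :
    laplacianL2 ⟨schwartzL2 φ, h⟩ = schwartzL2 (Δ φ) := by
  rw [laplacianL2_congr (besselInv_schwartz φ).symm h (besselInv_mem _), laplacianL2_besselInv,
    besselInv_schwartz, sub_sub_cancel, smul_smul, ← Complex.ofReal_mul,
    mul_inv_cancel₀ freqSq_pos.ne', Complex.ofReal_one, one_smul]

theorem exists_schwartz_besselInv (g : 𝓢(R3, ℂ)) :
    ∃ φ : 𝓢(R3, ℂ), schwartzL2 φ = besselInv (schwartzL2 g) := by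
  refine ⟨𝓕⁻ (mulSchwartz (weight 1) (𝓕 g)), ?_⟩
  rw [besselInv_apply, schwartzL2, schwartzL2, ← SchwartzMap.toLp_fourierInv_eq,
    SchwartzMap.toLp_fourier_eq, toLp_mulSchwartz_weight one_ne_zero]

/-- Schwartz functions are dense in `H²(ℝ³)`. -/
theorem exists_schwartz_tendsto (ψ : H2R3) : ∃ φ : ℕ → 𝓢(R3, ℂ),
    Tendsto (fun n ↦ schwartzL2 (φ n)) atTop (𝓝 (ψ : L2R3)) ∧
    Tendsto (fun n ↦ schwartzL2 (Δ (φ n))) atTop (𝓝 (laplacianL2 ψ)) := by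
  obtain ⟨ψ, hψ⟩ := ψ
  obtain ⟨f, rfl⟩ := exists_besselInv_eq hψ
  have hd : DenseRange (SchwartzMap.toLpCLM ℂ ℂ 2 (volume : Measure R3)) :=
    SchwartzMap.denseRange_toLpCLM (by simp)
  obtain ⟨u, hu, hlim⟩ := mem_closure_iff_seq_limit.1 (hd f)
  choose g hg using hu
  choose φ hφ using fun n ↦ exists_schwartz_besselInv (g n)
  have hg' : ∀ n, schwartzL2 (g n) = u n := hg
  have hΔ : ∀ n, schwartzL2 (Δ (φ n)) = (freqSq : ℂ) • (besselInv (u n) - u n) := fun n ↦ by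
    rw [← laplacianL2_schwartz _ (schwartzL2_mem _), laplacianL2_congr (hφ n) _ (besselInv_mem _),
      laplacianL2_besselInv, hg']
  refine ⟨φ, ?_, ?_⟩
  · simp only [hφ, hg']
    exact (besselInv.continuous.tendsto f).comp hlim
  · simp only [hΔ, laplacianL2_besselInv]
    exact (((besselInv.continuous.tendsto f).comp hlim).sub hlim).const_smul _

/-- The Laplacian is closed. -/
theorem laplacianL2_closed {u : ℕ → L2R3} (hu : ∀ n, u n ∈ H2R3) {a g : L2R3}
    (h1 : Tendsto u atTop (𝓝 a)) (h2 : Tendsto (fun n ↦ laplacianL2 ⟨u n, hu n⟩) atTop (𝓝 g)) :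
    ∃ h : a ∈ H2R3, laplacianL2 ⟨a, h⟩ = g := by
  choose f hf using fun n ↦ exists_besselInv_eq (hu n)
  have h3 : ∀ n, f n = u n - (freqSq : ℂ)⁻¹ • laplacianL2 ⟨u n, hu n⟩ := fun n ↦ by
    rw [laplacianL2_congr (hf n).symm _ (besselInv_mem _), laplacianL2_besselInv, smul_smul,
      inv_mul_cancel₀ freqSq_ne_zero, one_smul, hf, sub_sub_cancel]
  have h4 : Tendsto f atTop (𝓝 (a - (freqSq : ℂ)⁻¹ • g)) := by
    rw [funext h3]
    exact h1.sub (h2.const_smul _)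
  have h5 : besselInv (a - (freqSq : ℂ)⁻¹ • g) = a := by
    refine tendsto_nhds_unique ((besselInv.continuous.tendsto _).comp h4) ?_
    refine h1.congr fun n ↦ (hf n).symm
  refine ⟨h5 ▸ besselInv_mem _, ?_⟩
  rw [laplacianL2_congr h5.symm _ (besselInv_mem _), laplacianL2_besselInv, h5, sub_sub_cancel,
    smul_smul, mul_inv_cancel₀ freqSq_ne_zero, one_smul]

/-- The commutator of the Laplacian and the weight, on Schwartz functions. -/
def schwartzCommutator (L : ℝ) (φ : 𝓢(R3, ℂ)) : L2R3 :=
  schwartzL2 (Δ (mulSchwartz (weight L) φ)) - weightMul L (schwartzL2 (Δ φ))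

theorem schwartzL2_sub (φ ψ : 𝓢(R3, ℂ)) : schwartzL2 (φ - ψ) = schwartzL2 φ - schwartzL2 ψ :=
  map_sub (SchwartzMap.toLpCLM ℂ ℂ 2 (volume : Measure R3)) _ _

theorem laplacian_schwartz_sub (φ ψ : 𝓢(R3, ℂ)) : Δ (φ - ψ) = Δ φ - Δ ψ :=
  map_sub (LineDeriv.laplacianCLM ℝ R3 𝓢(R3, ℂ)) φ ψ

theorem schwartzCommutator_sub (L : ℝ) (φ ψ : 𝓢(R3, ℂ)) :
    schwartzCommutator L (φ - ψ) = schwartzCommutator L φ - schwartzCommutator L ψ := by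
  unfold schwartzCommutator
  rw [mulSchwartz, map_sub, laplacian_schwartz_sub, laplacian_schwartz_sub, schwartzL2_sub,
    schwartzL2_sub, map_sub]
  abel

/-- Continuity in the graph norm of Δ, crude but enough to make commutators of approximating
sequences Cauchy; 104 ≤ 11². -/
theorem norm_schwartzCommutator_le {L : ℝ} (hL : 1 ≤ L) (φ : 𝓢(R3, ℂ)) :
    ‖schwartzCommutator L φ‖ ≤ 11 * (‖schwartzL2 φ‖ + ‖schwartzL2 (Δ φ)‖) := by
  have h1 : ‖schwartzCommutator L φ‖ ^ 2 ≤ 104 / L ^ 2 *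
      (‖weightMul L (schwartzL2 φ)‖ * ‖weightMul L (schwartzL2 (Δ φ))‖
        + ‖weightMul L (schwartzL2 φ)‖ ^ 2) := commutator_schwartz hL φ
  have h2 := norm_weightMul_le L (schwartzL2 φ)
  have h3 := norm_weightMul_le L (schwartzL2 (Δ φ))
  have h4 : 104 / L ^ 2 ≤ 104 := div_le_self (by norm_num) (one_le_pow₀ hL)
  have a0 := norm_nonneg (schwartzL2 φ)
  have b0 := norm_nonneg (schwartzL2 (Δ φ))
  refine abs_le_of_sq_le_sq' ?_ (by positivity) |>.2
  refine h1.trans ?_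
  calc _ ≤ 104 * (‖schwartzL2 φ‖ * ‖schwartzL2 (Δ φ)‖ + ‖schwartzL2 φ‖ ^ 2) := by gcongr
    _ ≤ _ := by nlinarith [mul_nonneg a0 b0, sq_nonneg ‖schwartzL2 φ‖, sq_nonneg ‖schwartzL2 (Δ φ)‖]

/-- `H²(ℝ³)` is stable under multiplication by the weight, with a bound for the commutator. -/
theorem weightMul_mem_commutator {L : ℝ} (hL : 1 ≤ L) (ψ : H2R3) :
    ∃ h : weightMul L ψ ∈ H2R3, ‖laplacianL2 ⟨weightMul L ψ, h⟩ - weightMul L (laplacianL2 ψ)‖ ^ 2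
      ≤ 104 / L ^ 2 * (‖weightMul L ψ‖ * ‖weightMul L (laplacianL2 ψ)‖ + ‖weightMul L ψ‖ ^ 2) := by
  obtain ⟨φ, h1, h2⟩ := exists_schwartz_tendsto ψ
  have hL0 : L ≠ 0 := by positivity
  have hc : CauchySeq fun n ↦ schwartzCommutator L (φ n) := by
    rw [cauchySeq_iff_tendsto_dist_atTop_0]
    have c1 := cauchySeq_iff_tendsto_dist_atTop_0.1 h1.cauchySeq
    have c2 := cauchySeq_iff_tendsto_dist_atTop_0.1 h2.cauchySeq
    have c3 := (c1.add c2).const_mul 11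
    rw [add_zero, mul_zero] at c3
    refine squeeze_zero (fun _ ↦ dist_nonneg) (fun p ↦ ?_) c3
    rw [dist_eq_norm, dist_eq_norm, dist_eq_norm, ← schwartzCommutator_sub, ← schwartzL2_sub,
      ← schwartzL2_sub, ← laplacian_schwartz_sub]
    exact norm_schwartzCommutator_le hL _
  obtain ⟨c, hc⟩ := cauchySeq_tendsto_of_complete hc
  have hw : ∀ v : ℕ → L2R3, ∀ b, Tendsto v atTop (𝓝 b) →
      Tendsto (fun n ↦ weightMul L (v n)) atTop (𝓝 (weightMul L b)) := fun v b hv ↦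
    ((weightMul L).continuous.tendsto b).comp hv
  have hu : ∀ n, weightMul L (schwartzL2 (φ n)) ∈ H2R3 := fun n ↦ by
    rw [schwartzL2, ← toLp_mulSchwartz_weight hL0]
    exact schwartzL2_mem _
  have hlap : ∀ n, laplacianL2 ⟨weightMul L (schwartzL2 (φ n)), hu n⟩
      = schwartzCommutator L (φ n) + weightMul L (schwartzL2 (Δ (φ n))) := fun n ↦ by
    rw [laplacianL2_congr (toLp_mulSchwartz_weight hL0 (φ n)).symm _ (schwartzL2_mem _),
      laplacianL2_schwartz, schwartzCommutator, sub_add_cancel]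
  -- Convergence of the commutators makes Δ(θφ_n) converge, so closedness of Δ puts θψ in H².
  obtain ⟨h, hlim⟩ := laplacianL2_closed hu (hw _ _ h1)
    (g := c + weightMul L (laplacianL2 ψ)) (by
      simp only [hlap]
      exact hc.add (hw _ _ h2))
  refine ⟨h, ?_⟩
  rw [hlim, add_sub_cancel_right]
  exact le_of_tendsto_of_tendsto' (hc.norm.pow 2)
    ((((hw _ _ h1).norm.mul (hw _ _ h2).norm).add ((hw _ _ h1).norm.pow 2)).const_mul _)
    fun n ↦ commutator_schwartz hL (φ n)

/-- The left-hand side of Hardy's inequality as a quadratic form. -/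
theorem re_inner_hardy_eq (L : ℝ) (ψ : L2R3) :
    (inner ℂ (((1 / 4 : ℝ) : ℂ) • weightMul L ψ - weightMul L (weightMul L (weightMul L ψ))) ψ).re
      = ∫ x, weight L x * (1 / 4 - weight L x ^ 2) * ‖ψ x‖ ^ 2 := by
  rw [re_inner_eq_integral]
  refine integral_congr_ae ?_
  filter_upwards [Lp.coeFn_sub (((1 / 4 : ℝ) : ℂ) • weightMul L ψ)
    (weightMul L (weightMul L (weightMul L ψ))), Lp.coeFn_smul ((1 / 4 : ℝ) : ℂ) (weightMul L ψ),
    coeFn_weightMul L ψ, coeFn_weightMul L (weightMul L ψ),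
    coeFn_weightMul L (weightMul L (weightMul L ψ))] with x h1 h2 h3 h4 h5
  rw [h1, Pi.sub_apply, h2, Pi.smul_apply, h5, h4, h3]
  have h6 : ((1 / 4 : ℝ) : ℂ) • ((weight L x : ℂ) * ψ x)
      - (weight L x : ℂ) * ((weight L x : ℂ) * ((weight L x : ℂ) * ψ x))
      = ((weight L x * (1 / 4 - weight L x ^ 2) : ℝ) : ℂ) • ψ x := by
    simp only [smul_eq_mul]
    push_cast
    ring
  rw [h6, inner_smul_left, Complex.conj_ofReal, Complex.re_ofReal_mul]
  congr 1
  exact inner_self_eq_norm_sq (𝕜 := ℂ) (ψ x)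

/-- A weighted Hardy inequality on `H²(ℝ³)`. -/
theorem hardy_H2 {L : ℝ} (hL : L ≠ 0) (ψ : H2R3) :
    ∫ x, weight L x * (1 / 4 - weight L x ^ 2) * ‖(ψ : L2R3) x‖ ^ 2
      ≤ -(L ^ 2 * (inner ℂ ((ψ : L2R3) - weightMul L ψ) (laplacianL2 ψ)).re) := by
  obtain ⟨φ, h1, h2⟩ := exists_schwartz_tendsto ψ
  have hw : ∀ v : ℕ → L2R3, ∀ b, Tendsto v atTop (𝓝 b) →
      Tendsto (fun n ↦ weightMul L (v n)) atTop (𝓝 (weightMul L b)) := fun v b hv ↦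
    ((weightMul L).continuous.tendsto b).comp hv
  have hre : ∀ (v w : ℕ → L2R3) (a b : L2R3), Tendsto v atTop (𝓝 a) → Tendsto w atTop (𝓝 b) →
      Tendsto (fun n ↦ (inner ℂ (v n) (w n)).re) atTop (𝓝 (inner ℂ a b).re) :=
    fun v w a b hv hw ↦ (Complex.continuous_re.tendsto _).comp (hv.inner hw)
  rw [← re_inner_hardy_eq]
  refine le_of_tendsto_of_tendsto' (hre _ _ _ _ (((hw _ _ h1).const_smul _).sub
    (hw _ _ (hw _ _ (hw _ _ h1)))) h1)
    ((hre _ _ _ _ (h1.sub (hw _ _ h1)) h2).const_mul (L ^ 2)).neg fun n ↦ ?_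
  rw [re_inner_hardy_eq]
  have h3 := hardy_schwartz hL (φ n)
  have h4 : ∫ x, weight L x * (1 / 4 - weight L x ^ 2) * ‖schwartzL2 (φ n) x‖ ^ 2
      = ∫ x, weight L x * (1 / 4 - weight L x ^ 2) * ‖φ n x‖ ^ 2 := by
    refine integral_congr_ae ?_
    filter_upwards [(φ n).coeFn_toLp 2] with x hx
    rw [hx]
  have h5 : L ^ 2 * (inner ℂ (schwartzL2 (φ n) - weightMul L (schwartzL2 (φ n)))
      (schwartzL2 (Δ (φ n)))).re = ∫ x, L ^ 2 * (1 - weight L x) * inner ℝ (φ n x) (Δ (φ n) x) := by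
    rw [schwartzL2, ← toLp_mulSchwartz_weight hL]
    have h6 := re_inner_toLp (φ n - mulSchwartz (weight L) (φ n)) (Δ (φ n))
    have h7 := schwartzL2_sub (φ n) (mulSchwartz (weight L) (φ n))
    simp only [schwartzL2] at h7
    rw [← h7, h6, ← integral_const_mul]
    refine integral_congr_ae (ae_of_all _ fun x ↦ ?_)
    have h8 : (φ n - mulSchwartz (weight L) (φ n)) x = (1 - weight L x) • φ n x := by
      rw [sub_apply, SchwartzMap.smulLeftCLM_apply_apply (weight_hasTemperateGrowth hL), sub_smul,
        one_smul]
    simp only [h8]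
    rw [real_inner_smul_left, mul_assoc]
  rw [h4, h5]
  exact h3

end SobolevExtension

/-! ### Relative compactness of the potentials and the spectrum of `schrodinger W`. -/

noncomputable section Potentials

theorem norm_le_of_ae_norm_le {a b d : L2R3} {c e : ℝ} (hc : 0 ≤ c) (he : 0 ≤ e)
    (h : ∀ᵐ x, ‖a x‖ ≤ c * ‖b x‖ + e * ‖d x‖) : ‖a‖ ≤ c * ‖b‖ + e * ‖d‖ := by
  have hn : ∀ f : L2R3, ‖(Lp.memLp f).norm.toLp (fun x ↦ ‖f x‖)‖ = ‖f‖ := fun f ↦ by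
    rw [Lp.norm_toLp, eLpNorm_norm, Lp.norm_def]
  set G : Lp ℝ 2 (volume : Measure R3) := c • (Lp.memLp b).norm.toLp _
    + e • (Lp.memLp d).norm.toLp _ with hG
  have h1 : ‖a‖ ≤ ‖G‖ := by
    refine Lp.norm_le_norm_of_ae_le ?_
    filter_upwards [h, Lp.coeFn_add (c • (Lp.memLp b).norm.toLp _) (e • (Lp.memLp d).norm.toLp _),
      Lp.coeFn_smul c ((Lp.memLp b).norm.toLp _), Lp.coeFn_smul e ((Lp.memLp d).norm.toLp _),
      (Lp.memLp b).norm.coeFn_toLp, (Lp.memLp d).norm.coeFn_toLp] with x h1 h2 h3 h4 h5 h6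
    rw [h2, Pi.add_apply, h3, h4, Pi.smul_apply, Pi.smul_apply, h5, h6]
    exact h1.trans (le_abs_self _)
  refine h1.trans ((norm_add_le _ _).trans ?_)
  rw [norm_smul, norm_smul, hn, hn, Real.norm_eq_abs, Real.norm_eq_abs, abs_of_nonneg hc,
    abs_of_nonneg he]

theorem InfinitesimallyBounded.memLp {W : R3 → ℝ} (hW : InfinitesimallyBounded W) (ψ : H2R3) :
    MemLp (potentialMul W ψ) 2 volume :=
  let ⟨_, hC⟩ := hW 1 one_pos
  let ⟨h, _⟩ := hC ψ
  h

/-- Multiplication by an infinitesimally bounded potential. -/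
def InfinitesimallyBounded.mul {W : R3 → ℝ} (hW : InfinitesimallyBounded W) :
    H2R3 →ₗ[ℂ] L2R3 where
  toFun ψ := (hW.memLp ψ).toLp (potentialMul W ψ)
  map_add' a b := by
    rw [← MemLp.toLp_add]
    exact MemLp.toLp_congr _ _ (potentialMul_add W a b)
  map_smul' c a := by
    rw [RingHom.id_apply, ← MemLp.toLp_const_smul]
    exact MemLp.toLp_congr _ _ (potentialMul_smul W c a)

section

variable {W : R3 → ℝ} (hW : InfinitesimallyBounded W)

theorem InfinitesimallyBounded.coeFn_mul (ψ : H2R3) :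
    hW.mul ψ =ᵐ[volume] fun x ↦ (W x : ℂ) * (ψ : L2R3) x :=
  (hW.memLp ψ).coeFn_toLp

theorem InfinitesimallyBounded.exists_bound {ε : ℝ} (hε : 0 < ε) :
    ∃ C, 0 ≤ C ∧ ∀ ψ : H2R3, ‖hW.mul ψ‖ ≤ ε * ‖laplacianL2 ψ‖ + C * ‖(ψ : L2R3)‖ := by
  obtain ⟨C, hC⟩ := hW ε hε
  refine ⟨|C|, abs_nonneg C, fun ψ ↦ ?_⟩
  obtain ⟨h, hb⟩ := hC ψ
  refine hb.trans ?_
  gcongr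
  exact le_abs_self C

theorem InfinitesimallyBounded.neg_add {W₁ W₂ : R3 → ℝ} (hW₁ : InfinitesimallyBounded W₁)
    (hW₂ : InfinitesimallyBounded W₂) :
    InfinitesimallyBounded fun x ↦ -W₁ x + W₂ x := by
  intro ε hε
  obtain ⟨C₁, -, h₁⟩ := hW₁.exists_bound (half_pos hε)
  obtain ⟨C₂, -, h₂⟩ := hW₂.exists_bound (half_pos hε)
  refine ⟨C₁ + C₂, fun ψ ↦ ?_⟩
  have he : potentialMul (fun x ↦ -W₁ x + W₂ x) ψ
      = -potentialMul W₁ ψ + potentialMul W₂ ψ := by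
    ext x
    simp only [potentialMul, Pi.add_apply, Pi.neg_apply]
    push_cast
    ring
  have hm : MemLp (potentialMul (fun x ↦ -W₁ x + W₂ x) ψ) 2 volume := by
    rw [he]
    exact (hW₁.memLp ψ).neg.add (hW₂.memLp ψ)
  refine ⟨hm, ?_⟩
  have h3 : hm.toLp _ = -hW₁.mul ψ + hW₂.mul ψ := by
    change _ = -(hW₁.memLp ψ).toLp _ + (hW₂.memLp ψ).toLp _
    rw [← MemLp.toLp_neg, ← MemLp.toLp_add]
    exact MemLp.toLp_congr _ _ (by rw [he])
  rw [h3]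
  refine (norm_add_le _ _).trans ?_
  rw [norm_neg]
  linarith [h₁ ψ, h₂ ψ]

end

/-- `besselInv` as a map onto `H²(ℝ³)`. -/
def besselH2 : L2R3 →ₗ[ℂ] H2R3 :=
  LinearMap.codRestrict H2R3 (besselInv : L2R3 →ₗ[ℂ] L2R3) besselInv_mem

theorem coe_besselH2 (f : L2R3) : (besselH2 f : L2R3) = besselInv f := rfl

theorem laplacianL2_besselH2 (f : L2R3) :
    laplacianL2 (besselH2 f) = (freqSq : ℂ) • (besselInv f - f) :=
  laplacianL2_besselInv f _

theorem exists_besselH2_eq (ψ : H2R3) :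
    ∃ f, besselH2 f = ψ ∧ ‖f‖ ≤ ‖(ψ : L2R3)‖ + ‖laplacianL2 ψ‖ := by
  obtain ⟨f, hf⟩ := exists_besselInv_eq ψ.2
  have h1 : besselH2 f = ψ := Subtype.ext hf
  refine ⟨f, h1, ?_⟩
  have h2 : f = (ψ : L2R3) - (freqSq : ℂ)⁻¹ • laplacianL2 ψ := by
    rw [← h1, laplacianL2_besselH2, smul_smul, inv_mul_cancel₀ freqSq_ne_zero, one_smul,
      coe_besselH2, sub_sub_cancel]
  have h3 : ‖(freqSq : ℂ)⁻¹‖ ≤ 1 := by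
    rw [norm_inv, Complex.norm_real, Real.norm_eq_abs, abs_of_pos freqSq_pos]
    refine inv_le_one_of_one_le₀ (one_le_pow₀ ?_)
    linarith [Real.pi_gt_three]
  conv_lhs => rw [h2]
  refine (norm_sub_le _ _).trans ?_
  gcongr
  rw [norm_smul]
  exact mul_le_of_le_one_left (norm_nonneg _) h3

theorem norm_besselInv_le (f : L2R3) : ‖besselInv f‖ ≤ ‖f‖ := by
  have h1 := besselInv_norm_sq_le f
  have h2 : (inner ℂ (besselInv f) f).re ≤ ‖besselInv f‖ * ‖f‖ :=
    (Complex.re_le_norm _).trans (norm_inner_le_norm _ _)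
  by_contra! h
  nlinarith [norm_nonneg f]

theorem norm_laplacianL2_besselH2_le (f : L2R3) :
    ‖laplacianL2 (besselH2 f)‖ ≤ freqSq * ‖besselInv f‖ + freqSq * ‖f‖ := by
  rw [laplacianL2_besselH2, norm_smul, Complex.norm_real, Real.norm_eq_abs,
    abs_of_pos freqSq_pos, ← mul_add]
  exact mul_le_mul_of_nonneg_left (norm_sub_le _ _) freqSq_pos.le

theorem InfinitesimallyBounded.exists_bessel_bound {W : R3 → ℝ} (hW : InfinitesimallyBounded W) :
    ∃ C, 0 ≤ C ∧ ∀ f, ‖hW.mul (besselH2 f)‖ ≤ freqSq / 2 * ‖f‖ + C * ‖besselInv f‖ := by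
  obtain ⟨C, hC0, hC⟩ := hW.exists_bound (half_pos one_pos)
  have := freqSq_pos
  refine ⟨freqSq / 2 + C, by positivity, fun f ↦ (hC _).trans ?_⟩
  have := norm_laplacianL2_besselH2_le f
  rw [coe_besselH2]
  linarith

/-- The potential times `besselInv`. -/
def InfinitesimallyBounded.mulBessel {W : R3 → ℝ} (hW : InfinitesimallyBounded W) :
    L2R3 →L[ℂ] L2R3 :=
  LinearMap.mkContinuousOfExistsBound (hW.mul ∘ₗ besselH2) (by
    obtain ⟨C, hC0, hC⟩ := hW.exists_bessel_bound
    refine ⟨freqSq / 2 + C, fun f ↦ (hC f).trans ?_⟩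
    rw [add_mul]
    gcongr
    exact norm_besselInv_le f)

theorem InfinitesimallyBounded.mulBessel_apply {W : R3 → ℝ} (hW : InfinitesimallyBounded W)
    (f : L2R3) : hW.mulBessel f = hW.mul (besselH2 f) := rfl

/-- A potential tends to zero at infinity. -/
def VanishesAtInfinity (W : R3 → ℝ) : Prop :=
  ∀ ε : ℝ, 0 < ε → ∃ ρ : ℝ, ∀ᵐ x : R3, ρ < ‖x‖ → |W x| ≤ ε

/-- Multiplication by the weight as a map of `H²(ℝ³)`. -/
def weightH2 {L : ℝ} (hL : 1 ≤ L) (ψ : H2R3) : H2R3 :=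
  ⟨weightMul L ψ, (weightMul_mem_commutator hL ψ).1⟩

theorem coe_weightH2 {L : ℝ} (hL : 1 ≤ L) (ψ : H2R3) :
    (weightH2 hL ψ : L2R3) = weightMul L ψ := rfl

theorem commutator_le {L : ℝ} (hL : 1 ≤ L) (ψ : H2R3) :
    ‖laplacianL2 (weightH2 hL ψ) - weightMul L (laplacianL2 ψ)‖ ^ 2
      ≤ 104 / L ^ 2 * (‖weightMul L ψ‖ * ‖weightMul L (laplacianL2 ψ)‖ + ‖weightMul L ψ‖ ^ 2) :=
  (weightMul_mem_commutator hL ψ).2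

theorem norm_laplacianL2_weightH2_le {L : ℝ} (hL : 1 ≤ L) (ψ : H2R3) :
    ‖laplacianL2 (weightH2 hL ψ)‖
      ≤ 3 / 2 * ‖weightMul L (laplacianL2 ψ)‖ + 104 * ‖weightMul L ψ‖ := by
  have h1 := commutator_le hL ψ
  set a := ‖weightMul L (ψ : L2R3)‖
  set b := ‖weightMul L (laplacianL2 ψ)‖ with hb
  have ha0 : 0 ≤ a := norm_nonneg _
  have hb0 : 0 ≤ b := norm_nonneg _
  have h2 : 104 / L ^ 2 ≤ 104 := div_le_self (by norm_num) (one_le_pow₀ hL)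
  -- The square root of 104(ab + a²) is split as b/2 + 104a; the coefficient of b is kept small for
  -- later absorption.
  have h3 : ‖laplacianL2 (weightH2 hL ψ) - weightMul L (laplacianL2 ψ)‖ ≤ b / 2 + 104 * a := by
    refine (abs_le_of_sq_le_sq' (h1.trans ?_) (by positivity)).2
    calc _ ≤ 104 * (a * b + a ^ 2) := by gcongr
      _ ≤ _ := by nlinarith [mul_nonneg ha0 hb0]
  have h4 := norm_sub_norm_le (laplacianL2 (weightH2 hL ψ)) (weightMul L (laplacianL2 ψ))
  linarith

/-- Inside the ball of radius ρ the weight satisfies (1 + ρ²)θ₁ ≥ 1; outside it |W| ≤ ε. -/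
theorem InfinitesimallyBounded.norm_mul_le_of_vanishes {W : R3 → ℝ} (hW : InfinitesimallyBounded W)
    {ε ρ : ℝ} (hε : 0 ≤ ε) (h : ∀ᵐ x : R3, ρ < ‖x‖ → |W x| ≤ ε) (ψ : H2R3) :
    ‖hW.mul ψ‖ ≤ (1 + ρ ^ 2) * ‖hW.mul (weightH2 le_rfl ψ)‖ + ε * ‖(ψ : L2R3)‖ := by
  refine norm_le_of_ae_norm_le (by positivity) hε ?_
  filter_upwards [h, hW.coeFn_mul ψ, hW.coeFn_mul (weightH2 le_rfl ψ),
    coeFn_weightMul 1 (ψ : L2R3)] with x h1 h2 h3 h4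
  rw [h2, h3, coe_weightH2, h4, norm_mul, norm_mul, norm_mul, Complex.norm_real, Complex.norm_real,
    Real.norm_eq_abs, Real.norm_eq_abs, abs_of_nonneg (weight_nonneg 1 x)]
  have h0 := norm_nonneg ((ψ : L2R3) x)
  have hw := weight_nonneg 1 x
  rcases lt_or_ge ρ ‖x‖ with hx | hx
  · have := mul_le_mul_of_nonneg_right (h1 hx) h0
    have : 0 ≤ (1 + ρ ^ 2) * (|W x| * (weight 1 x * ‖(ψ : L2R3) x‖)) := by positivity
    linarith
  · have h5 : 1 ≤ (1 + ρ ^ 2) * weight 1 x := by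
      unfold weight
      rw [one_pow, mul_one_div, one_le_div (by positivity)]
      gcongr
    have h6 := mul_le_mul_of_nonneg_right h5 (mul_nonneg (abs_nonneg (W x)) h0)
    have h7 : 0 ≤ ε * ‖(ψ : L2R3) x‖ := by positivity
    linarith

/-- Far out W is small. Near the origin θ₁Bf_n → 0 by Rellich while Δ(θ₁Bf_n) stays bounded, so the
arbitrarily small relative bound of W makes Wθ₁Bf_n → 0. Each of the three errors gets e/3. -/
theorem InfinitesimallyBounded.isCompletelyContinuous {W : R3 → ℝ}
    (hW : InfinitesimallyBounded W) (hv : VanishesAtInfinity W) :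
    IsCompletelyContinuous hW.mulBessel := by
  intro f C hf hweak
  have hR := isCompletelyContinuous_weightMul_besselInv f C hf hweak
  have hC0 : 0 ≤ C := (norm_nonneg _).trans (hf 0)
  have hk := freqSq_pos
  set M := 3 / 2 * (freqSq * C + freqSq * C) + 104 * C with hM
  have hM0 : 0 ≤ M := by positivity
  have hlap : ∀ n, ‖laplacianL2 (weightH2 le_rfl (besselH2 (f n)))‖ ≤ M := fun n ↦ by
    refine (norm_laplacianL2_weightH2_le le_rfl _).trans ?_
    have h1 := norm_weightMul_le 1 (laplacianL2 (besselH2 (f n)))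
    have h2 := norm_weightMul_le 1 (besselH2 (f n) : L2R3)
    have h3 := norm_laplacianL2_besselH2_le (f n)
    have h4 := (norm_besselInv_le (f n)).trans (hf n)
    rw [coe_besselH2] at h2 ⊢
    have h5 := mul_le_mul_of_nonneg_left h4 hk.le
    have h6 := mul_le_mul_of_nonneg_left (hf n) hk.le
    linarith
  rw [tendsto_zero_iff_norm_tendsto_zero]
  rw [Metric.tendsto_atTop]
  intro e he
  obtain ⟨ρ, hρ⟩ := hv (e / (3 * (C + 1))) (by positivity)
  obtain ⟨C', hC'0, hC'⟩ := hW.exists_bound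
    (ε := e / (3 * (M + 1) * (1 + ρ ^ 2))) (by positivity)
  have hev : ∀ᶠ n in atTop, ‖weightMul 1 (besselInv (f n))‖ < e / (3 * (C' + 1) * (1 + ρ ^ 2)) :=
    (tendsto_zero_iff_norm_tendsto_zero.1 hR).eventually_lt_const (by positivity)
  obtain ⟨N, hN⟩ := eventually_atTop.1 hev
  refine ⟨N, fun n hn ↦ ?_⟩
  rw [Real.dist_eq, sub_zero, abs_norm, hW.mulBessel_apply]
  have h1 := hW.norm_mul_le_of_vanishes (by positivity) hρ (besselH2 (f n))
  have h2 := hC' (weightH2 le_rfl (besselH2 (f n)))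
  rw [coe_weightH2, coe_besselH2] at h2
  rw [coe_besselH2] at h1
  have h3 : e / (3 * (C + 1)) * ‖besselInv (f n)‖ ≤ e / 3 := by
    calc _ ≤ e / (3 * (C + 1)) * C := by
          gcongr
          exact (norm_besselInv_le _).trans (hf n)
      _ ≤ e / (3 * (C + 1)) * (C + 1) := by gcongr; linarith
      _ = e / 3 := by field_simp
  have h4 : (1 + ρ ^ 2) * ‖hW.mul (weightH2 le_rfl (besselH2 (f n)))‖ < e / 3 + e / 3 := by
    calc _ ≤ (1 + ρ ^ 2) * (e / (3 * (M + 1) * (1 + ρ ^ 2)) * M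
          + C' * ‖weightMul 1 (besselInv (f n))‖) := by
          gcongr
          refine h2.trans ?_
          gcongr
          exact hlap n
      _ ≤ (1 + ρ ^ 2) * (e / (3 * (M + 1) * (1 + ρ ^ 2)) * (M + 1)
          + (C' + 1) * ‖weightMul 1 (besselInv (f n))‖) := by
          gcongr <;> linarith
      _ < (1 + ρ ^ 2) * (e / (3 * (M + 1) * (1 + ρ ^ 2)) * (M + 1)
          + (C' + 1) * (e / (3 * (C' + 1) * (1 + ρ ^ 2)))) := by
          have := hN n hn
          gcongr
      _ = e / 3 + e / 3 := by
          have : M + 1 ≠ 0 := by positivity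
          field_simp
  linarith

theorem InfinitesimallyBounded.inner_mul_comm {W : R3 → ℝ} (hW : InfinitesimallyBounded W)
    (φ ψ : H2R3) : inner ℂ (hW.mul φ) (ψ : L2R3) = inner ℂ (φ : L2R3) (hW.mul ψ) := by
  rw [L2.inner_def, L2.inner_def]
  refine integral_congr_ae ?_
  filter_upwards [hW.coeFn_mul φ, hW.coeFn_mul ψ] with x h1 h2
  simp only [h1, h2, RCLike.inner_apply, map_mul, Complex.conj_ofReal]
  ring

theorem mem_schrodinger_domain {W : R3 → ℝ} (hW : InfinitesimallyBounded W) (ψ : H2R3) :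
    (ψ : L2R3) ∈ (schrodinger W).domain := ⟨ψ.2, hW.memLp ψ⟩

theorem schrodinger_apply {W : R3 → ℝ} (hW : InfinitesimallyBounded W) (ψ : H2R3) :
    schrodinger W ⟨ψ, mem_schrodinger_domain hW ψ⟩ = -laplacianL2 ψ + hW.mul ψ := rfl

theorem isCompactPerturbation_schrodinger {W : R3 → ℝ} (hW : InfinitesimallyBounded W)
    (hv : VanishesAtInfinity W) :
    IsCompactPerturbation freqSq besselInv hW.mulBessel (schrodinger W) where
  pos := freqSq_pos
  inner_comm := besselInv_inner_comm
  norm_sq_le := besselInv_norm_sq_le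
  injective := besselInv_injective
  mem_domain f := mem_schrodinger_domain hW (besselH2 f)
  exists_eq ψ := exists_besselInv_eq ψ.2.1
  apply_eq f := by
    refine (schrodinger_apply hW (besselH2 f)).trans ?_
    rw [laplacianL2_besselH2, hW.mulBessel_apply, ← smul_neg, neg_sub]
  inner_comm_right f g := hW.inner_mul_comm (besselH2 f) (besselH2 g)
  bound := hW.exists_bessel_bound
  completelyContinuous := hW.isCompletelyContinuous hv

theorem mem_spectrumOf_schrodinger {W : R3 → ℝ} (hW : InfinitesimallyBounded W)
    (hv : VanishesAtInfinity W) {t : ℝ} (ht : 0 ≤ t) : (t : ℂ) ∈ spectrumOf (schrodinger W) := by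
  obtain ⟨f, hf, hlim⟩ := exists_orthonormal_tendsto_zero ht
  exact (isCompactPerturbation_schrodinger hW hv).mem_spectrumOf_of_orthonormal hf hlim

/-- All of [0, ∞) is spectrum, so 0 is not isolated. -/
theorem zero_mem_essentialSpectrum {W : R3 → ℝ} (hW : InfinitesimallyBounded W)
    (hv : VanishesAtInfinity W) : ((0 : ℝ) : ℂ) ∈ essentialSpectrum (schrodinger W) := by
  refine ⟨mem_spectrumOf_schrodinger hW hv le_rfl, fun hd ↦ ?_⟩
  obtain ⟨-, ⟨r, hr, h⟩, -⟩ := hd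
  have h1 : ((r / 2 : ℝ) : ℂ) ∈ ({((0 : ℝ) : ℂ)} : Set ℂ) := by
    rw [← h]
    refine ⟨mem_spectrumOf_schrodinger hW hv (by positivity), ?_⟩
    rw [mem_ball_iff_norm, Complex.ofReal_zero, sub_zero, Complex.norm_real, Real.norm_eq_abs,
      abs_of_pos (half_pos hr)]
    linarith
  have h2 := Complex.ofReal_inj.1 (Set.mem_singleton_iff.1 h1)
  linarith

theorem essentialThreshold_schrodinger {W : R3 → ℝ} (hW : InfinitesimallyBounded W)
    (hv : VanishesAtInfinity W) : essentialThreshold (schrodinger W) = 0 := by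
  refine le_antisymm (sInf_le ⟨0, zero_mem_essentialSpectrum hW hv, rfl⟩) (le_sInf ?_)
  rintro e ⟨t, ht, rfl⟩
  exact EReal.coe_nonneg.2
    ((isCompactPerturbation_schrodinger hW hv).nonneg_of_mem_essentialSpectrum ht)

/-- A Schrödinger operator whose spectrum begins below zero has an eigenvector. -/
theorem exists_eigenvector_of_spectralBottom_lt {W : R3 → ℝ} (hW : InfinitesimallyBounded W)
    (hv : VanishesAtInfinity W) (h : spectralBottom (schrodinger W) < 0) :
    ∃ E : ℝ, E < 0 ∧ ∃ ψ : H2R3, ψ ≠ 0 ∧ laplacianL2 ψ = hW.mul ψ - (E : ℂ) • (ψ : L2R3) := by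
  obtain ⟨e, ⟨t, ht, rfl⟩, ht0⟩ := sInf_lt_iff.1 h
  have ht0 : t < 0 := EReal.coe_neg'.1 ht0
  have hd : (t : ℂ) ∈ discreteSpectrum (schrodinger W) := by
    by_contra hd
    exact ht0.not_ge
      ((isCompactPerturbation_schrodinger hW hv).nonneg_of_mem_essentialSpectrum ⟨ht, hd⟩)
  obtain ⟨ψ, hψ, hψ0⟩ := Submodule.exists_mem_ne_zero_of_ne_bot hd.2.2.1
  have hψ1 : schrodinger W ψ = (t : ℂ) • (ψ : L2R3) := sub_eq_zero.1 hψ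
  refine ⟨t, ht0, ⟨ψ, ψ.2.1⟩, fun h0 ↦ hψ0 (Subtype.ext (congrArg (Subtype.val : H2R3 → L2R3) h0)), ?_⟩
  have h2 := (schrodinger_apply hW ⟨ψ, ψ.2.1⟩).symm.trans hψ1
  rw [← h2]
  abel

theorem mem_spectrumOf_of_eigenvector {W : R3 → ℝ} (hW : InfinitesimallyBounded W) {E : ℝ}
    {ψ : H2R3} (hψ : ψ ≠ 0) (h : laplacianL2 ψ = hW.mul ψ - (E : ℂ) • (ψ : L2R3)) :
    (E : ℂ) ∈ spectrumOf (schrodinger W) := by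
  rintro ⟨S, -, hS⟩
  have h1 := hS ⟨ψ, mem_schrodinger_domain hW ψ⟩
  rw [schrodinger_apply hW, h] at h1
  have h2 : -(hW.mul ψ - (E : ℂ) • (ψ : L2R3)) + hW.mul ψ - (E : ℂ) • (ψ : L2R3) = 0 := by abel
  rw [h2, map_zero] at h1
  exact hψ (Subtype.ext h1.symm)

end Potentials

/-! ### Norm convergence of the repulsions relative to the Laplacian. -/

noncomputable section Convergence

variable {U Uc : R3 → ℝ} (hU : InfinitesimallyBounded U) (hUc : InfinitesimallyBounded Uc)

theorem coeFn_mul_sub_mul (ψ : H2R3) : (hUc.mul ψ - hU.mul ψ : L2R3) =ᵐ[volume]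
    fun x ↦ ((Uc x - U x : ℝ) : ℂ) * (ψ : L2R3) x := by
  filter_upwards [Lp.coeFn_sub (hUc.mul ψ) (hU.mul ψ), hU.coeFn_mul ψ, hUc.coeFn_mul ψ]
    with x h1 h2 h3
  rw [h1, Pi.sub_apply, h2, h3]
  push_cast
  ring

theorem norm_mul_le_mul (h0 : ∀ᵐ x, 0 ≤ U x) (h : ∀ᵐ x, U x ≤ Uc x) (ψ : H2R3) :
    ‖hU.mul ψ‖ ≤ ‖hUc.mul ψ‖ := by
  refine Lp.norm_le_norm_of_ae_le ?_
  filter_upwards [h0, h, hU.coeFn_mul ψ, hUc.coeFn_mul ψ] with x h1 h2 h3 h4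
  rw [h3, h4, norm_mul, norm_mul, Complex.norm_real, Complex.norm_real, Real.norm_eq_abs,
    Real.norm_eq_abs, abs_of_nonneg h1, abs_of_nonneg (h1.trans h2)]
  gcongr

theorem norm_mul_sub_mul_le (h0 : ∀ᵐ x, 0 ≤ U x) (h : ∀ᵐ x, U x ≤ Uc x) (ψ : H2R3) :
    ‖hUc.mul ψ - hU.mul ψ‖ ≤ ‖hUc.mul ψ‖ := by
  refine Lp.norm_le_norm_of_ae_le ?_
  filter_upwards [h0, h, coeFn_mul_sub_mul hU hUc ψ, hUc.coeFn_mul ψ] with x h1 h2 h3 h4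
  rw [h3, h4, norm_mul, norm_mul, Complex.norm_real, Complex.norm_real, Real.norm_eq_abs,
    Real.norm_eq_abs, abs_of_nonneg (sub_nonneg.2 h2), abs_of_nonneg (h1.trans h2)]
  gcongr
  linarith

theorem tendsto_mul_sub_mul {U : ℕ → R3 → ℝ} (hU : ∀ n, InfinitesimallyBounded (U n))
    (h0 : ∀ n, ∀ᵐ x, 0 ≤ U n x) (h : ∀ n, ∀ᵐ x, U n x ≤ Uc x)
    (hlim : ∀ᵐ x, Tendsto (fun n ↦ U n x) atTop (𝓝 (Uc x))) (ψ : H2R3) :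
    Tendsto (fun n ↦ ‖hUc.mul ψ - (hU n).mul ψ‖) atTop (𝓝 0) := by
  have h1 : Tendsto (fun n ↦ ∫ x, ‖(hUc.mul ψ - (hU n).mul ψ : L2R3) x‖ ^ 2) atTop
      (𝓝 (∫ _ : R3, (0 : ℝ))) := by
    refine tendsto_integral_of_dominated_convergence (fun x ↦ ‖hUc.mul ψ x‖ ^ 2)
      (fun n ↦ (integrable_norm_sq _).1) (integrable_norm_sq _) (fun n ↦ ?_) ?_
    · filter_upwards [h0 n, h n, coeFn_mul_sub_mul (hU n) hUc ψ, hUc.coeFn_mul ψ]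
        with x h1 h2 h3 h4
      rw [Real.norm_eq_abs, abs_of_nonneg (sq_nonneg _)]
      gcongr
      rw [h3, h4, norm_mul, norm_mul, Complex.norm_real, Complex.norm_real, Real.norm_eq_abs,
        Real.norm_eq_abs, abs_of_nonneg (sub_nonneg.2 h2), abs_of_nonneg (h1.trans h2)]
      gcongr
      linarith
    · filter_upwards [hlim, ae_all_iff.2 fun n ↦ coeFn_mul_sub_mul (hU n) hUc ψ] with x h1 h2
      simp only [h2, norm_mul, Complex.norm_real]
      have h3 := (((h1.const_sub (Uc x)).norm).mul_const ‖(ψ : L2R3) x‖).pow 2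
      simpa using h3
  simp only [← norm_sq_eq_integral, integral_zero] at h1
  have h2 := h1.sqrt
  simpa using h2

/-- Take nearly norming vectors f_n with weak limit a along a subsequence. On f_n - a the difference
of the potentials is dominated by U_c, for which complete continuity applies; on the fixed vector a,
dominated convergence applies. -/
theorem exists_subseq_tendsto_mulBessel (hv : VanishesAtInfinity Uc) {U : ℕ → R3 → ℝ}
    (hU : ∀ n, InfinitesimallyBounded (U n))
    (h0 : ∀ n, ∀ᵐ x, 0 ≤ U n x) (h : ∀ n, ∀ᵐ x, U n x ≤ Uc x)
    (hlim : ∀ᵐ x, Tendsto (fun n ↦ U n x) atTop (𝓝 (Uc x))) :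
    ∃ k : ℕ → ℕ, Tendsto (fun n ↦ ‖hUc.mulBessel - (hU (k n)).mulBessel‖) atTop (𝓝 0) := by
  have hex : ∀ n, ∃ f, ‖f‖ ≤ 1 ∧ ‖hUc.mulBessel - (hU n).mulBessel‖
      ≤ ‖(hUc.mulBessel - (hU n).mulBessel) f‖ + 1 / ((n : ℝ) + 1) := fun n ↦ by
    obtain ⟨f, hf, hlt⟩ := ContinuousLinearMap.exists_lt_apply_of_lt_opNorm
      (hUc.mulBessel - (hU n).mulBessel)
      (r := ‖hUc.mulBessel - (hU n).mulBessel‖ - 1 / ((n : ℝ) + 1))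
      (sub_lt_self _ (by positivity))
    exact ⟨f, hf.le, by linarith⟩
  choose f hf1 hf2 using hex
  obtain ⟨a, -, k, hk, hweak⟩ := exists_weakly_convergent_subseq hf1
  refine ⟨k, ?_⟩
  have hcc := (hUc.isCompletelyContinuous hv).tendsto (f := f ∘ k) (fun n ↦ hf1 (k n)) hweak
  have t1 : Tendsto (fun n ↦ ‖hUc.mulBessel (f (k n)) - hUc.mulBessel a‖) atTop (𝓝 0) :=
    tendsto_iff_norm_sub_tendsto_zero.1 hcc
  have t2 := (tendsto_mul_sub_mul hUc hU h0 h hlim (besselH2 a)).comp hk.tendsto_atTop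
  have t3 := (tendsto_one_div_add_atTop_nhds_zero_nat (𝕜 := ℝ)).comp hk.tendsto_atTop
  have t4 := (t1.add t2).add t3
  rw [add_zero, add_zero] at t4
  refine squeeze_zero (fun n ↦ norm_nonneg _) (fun n ↦ (hf2 (k n)).trans ?_) t4
  gcongr ?_ + ?_
  · have e1 : (hUc.mulBessel - (hU (k n)).mulBessel) (f (k n))
        = (hUc.mul (besselH2 (f (k n) - a)) - (hU (k n)).mul (besselH2 (f (k n) - a)))
          + (hUc.mul (besselH2 a) - (hU (k n)).mul (besselH2 a)) := by
      rw [sub_apply, InfinitesimallyBounded.mulBessel_apply,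
        InfinitesimallyBounded.mulBessel_apply]
      simp only [map_sub]
      abel
    rw [e1]
    refine (norm_add_le _ _).trans ?_
    gcongr ?_ + ?_
    · refine (norm_mul_sub_mul_le (hU (k n)) hUc (h0 _) (h _) _).trans_eq ?_
      rw [map_sub, map_sub]
      rfl
    · exact le_rfl
  · exact le_rfl

end Convergence

/-! ### A priori bounds for eigenfunctions with nonpositive energy. -/

noncomputable section Elliptic

theorem re_inner_laplacianL2_nonpos (ψ : H2R3) :
    (inner ℂ (laplacianL2 ψ) (ψ : L2R3)).re ≤ 0 := by
  obtain ⟨f, rfl, -⟩ := exists_besselH2_eq ψ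
  rw [laplacianL2_besselH2, inner_smul_left, Complex.conj_ofReal, Complex.re_ofReal_mul,
    coe_besselH2, inner_sub_left, Complex.sub_re]
  refine mul_nonpos_of_nonneg_of_nonpos freqSq_pos.le ?_
  have h1 : (inner ℂ (besselInv f) (besselInv f)).re = ‖besselInv f‖ ^ 2 :=
    inner_self_eq_norm_sq (𝕜 := ℂ) _
  rw [h1, ← besselInv_inner_comm]
  linarith [besselInv_norm_sq_le f]

variable {W : R3 → ℝ} {hW : InfinitesimallyBounded W} {C E : ℝ} {ψ : H2R3}

/-- In ‖Δψ + Eψ‖² the cross term is nonnegative, as E and Re⟨Δψ, ψ⟩ are both nonpositive. So ‖Wψ‖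
dominates ‖Δψ‖ and |E|‖ψ‖, and the relative bound closes the estimate. -/
theorem energy_bound (hC : ∀ φ : H2R3, ‖hW.mul φ‖ ≤ 1 / 4 * ‖laplacianL2 φ‖ + C * ‖(φ : L2R3)‖)
    (hE : E ≤ 0) (h : laplacianL2 ψ = hW.mul ψ - (E : ℂ) • (ψ : L2R3)) :
    -E * ‖(ψ : L2R3)‖ ≤ 2 * (C * ‖(ψ : L2R3)‖) := by
  have h1 : hW.mul ψ = laplacianL2 ψ + (E : ℂ) • (ψ : L2R3) := by rw [h]; abel
  have h2 : ‖hW.mul ψ‖ ^ 2 = ‖laplacianL2 ψ‖ ^ 2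
      + 2 * (E * (inner ℂ (laplacianL2 ψ) (ψ : L2R3)).re) + (E * ‖(ψ : L2R3)‖) ^ 2 := by
    have h3 := norm_add_sq (𝕜 := ℂ) (laplacianL2 ψ) ((E : ℂ) • (ψ : L2R3))
    rw [← h1, inner_smul_right, norm_smul, mul_pow, Complex.norm_real, Real.norm_eq_abs,
      sq_abs, ← mul_pow] at h3
    rw [h3]
    congr 3
    exact Complex.re_ofReal_mul _ _
  have h4 := mul_nonneg_of_nonpos_of_nonpos hE (re_inner_laplacianL2_nonpos ψ)
  have h5 : ‖laplacianL2 ψ‖ ≤ ‖hW.mul ψ‖ :=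
    (abs_le_of_sq_le_sq' (by nlinarith) (norm_nonneg _)).2
  have h6 : -E * ‖(ψ : L2R3)‖ ≤ ‖hW.mul ψ‖ :=
    (abs_le_of_sq_le_sq' (by nlinarith) (norm_nonneg _)).2
  have h7 := hC ψ
  have h8 := norm_nonneg (hW.mul ψ)
  linarith

theorem mul_weightH2 {L : ℝ} (hL : 1 ≤ L) (ψ : H2R3) :
    hW.mul (weightH2 hL ψ) = weightMul L (hW.mul ψ) := by
  apply Lp.ext
  filter_upwards [hW.coeFn_mul (weightH2 hL ψ), hW.coeFn_mul ψ, coeFn_weightMul L (hW.mul ψ),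
    coeFn_weightMul L (ψ : L2R3)] with x h1 h2 h3 h4
  rw [h1, h3, h2, coe_weightH2, h4]
  ring

theorem weightMul_laplacianL2 {L : ℝ} (hL : 1 ≤ L)
    (h : laplacianL2 ψ = hW.mul ψ - (E : ℂ) • (ψ : L2R3)) :
    weightMul L (laplacianL2 ψ) = hW.mul (weightH2 hL ψ) - (E : ℂ) • (weightH2 hL ψ : L2R3) := by
  rw [h, map_sub, map_smul, mul_weightH2, coe_weightH2]

/-- The commutator bound has coefficient 3/2 and the relative bound 1/4; since 3/8 < 1 the
second-order terms can be absorbed, leaving only ‖θψ‖ on the right. -/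
theorem elliptic_bound (hC : ∀ φ : H2R3, ‖hW.mul φ‖ ≤ 1 / 4 * ‖laplacianL2 φ‖ + C * ‖(φ : L2R3)‖)
    (hE : E ≤ 0) (hEC : -E ≤ 2 * C)
    (h : laplacianL2 ψ = hW.mul ψ - (E : ℂ) • (ψ : L2R3)) {L : ℝ} (hL : 1 ≤ L) :
    ‖weightMul L (laplacianL2 ψ)‖ ≤ (200 + 10 * C) * ‖weightMul L (ψ : L2R3)‖ ∧
    ‖laplacianL2 (weightH2 hL ψ)‖ ≤ (200 + 10 * C) * ‖weightMul L (ψ : L2R3)‖ := by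
  have h1 := norm_laplacianL2_weightH2_le hL ψ
  have h2 : ‖weightMul L (laplacianL2 ψ)‖ ≤ 1 / 4 * ‖laplacianL2 (weightH2 hL ψ)‖
      + C * ‖weightMul L (ψ : L2R3)‖ + 2 * C * ‖weightMul L (ψ : L2R3)‖ := by
    rw [weightMul_laplacianL2 hL h]
    refine (norm_sub_le _ _).trans ?_
    have h3 := hC (weightH2 hL ψ)
    rw [norm_smul, Complex.norm_real, Real.norm_eq_abs, abs_of_nonpos hE]
    rw [coe_weightH2] at h3 ⊢
    gcongr
  have h4 : 0 ≤ ‖weightMul L (ψ : L2R3)‖ := norm_nonneg _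
  have h5 : 0 ≤ C * ‖weightMul L (ψ : L2R3)‖ := mul_nonneg (by linarith) h4
  constructor <;> linarith

end Elliptic

/-! ### The Agmon-type estimate with weight |x|²θ. -/

noncomputable section Localization

theorem one_le_mul_weight_one {x : R3} {R : ℝ} (h : ‖x‖ ^ 2 ≤ R ^ 2) :
    1 ≤ (1 + R ^ 2) * weight 1 x := by
  unfold weight
  rw [one_pow, mul_one_div, one_le_div (by positivity)]
  linarith

/-- The pointwise lower bound behind the decay of the bound states. -/
theorem pointwise_lower_bound {L δ R ρ v u w : ℝ} {x : R3} (hL : L ≠ 0) (hv : 0 ≤ v)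
    (hvR : R < ‖x‖ → v = 0) (hu : 0 ≤ u) (huw : u ≤ w)
    (hw : ρ < ‖x‖ → (3 / 4 + δ) / ‖x‖ ^ 2 ≤ w) :
    min δ (1 / 5) * weight L x ≤ weight L x * (1 / 4 - weight L x ^ 2)
      + L ^ 2 * ((1 - weight L x) * (-v + u)) + 25 * L ^ 2 * (weight L x ^ 2 * (w - u))
      + R ^ 2 * (1 + R ^ 2) ^ 2 * (weight 1 x ^ 2 * v) + 2 * (1 + ρ ^ 2) ^ 2 * weight 1 x ^ 2 := by
  have hr := norm_sq_mul_weight hL x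
  set θ := weight L x
  set θ₁ := weight 1 x with hθ₁
  have h0 : 0 ≤ θ := weight_nonneg L x
  have h1 : θ ≤ 1 := weight_le_one L x
  have hd : 0 ≤ w - u := sub_nonneg.2 huw
  have hsq : ∀ {S : ℝ}, ‖x‖ ^ 2 ≤ S ^ 2 → 1 ≤ (1 + S ^ 2) ^ 2 * θ₁ ^ 2 := fun {S} h ↦ by
    rw [← mul_pow]
    exact one_le_pow₀ (one_le_mul_weight_one h)
  -- On the support of V one has |x|²θ ≤ R², and (1 + R²)θ₁ ≥ 1 turns this into a local term
  -- independent of L.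
  have hV : L ^ 2 * (1 - θ) * v ≤ R ^ 2 * (1 + R ^ 2) ^ 2 * (θ₁ ^ 2 * v) := by
    rcases lt_or_ge R ‖x‖ with hx | hx
    · rw [hvR hx]
      simp
    · have hx2 : ‖x‖ ^ 2 ≤ R ^ 2 := pow_le_pow_left₀ (norm_nonneg x) hx 2
      rw [← hr]
      calc ‖x‖ ^ 2 * θ * v ≤ R ^ 2 * 1 * v := by gcongr
        _ = R ^ 2 * 1 * (1 * v) := by ring
        _ ≤ R ^ 2 * 1 * (((1 + R ^ 2) ^ 2 * θ₁ ^ 2) * v) := by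
            gcongr
            exact hsq hx2
        _ = _ := by ring
  have hρ0 : 0 ≤ 2 * (1 + ρ ^ 2) ^ 2 * θ₁ ^ 2 := by positivity
  have hD : 0 ≤ 25 * L ^ 2 * (θ ^ 2 * (w - u)) := by positivity
  have hU : 0 ≤ L ^ 2 * (1 - θ) * u := mul_nonneg (mul_nonneg (sq_nonneg L) (by linarith)) hu
  have hmin1 : min δ (1 / 5) * θ ≤ δ * θ := mul_le_mul_of_nonneg_right (min_le_left _ _) h0
  have hmin2 : min δ (1 / 5) * θ ≤ 1 / 5 * θ := mul_le_mul_of_nonneg_right (min_le_right _ _) h0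
  have hexp : L ^ 2 * ((1 - θ) * (-v + u)) = L ^ 2 * (1 - θ) * u - L ^ 2 * (1 - θ) * v := by ring
  rw [hexp]
  -- The absolute value covers negative ρ and ensures x ≠ 0 in the exterior case.
  rcases lt_or_ge |ρ| ‖x‖ with hx | hx
  · have hx0 : 0 < ‖x‖ := (abs_nonneg ρ).trans_lt hx
    have hw' := hw ((le_abs_self ρ).trans_lt hx)
    rw [div_le_iff₀ (by positivity)] at hw'
    -- For θ < 1/5 Hardy alone suffices, since 1/4 - 1/25 > 1/5, and no comparison of u with w is
    -- needed. For θ ≥ 1/5 one has 1 - θ ≤ 25θ², so the defect w - u carries one factor θ for each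
    -- copy of ψ.
    rcases lt_or_ge θ (1 / 5) with hθ | hθ
    · have : 1 / 5 * θ ≤ θ * (1 / 4 - θ ^ 2) := by
        rw [mul_comm]
        exact mul_le_mul_of_nonneg_left (by nlinarith) h0
      linarith
    · have h2 : (3 / 4 + δ) * θ ≤ L ^ 2 * (1 - θ) * w := by
        rw [← hr]
        calc (3 / 4 + δ) * θ ≤ w * ‖x‖ ^ 2 * θ := by gcongr
          _ = _ := by ring
      have h3 : L ^ 2 * (1 - θ) * (w - u) ≤ 25 * L ^ 2 * (θ ^ 2 * (w - u)) := by
        have : 1 - θ ≤ 25 * θ ^ 2 := by nlinarith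
        calc L ^ 2 * (1 - θ) * (w - u) ≤ L ^ 2 * (25 * θ ^ 2) * (w - u) := by gcongr
          _ = _ := by ring
      have h4 : δ * θ ≤ θ * (1 / 4 - θ ^ 2) + (3 / 4 + δ) * θ := by
        have : θ * θ ^ 2 ≤ θ * 1 := by
          gcongr
          exact pow_le_one₀ h0 h1
        linarith
      linarith
  -- Nothing is known about w in this ball; the Hardy term is bounded below by a constant there, and
  -- the local term supplies the 2.
  · have h2 := hsq (S := ρ) (by
      rw [← sq_abs ρ]
      exact pow_le_pow_left₀ (norm_nonneg x) hx 2)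
    have h3 : 1 / 5 * θ ≤ θ * (1 / 4 - θ ^ 2) + 2 := by
      have : θ * θ ^ 2 ≤ 1 * 1 := mul_le_mul h1 (pow_le_one₀ h0 h1) (sq_nonneg θ) zero_le_one
      linarith
    linarith

theorem re_inner_ofReal_mul (a b : ℝ) (z : ℂ) :
    (inner ℂ ((a : ℂ) * z) ((b : ℂ) * z)).re = a * b * ‖z‖ ^ 2 := by
  rw [← smul_eq_mul, ← smul_eq_mul, inner_smul_left, inner_smul_right, Complex.conj_ofReal,
    Complex.re_ofReal_mul, Complex.re_ofReal_mul, ← mul_assoc]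
  congr 1
  exact inner_self_eq_norm_sq (𝕜 := ℂ) z

theorem re_inner_eq_integral_of_ae {f g ψ : L2R3} {a b : R3 → ℝ}
    (hf : f =ᵐ[volume] fun x ↦ (a x : ℂ) * ψ x) (hg : g =ᵐ[volume] fun x ↦ (b x : ℂ) * ψ x) :
    Integrable (fun x ↦ a x * b x * ‖ψ x‖ ^ 2) ∧
      (inner ℂ f g).re = ∫ x, a x * b x * ‖ψ x‖ ^ 2 := by
  have h : (fun x ↦ (inner ℂ (f x : ℂ) (g x : ℂ)).re)
      =ᵐ[volume] fun x ↦ a x * b x * ‖ψ x‖ ^ 2 := by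
    filter_upwards [hf, hg] with x h1 h2
    rw [h1, h2, re_inner_ofReal_mul]
  exact ⟨(integrable_inner f g).re.congr h, (re_inner_eq_integral f g).trans (integral_congr_ae h)⟩

theorem coeFn_self_eq (ψ : L2R3) : ψ =ᵐ[volume] fun x ↦ ((1 : ℝ) : ℂ) * ψ x :=
  ae_of_all _ fun x ↦ by simp

theorem coeFn_sub_weightMul (L : ℝ) (ψ : L2R3) :
    (ψ - weightMul L ψ : L2R3) =ᵐ[volume] fun x ↦ ((1 - weight L x : ℝ) : ℂ) * ψ x := by
  filter_upwards [Lp.coeFn_sub ψ (weightMul L ψ), coeFn_weightMul L ψ] with x h1 h2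
  rw [h1, Pi.sub_apply, h2]
  push_cast
  ring

theorem InfinitesimallyBounded.coeFn_mul_weightH2 {W : R3 → ℝ} (hW : InfinitesimallyBounded W)
    {L : ℝ} (hL : 1 ≤ L) (ψ : H2R3) :
    hW.mul (weightH2 hL ψ) =ᵐ[volume] fun x ↦ ((weight L x * W x : ℝ) : ℂ) * (ψ : L2R3) x := by
  filter_upwards [hW.coeFn_mul (weightH2 hL ψ), coeFn_weightMul L (ψ : L2R3)] with x h1 h2
  rw [h1, coe_weightH2, h2]
  push_cast
  ring

theorem norm_sq_weightMul_le (L : ℝ) (ψ : L2R3) :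
    ‖weightMul L ψ‖ ^ 2 ≤ (inner ℂ (weightMul L ψ) ψ).re := by
  obtain ⟨h1, h2⟩ := re_inner_eq_integral_of_ae (coeFn_weightMul L ψ) (coeFn_self_eq ψ)
  obtain ⟨h3, h4⟩ := re_inner_eq_integral_of_ae (coeFn_weightMul L ψ) (coeFn_weightMul L ψ)
  have h5 : (inner ℂ (weightMul L ψ) (weightMul L ψ)).re = ‖weightMul L ψ‖ ^ 2 :=
    inner_self_eq_norm_sq (𝕜 := ℂ) _
  rw [← h5, h2, h4]
  refine integral_mono h3 h1 fun x ↦ ?_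
  simp only
  have := weight_nonneg L x
  have := weight_le_one L x
  gcongr

/-- Cutting off at scale L loses little local mass, because θ₁(1 - θ) = (1 - θ₁)θ/L². -/
theorem norm_sq_weightMul_sub_le {L : ℝ} (hL : 1 ≤ L) (ψ : L2R3) :
    ‖weightMul 1 (ψ - weightMul L ψ)‖ ^ 2 ≤ 1 / L ^ 2 * (inner ℂ (weightMul L ψ) ψ).re := by
  have hc : weightMul 1 (ψ - weightMul L ψ) =ᵐ[volume]
      fun x ↦ ((weight 1 x * (1 - weight L x) : ℝ) : ℂ) * ψ x := by
    filter_upwards [coeFn_weightMul 1 (ψ - weightMul L ψ), coeFn_sub_weightMul L ψ] with x h1 h2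
    rw [h1, h2]
    push_cast
    ring
  obtain ⟨h1, h2⟩ := re_inner_eq_integral_of_ae (coeFn_weightMul L ψ) (coeFn_self_eq ψ)
  obtain ⟨h3, h4⟩ := re_inner_eq_integral_of_ae hc hc
  have h5 : (inner ℂ (weightMul 1 (ψ - weightMul L ψ)) (weightMul 1 (ψ - weightMul L ψ))).re
      = ‖weightMul 1 (ψ - weightMul L ψ)‖ ^ 2 := inner_self_eq_norm_sq (𝕜 := ℂ) _
  rw [← h5, h2, h4, ← integral_const_mul]
  refine integral_mono h3 (h1.const_mul _) fun x ↦ ?_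
  simp only
  rw [← mul_assoc (1 / L ^ 2)]
  refine mul_le_mul_of_nonneg_right ?_ (sq_nonneg ‖ψ x‖)
  have hL0 : L ≠ 0 := by positivity
  have a1 := weight_nonneg 1 x
  have a2 := weight_le_one 1 x
  have a3 := weight_nonneg L x
  have a4 := weight_le_one L x
  have hr := norm_sq_mul_weight hL0 x
  have hr1 := norm_sq_mul_weight one_ne_zero x
  have e1 : weight 1 x * (1 - weight L x) = 1 / L ^ 2 * ((1 - weight 1 x) * weight L x) := by
    have : L ^ 2 * (weight 1 x * (1 - weight L x)) = (1 - weight 1 x) * weight L x := by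
      calc _ = weight 1 x * (L ^ 2 * (1 - weight L x)) := by ring
        _ = ‖x‖ ^ 2 * weight 1 x * weight L x := by rw [← hr]; ring
        _ = _ := by rw [hr1]; ring
    rw [← this]
    field_simp
  have e2 : weight 1 x * (1 - weight L x) ≤ 1 :=
    mul_le_one₀ a2 (sub_nonneg.2 a4) (sub_le_self 1 a3)
  have e3 : 0 ≤ weight 1 x * (1 - weight L x) := mul_nonneg a1 (by linarith)
  calc _ ≤ weight 1 x * (1 - weight L x) * 1 := by gcongr
    _ = 1 / L ^ 2 * ((1 - weight 1 x) * weight L x) := by rw [mul_one, e1]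
    _ ≤ 1 / L ^ 2 * (1 * weight L x) := by
        gcongr
        linarith
    _ = _ := by ring

variable {V U Uc : R3 → ℝ} {R ρ δ : ℝ} (hV : InfinitesimallyBounded V)
  (hU : InfinitesimallyBounded U) (hUc : InfinitesimallyBounded Uc)

/-- The Agmon-type estimate for bound states, in terms of their local mass. -/
theorem localization_form (hV0 : ∀ᵐ x, 0 ≤ V x) (hVR : ∀ᵐ x : R3, R < ‖x‖ → V x = 0)
    (h0 : ∀ᵐ x, 0 ≤ U x) (h : ∀ᵐ x, U x ≤ Uc x)
    (hlong : ∀ᵐ x : R3, ρ < ‖x‖ → (3 / 4 + δ) / ‖x‖ ^ 2 ≤ Uc x) {E : ℝ} (hE : E ≤ 0) {ψ : H2R3}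
    (heq : laplacianL2 ψ = (hV.neg_add hU).mul ψ - (E : ℂ) • (ψ : L2R3)) {L : ℝ} (hL : 1 ≤ L) :
    min δ (1 / 5) * (inner ℂ (weightMul L ψ) (ψ : L2R3)).re
      ≤ 25 * L ^ 2 * (inner ℂ (weightMul L ψ)
          (hUc.mul (weightH2 hL ψ) - hU.mul (weightH2 hL ψ))).re
        + R ^ 2 * (1 + R ^ 2) ^ 2 * (inner ℂ (weightMul 1 ψ) (hV.mul (weightH2 le_rfl ψ))).re
        + 2 * (1 + ρ ^ 2) ^ 2 * ‖weightMul 1 (ψ : L2R3)‖ ^ 2 := by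
  have hL0 : L ≠ 0 := by positivity
  have hc3 : (hUc.mul (weightH2 hL ψ) - hU.mul (weightH2 hL ψ) : L2R3) =ᵐ[volume]
      fun x ↦ ((weight L x * (Uc x - U x) : ℝ) : ℂ) * (ψ : L2R3) x := by
    filter_upwards [coeFn_mul_sub_mul hU hUc (weightH2 hL ψ), coeFn_weightMul L (ψ : L2R3)]
      with x h1 h2
    rw [h1, coe_weightH2, h2]
    push_cast
    ring
  have hcH : (((1 / 4 : ℝ) : ℂ) • weightMul L ψ - weightMul L (weightMul L (weightMul L ψ)) : L2R3)
      =ᵐ[volume] fun x ↦ ((weight L x * (1 / 4 - weight L x ^ 2) : ℝ) : ℂ) * (ψ : L2R3) x := by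
    filter_upwards [Lp.coeFn_sub (((1 / 4 : ℝ) : ℂ) • weightMul L (ψ : L2R3))
      (weightMul L (weightMul L (weightMul L ψ))),
      Lp.coeFn_smul ((1 / 4 : ℝ) : ℂ) (weightMul L (ψ : L2R3)),
      coeFn_weightMul L (ψ : L2R3), coeFn_weightMul L (weightMul L (ψ : L2R3)),
      coeFn_weightMul L (weightMul L (weightMul L (ψ : L2R3)))] with x h1 h2 h3 h4 h5
    rw [h1, Pi.sub_apply, h2, Pi.smul_apply, h5, h4, h3, smul_eq_mul]
    push_cast
    ring
  obtain ⟨iN, eN⟩ := re_inner_eq_integral_of_ae (coeFn_weightMul L (ψ : L2R3))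
    (coeFn_self_eq (ψ : L2R3))
  obtain ⟨i1, e1⟩ := re_inner_eq_integral_of_ae hcH (coeFn_self_eq (ψ : L2R3))
  obtain ⟨i2, e2⟩ := re_inner_eq_integral_of_ae (coeFn_sub_weightMul L (ψ : L2R3))
    ((hV.neg_add hU).coeFn_mul ψ)
  obtain ⟨i3, e3⟩ := re_inner_eq_integral_of_ae (coeFn_weightMul L (ψ : L2R3)) hc3
  obtain ⟨i4, e4⟩ := re_inner_eq_integral_of_ae (coeFn_weightMul 1 (ψ : L2R3))
    (hV.coeFn_mul_weightH2 le_rfl ψ)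
  obtain ⟨i5, e5⟩ := re_inner_eq_integral_of_ae (coeFn_weightMul 1 (ψ : L2R3))
    (coeFn_weightMul 1 (ψ : L2R3))
  have e6 : (inner ℂ (weightMul 1 (ψ : L2R3)) (weightMul 1 (ψ : L2R3))).re
      = ‖weightMul 1 (ψ : L2R3)‖ ^ 2 := inner_self_eq_norm_sq (𝕜 := ℂ) _
  have hmain := integral_mono_ae (iN.const_mul (min δ (1 / 5)))
    ((((i1.add (i2.const_mul (L ^ 2))).add (i3.const_mul (25 * L ^ 2))).add
      (i4.const_mul (R ^ 2 * (1 + R ^ 2) ^ 2))).add (i5.const_mul (2 * (1 + ρ ^ 2) ^ 2))) (by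
    filter_upwards [hV0, hVR, h0, h, hlong] with x a1 a2 a3 a4 a5
    have hp := mul_le_mul_of_nonneg_right
      (pointwise_lower_bound hL0 a1 a2 a3 a4 a5) (sq_nonneg ‖(ψ : L2R3) x‖)
    simp only [Pi.add_apply]
    refine le_of_eq_of_le ?_ (hp.trans_eq ?_) <;> ring)
  rw [integral_add' (((i1.add (i2.const_mul (L ^ 2))).add (i3.const_mul (25 * L ^ 2))).add
      (i4.const_mul (R ^ 2 * (1 + R ^ 2) ^ 2))) (i5.const_mul (2 * (1 + ρ ^ 2) ^ 2)),
    integral_add' ((i1.add (i2.const_mul (L ^ 2))).add (i3.const_mul (25 * L ^ 2)))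
      (i4.const_mul (R ^ 2 * (1 + R ^ 2) ^ 2)),
    integral_add' (i1.add (i2.const_mul (L ^ 2))) (i3.const_mul (25 * L ^ 2)),
    integral_add' i1 (i2.const_mul (L ^ 2)), integral_const_mul, integral_const_mul,
    integral_const_mul, integral_const_mul, integral_const_mul, ← eN, ← e1, ← e2, ← e3, ← e4,
    ← e5, e6] at hmain
  -- The eigenvalue equation replaces Δψ. The energy term carries E ≤ 0 times the nonnegative form
  -- of 1 - θ, so it can be dropped.
  have hardy := hardy_H2 hL0 ψ
  rw [← re_inner_hardy_eq, heq, inner_sub_right, inner_smul_right, Complex.sub_re,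
    Complex.re_ofReal_mul] at hardy
  have hpos : 0 ≤ (inner ℂ ((ψ : L2R3) - weightMul L ψ) (ψ : L2R3)).re := by
    obtain ⟨-, e7⟩ := re_inner_eq_integral_of_ae (coeFn_sub_weightMul L (ψ : L2R3))
      (coeFn_self_eq (ψ : L2R3))
    rw [e7]
    refine integral_nonneg fun x ↦ ?_
    have := weight_le_one L x
    exact mul_nonneg (mul_nonneg (by linarith) zero_le_one) (sq_nonneg _)
  have hEp := mul_nonpos_of_nonpos_of_nonneg hE hpos
  have hEp2 := mul_nonpos_of_nonneg_of_nonpos (sq_nonneg L) hEp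
  rw [mul_sub] at hardy
  linarith

end Localization

/-! ### Passage to the critical coupling. -/

noncomputable section CriticalCoupling

theorem InfinitesimallyBounded.neg_add_mul {W₁ W₂ : R3 → ℝ} (hW₁ : InfinitesimallyBounded W₁)
    (hW₂ : InfinitesimallyBounded W₂) (φ : H2R3) :
    (hW₁.neg_add hW₂).mul φ = -hW₁.mul φ + hW₂.mul φ := by
  apply Lp.ext
  filter_upwards [(hW₁.neg_add hW₂).coeFn_mul φ, hW₁.coeFn_mul φ, hW₂.coeFn_mul φ,
    Lp.coeFn_add (-hW₁.mul φ) (hW₂.mul φ), Lp.coeFn_neg (hW₁.mul φ)] with x h1 h2 h3 h4 h5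
  rw [h1, h4, Pi.add_apply, h5, Pi.neg_apply, h2, h3]
  push_cast
  ring

theorem VanishesAtInfinity.neg_add {V U : R3 → ℝ} {R : ℝ} (hVR : ∀ᵐ x : R3, R < ‖x‖ → V x = 0)
    (hU : VanishesAtInfinity U) : VanishesAtInfinity fun x ↦ -V x + U x := by
  intro ε hε
  obtain ⟨ρ, hρ⟩ := hU ε hε
  refine ⟨max R ρ, ?_⟩
  filter_upwards [hVR, hρ] with x h1 h2 hx
  rw [h1 ((le_max_left _ _).trans_lt hx), neg_zero, zero_add]
  exact h2 ((le_max_right _ _).trans_lt hx)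

theorem weightMul_one_ne_zero {ψ : L2R3} (h : ψ ≠ 0) : weightMul 1 ψ ≠ 0 := by
  intro h0
  refine h (Lp.ext ?_)
  filter_upwards [coeFn_weightMul 1 ψ, Lp.coeFn_zero ℂ 2 (volume : Measure R3)] with x h1 h2
  rw [h2]
  rw [h0, h2] at h1
  have h3 : (weight 1 x : ℂ) ≠ 0 := Complex.ofReal_ne_zero.2 (weight_pos one_ne_zero x).ne'
  exact (mul_eq_zero.1 h1.symm).resolve_left h3

theorem le_one_add_of_sq_le {a N : ℝ} (h : a ^ 2 ≤ N) : a ≤ 1 + N := by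
  nlinarith [sq_nonneg (a - 1)]

theorem le_sq_one_add {N : ℝ} (h : 0 ≤ N) : N ≤ (1 + N) ^ 2 := by
  nlinarith

theorem div_fifty_mul_le {L a c₀ : ℝ} (hL : 1 ≤ L) (ha : 0 ≤ a)
    (hc₁ : c₀ ≤ 1 / 5) : c₀ / (50 * L ^ 2) * a ≤ a / L := by
  rw [div_mul_eq_mul_div]
  calc c₀ * a / (50 * L ^ 2) ≤ 1 * a / (1 * L) := by
        gcongr
        · linarith
        · norm_num
        · exact le_self_pow₀ hL two_ne_zero
    _ = a / L := by rw [one_mul, one_mul]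

/-- One constant, later called G, majorizes the norm, mass and residual errors at once. -/
theorem constant_bounds {C C₀ a a₀ : ℝ} (hC : 0 ≤ C) (hC₀ : 0 ≤ C₀) (ha : 0 ≤ a) (h : a ≤ a₀) :
    (1 + C₀) * a ≤ 105 * (1 + C₀) * a₀ + 2 * C ∧ a₀ ≤ 105 * (1 + C₀) * a₀ + 2 * C ∧
      104 * (1 + C₀) * a + a ≤ 105 * (1 + C₀) * a₀ + 2 * C := by
  have h1 := mul_nonneg hC₀ ha
  have h2 := mul_le_mul_of_nonneg_left h hC₀
  refine ⟨?_, ?_, ?_⟩ <;> linarith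

theorem weighted_sum_le {n p q r x x' y y' : ℝ} (h : n ≤ p * x + q * y + r) (hp : 0 ≤ p)
    (hq : 0 ≤ q) (hx : x ≤ x') (hy : y ≤ y') : n ≤ p * x' + (q * y' + r) := by
  linarith [mul_le_mul_of_nonneg_left hx hp, mul_le_mul_of_nonneg_left hy hq]

/-- The tolerance c₀/(50L²) on the defect X is chosen so that it consumes exactly (c₀/2)a², hence at
most half of c₀N. -/
theorem mass_bound_arith {c₀ N a X A L : ℝ} (hc : 0 < c₀) (hL : 1 ≤ L) (ha : 0 ≤ a)
    (haN : a ^ 2 ≤ N) (hX : X ≤ c₀ / (50 * L ^ 2) * a) (h : c₀ * N ≤ 25 * L ^ 2 * (a * X) + A) :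
    N ≤ 2 * A / c₀ := by
  have hL0 : 0 < L := by linarith
  have h1 : 25 * L ^ 2 * (a * X) ≤ c₀ / 2 * a ^ 2 := by
    calc 25 * L ^ 2 * (a * X) ≤ 25 * L ^ 2 * (a * (c₀ / (50 * L ^ 2) * a)) := by gcongr
      _ = c₀ / 2 * a ^ 2 := by field_simp; ring
  have h2 : c₀ / 2 * a ^ 2 ≤ c₀ / 2 * N := by gcongr
  rw [le_div_iff₀ hc]
  linarith

theorem commutator_bound_arith {L a b C₀ X : ℝ} (hL : 1 ≤ L) (ha : 0 ≤ a) (hC : 0 ≤ C₀)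
    (hb : b ≤ C₀ * a) (hX : X ^ 2 ≤ 104 / L ^ 2 * (a * b + a ^ 2)) :
    X ≤ 104 * (1 + C₀) * a / L := by
  have hL0 : 0 < L := by linarith
  refine (abs_le_of_sq_le_sq' (hX.trans ?_) (by positivity)).2
  calc 104 / L ^ 2 * (a * b + a ^ 2) ≤ 104 / L ^ 2 * (a * (C₀ * a) + a ^ 2) := by gcongr
    _ = 104 * (1 + C₀) * (a ^ 2 / L ^ 2) := by ring
    _ ≤ (104 * (1 + C₀)) ^ 2 * (a ^ 2 / L ^ 2) := by
        gcongr
        nlinarith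
    _ = _ := by ring

section

variable {V Uc : R3 → ℝ} {R ρ δ : ℝ} (hV : InfinitesimallyBounded V)
  (hUc : InfinitesimallyBounded Uc)

set_option maxHeartbeats 1000000 in
/-- Bound states of nearby potentials, cut off at the scale `L`, are approximate eigenvectors of
the critical operator and retain their local mass. -/
theorem exists_approximate_eigenvector (hV0 : ∀ᵐ x, 0 ≤ V x)
    (hVR : ∀ᵐ x : R3, R < ‖x‖ → V x = 0) (hδ : 0 < δ)
    (hlong : ∀ᵐ x : R3, ρ < ‖x‖ → (3 / 4 + δ) / ‖x‖ ^ 2 ≤ Uc x) :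
    ∃ G : ℝ, ∀ L : ℝ, 1 ≤ L → ∃ ε > 0, ∀ (U : R3 → ℝ) (hU : InfinitesimallyBounded U),
      (∀ᵐ x, 0 ≤ U x) → (∀ᵐ x, U x ≤ Uc x) → ‖hUc.mulBessel - hU.mulBessel‖ ≤ ε →
      ∀ (E : ℝ), E ≤ 0 → ∀ ψ : H2R3,
        laplacianL2 ψ = (hV.neg_add hU).mul ψ - (E : ℂ) • (ψ : L2R3) →
        ‖weightMul 1 (ψ : L2R3)‖ = 1 →
        -E ≤ G ∧ ∃ g : L2R3, ‖g‖ ≤ G ∧ 1 - G / L ≤ ‖weightMul 1 (besselInv g)‖ ∧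
          ‖laplacianL2 (besselH2 g) - (hV.neg_add hUc).mul (besselH2 g)
            + (E : ℂ) • besselInv g‖ ≤ G / L := by
  obtain ⟨C₁, hC₁, hb₁⟩ := hV.exists_bound (ε := 1 / 8) (by norm_num)
  obtain ⟨C₂, hC₂, hb₂⟩ := hUc.exists_bound (ε := 1 / 8) (by norm_num)
  set C := C₁ + C₂ with hC
  have hCnn : 0 ≤ C := add_nonneg hC₁ hC₂
  set C₀ := 200 + 10 * C with hC₀
  have hC₀nn : 0 ≤ C₀ := by positivity
  set c₀ := min δ (1 / 5) with hc₀
  have hc₀p : 0 < c₀ := lt_min hδ (by norm_num)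
  have hc₀1 : c₀ ≤ 1 / 5 := min_le_right _ _
  -- A bounds the local terms of `localization_form` when ‖θ₁ψ‖ = 1; absorbing half of c₀N then
  -- gives N ≤ 2A/c₀.
  set A := R ^ 2 * (1 + R ^ 2) ^ 2 * (C₀ + C) + 2 * (1 + ρ ^ 2) ^ 2 with hA
  have hAnn : 0 ≤ A := by positivity
  set N₀ := 2 * A / c₀ with hN₀
  have hN₀nn : 0 ≤ N₀ := by positivity
  set a₀ := 1 + N₀ with ha₀
  -- The order of choice is essential: G does not depend on L, whereas ε may shrink like L⁻².
  refine ⟨105 * (1 + C₀) * a₀ + 2 * C, fun L hL ↦ ⟨c₀ / (50 * L ^ 2) / (1 + C₀), by positivity,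
    fun U hU h0 h hε E hE ψ heq hm ↦ ?_⟩⟩
  have hL0 : 0 < L := by linarith
  have hbW : ∀ φ : H2R3, ‖(hV.neg_add hU).mul φ‖
      ≤ 1 / 4 * ‖laplacianL2 φ‖ + C * ‖(φ : L2R3)‖ := fun φ ↦ by
    rw [hV.neg_add_mul hU]
    refine (norm_add_le _ _).trans ?_
    rw [norm_neg]
    have := norm_mul_le_mul hU hUc h0 h φ
    have := hb₁ φ
    have := hb₂ φ
    rw [hC]
    linarith
  have hψ0 : 0 < ‖(ψ : L2R3)‖ := by
    have := norm_weightMul_le 1 (ψ : L2R3)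
    rw [hm] at this
    linarith
  have hEC : -E ≤ 2 * C := by
    have := energy_bound hbW hE heq
    rw [← mul_assoc] at this
    exact le_of_mul_le_mul_right this hψ0
  obtain ⟨hell, hell'⟩ := elliptic_bound hbW hE hEC heq hL
  obtain ⟨-, hell₁⟩ := elliptic_bound hbW hE hEC heq le_rfl
  rw [hm, mul_one] at hell₁
  -- g = (1 - Δ/(2π)²)(θψ), so the operator-norm smallness of the potential difference can be
  -- applied to θψ.
  obtain ⟨g, hg, hgn⟩ := exists_besselH2_eq (weightH2 hL ψ)
  set N := (inner ℂ (weightMul L ψ) (ψ : L2R3)).re with hN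
  set a := ‖weightMul L (ψ : L2R3)‖ with ha
  have hann : 0 ≤ a := norm_nonneg _
  have haN : a ^ 2 ≤ N := norm_sq_weightMul_le L ψ
  have hgn' : ‖g‖ ≤ (1 + C₀) * a := by
    refine hgn.trans ?_
    rw [coe_weightH2, one_add_mul]
    gcongr
  have hX : ‖hUc.mul (weightH2 hL ψ) - hU.mul (weightH2 hL ψ)‖ ≤ c₀ / (50 * L ^ 2) * a := by
    rw [← hg, ← hUc.mulBessel_apply, ← hU.mulBessel_apply, ← sub_apply]
    refine ((hUc.mulBessel - hU.mulBessel).le_opNorm g).trans ?_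
    calc _ ≤ c₀ / (50 * L ^ 2) / (1 + C₀) * ((1 + C₀) * a) := by gcongr
      _ = _ := by field_simp
  have hform := localization_form hV hU hUc hV0 hVR h0 h hlong hE heq hL
  have hT3 : (inner ℂ (weightMul L ψ) (hUc.mul (weightH2 hL ψ) - hU.mul (weightH2 hL ψ))).re
      ≤ a * ‖hUc.mul (weightH2 hL ψ) - hU.mul (weightH2 hL ψ)‖ :=
    (Complex.re_le_norm _).trans (norm_inner_le_norm _ _)
  have hT4 : (inner ℂ (weightMul 1 ψ) (hV.mul (weightH2 le_rfl ψ))).re ≤ C₀ + C := by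
    refine (Complex.re_le_norm _).trans ((norm_inner_le_norm _ _).trans ?_)
    rw [hm, one_mul]
    have h1 := hb₁ (weightH2 le_rfl ψ)
    rw [coe_weightH2, hm] at h1
    linarith
  have hNN₀ : N ≤ N₀ := by
    rw [hm, one_pow, mul_one] at hform
    exact mass_bound_arith hc₀p hL hann haN hX
      (weighted_sum_le hform (by positivity) (by positivity) hT3 hT4)
  have haa₀ : a ≤ a₀ := le_one_add_of_sq_le (haN.trans hNN₀)
  obtain ⟨hc₁, hc₂, hc₃⟩ := constant_bounds hCnn hC₀nn hann haa₀
  have hcomm := commutator_bound_arith hL hann hC₀nn hell (commutator_le hL ψ)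
  refine ⟨hEC.trans (le_add_of_nonneg_left (by positivity)), g, hgn'.trans hc₁, ?_, ?_⟩
  · have e1 : besselInv g = weightMul L ψ := congrArg Subtype.val hg
    have h1 : ‖weightMul 1 ((ψ : L2R3) - weightMul L ψ)‖ ≤ a₀ / L := by
      refine (abs_le_of_sq_le_sq' ((norm_sq_weightMul_sub_le hL (ψ : L2R3)).trans ?_)
        (by positivity)).2
      rw [div_pow, one_div_mul_eq_div]
      exact div_le_div_of_nonneg_right (hNN₀.trans (le_sq_one_add hN₀nn)) (sq_nonneg L)
    have h2 := norm_sub_norm_le (weightMul 1 (ψ : L2R3)) (weightMul 1 (weightMul L ψ))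
    rw [← map_sub, hm] at h2
    have h3 := div_le_div_of_nonneg_right hc₂ hL0.le
    rw [e1]
    exact sub_le_comm.1 (h2.trans (h1.trans h3))
  -- The residual splits into the commutator [Δ, θ]ψ and the defect (U_c - U)θψ.
  · have e2 : laplacianL2 (besselH2 g) - (hV.neg_add hUc).mul (besselH2 g)
        + (E : ℂ) • besselInv g
        = (laplacianL2 (weightH2 hL ψ) - weightMul L (laplacianL2 ψ))
          - (hUc.mul (weightH2 hL ψ) - hU.mul (weightH2 hL ψ)) := by
      rw [← coe_besselH2, hg, weightMul_laplacianL2 hL heq, hV.neg_add_mul hUc, hV.neg_add_mul hU]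
      abel
    rw [e2]
    refine (norm_sub_le _ _).trans (le_trans (add_le_add hcomm (hX.trans ?_))
      ((add_div _ _ _).symm.trans_le (div_le_div_of_nonneg_right hc₃ hL0.le)))
    exact div_fifty_mul_le hL hann hc₀1

/-- Bounded approximate eigenvectors with nonvanishing local mass yield an eigenvector. -/
theorem exists_eigenvector_of_approximate {W : R3 → ℝ} (hW : InfinitesimallyBounded W)
    (hv : VanishesAtInfinity W) {G : ℝ} {E : ℕ → ℝ} {g : ℕ → L2R3} (hE0 : ∀ n, E n ≤ 0)
    (hEG : ∀ n, -E n ≤ G) (hg : ∀ n, ‖g n‖ ≤ G)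
    (hmass : ∀ n : ℕ, 1 - G / ((n : ℝ) + 1) ≤ ‖weightMul 1 (besselInv (g n))‖)
    (hres : ∀ n : ℕ, ‖laplacianL2 (besselH2 (g n)) - hW.mul (besselH2 (g n))
      + (E n : ℂ) • besselInv (g n)‖ ≤ G / ((n : ℝ) + 1)) :
    ∃ e : ℝ, e ≤ 0 ∧ ∃ ψ : H2R3, ψ ≠ 0 ∧ laplacianL2 ψ = hW.mul ψ - (e : ℂ) • (ψ : L2R3) := by
  obtain ⟨a, -, k, hk, hweak⟩ := exists_weakly_convergent_subseq hg
  obtain ⟨e, he, l, hl, hlim⟩ := (isCompact_Icc (a := -G) (b := 0)).tendsto_subseq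
    (x := fun n ↦ E (k n)) fun n ↦ ⟨by linarith [hEG (k n)], hE0 (k n)⟩
  set j : ℕ → ℕ := k ∘ l with hj
  have hjt : Tendsto j atTop atTop := hk.tendsto_atTop.comp hl.tendsto_atTop
  have hweak' : ∀ h, Tendsto (fun n ↦ inner ℂ h (g (j n))) atTop (𝓝 (inner ℂ h a)) :=
    fun h ↦ (hweak h).comp hl.tendsto_atTop
  have hG0 : Tendsto (fun n ↦ G / ((j n : ℝ) + 1)) atTop (𝓝 0) := by
    have h1 := (tendsto_one_div_add_atTop_nhds_zero_nat (𝕜 := ℝ)).const_mul G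
    simp only [mul_one_div, mul_zero] at h1
    exact h1.comp hjt
  have hR := isCompletelyContinuous_weightMul_besselInv.tendsto (fun n ↦ hg (j n)) hweak'
  have hK := (hW.isCompletelyContinuous hv).tendsto (fun n ↦ hg (j n)) hweak'
  -- θ₁B is completely continuous, so the local mass passes to the limit and is at least 1.
  have hne : besselInv a ≠ 0 := fun h0 ↦ by
    have h1 : (1 : ℝ) - 0 ≤ ‖weightMul 1 (besselInv a)‖ :=
      le_of_tendsto_of_tendsto' (hG0.const_sub 1) hR.norm fun n ↦ hmass (j n)
    rw [h0, map_zero, norm_zero] at h1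
    linarith
  refine ⟨e, he.2, besselH2 a, fun h0 ↦ hne (congrArg Subtype.val h0), ?_⟩
  have hr0 : Tendsto (fun n ↦ laplacianL2 (besselH2 (g (j n))) - hW.mul (besselH2 (g (j n)))
      + (E (j n) : ℂ) • besselInv (g (j n))) atTop (𝓝 0) :=
    squeeze_zero_norm (fun n ↦ hres (j n)) hG0
  have hB : ∀ h, Tendsto (fun n ↦ inner ℂ h (besselInv (g (j n)))) atTop
      (𝓝 (inner ℂ h (besselInv a))) := fun h ↦ by
    simp only [← besselInv_inner_comm]
    exact hweak' _
  have hEc : Tendsto (fun n ↦ (E (j n) : ℂ)) atTop (𝓝 (e : ℂ)) :=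
    (Complex.continuous_ofReal.tendsto e).comp hlim
  have hzero : laplacianL2 (besselH2 a) - hW.mul (besselH2 a) + (e : ℂ) • besselInv a = 0 := by
    -- The equation needs to be passed to the limit only weakly, tested against an arbitrary h.
    refine ext_inner_left ℂ fun h ↦ ?_
    have t1 := (tendsto_const_nhds (x := h)).inner (𝕜 := ℂ) hr0
    refine tendsto_nhds_unique ?_ t1
    simp only [laplacianL2_besselH2, inner_add_right, inner_sub_right, inner_smul_right]
    exact ((((hB h).sub (hweak' h)).const_mul _).sub
      ((tendsto_const_nhds (x := h)).inner hK)).add (hEc.mul (hB h))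
  rw [← coe_besselH2] at hzero
  rw [← sub_eq_zero, ← hzero]
  abel

/-- Bound states persist in the limit of a critical, slowly decaying repulsion. -/
theorem exists_eigenvector_of_critical (hV0 : ∀ᵐ x, 0 ≤ V x)
    (hVR : ∀ᵐ x : R3, R < ‖x‖ → V x = 0) (hδ : 0 < δ)
    (hlong : ∀ᵐ x : R3, ρ < ‖x‖ → (3 / 4 + δ) / ‖x‖ ^ 2 ≤ Uc x) (hv : VanishesAtInfinity Uc)
    {U : ℕ → R3 → ℝ} (hU : ∀ n, InfinitesimallyBounded (U n)) (h0 : ∀ n, ∀ᵐ x, 0 ≤ U n x)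
    (h : ∀ n, ∀ᵐ x, U n x ≤ Uc x) (hlim : ∀ᵐ x, Tendsto (fun n ↦ U n x) atTop (𝓝 (Uc x)))
    (heig : ∀ n, ∃ E : ℝ, E < 0 ∧ ∃ ψ : H2R3, ψ ≠ 0 ∧
      laplacianL2 ψ = (hV.neg_add (hU n)).mul ψ - (E : ℂ) • (ψ : L2R3)) :
    ∃ e : ℝ, e ≤ 0 ∧ ∃ ψ : H2R3, ψ ≠ 0 ∧
      laplacianL2 ψ = (hV.neg_add hUc).mul ψ - (e : ℂ) • (ψ : L2R3) := by
  obtain ⟨G, hG⟩ := exists_approximate_eigenvector hV hUc hV0 hVR hδ hlong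
  obtain ⟨k, hk⟩ := exists_subseq_tendsto_mulBessel hUc hv hU h0 h hlim
  have hstep : ∀ n : ℕ, ∃ E : ℝ, ∃ g : L2R3, E ≤ 0 ∧ -E ≤ G ∧ ‖g‖ ≤ G ∧
      1 - G / ((n : ℝ) + 1) ≤ ‖weightMul 1 (besselInv g)‖ ∧
      ‖laplacianL2 (besselH2 g) - (hV.neg_add hUc).mul (besselH2 g)
            + (E : ℂ) • besselInv g‖ ≤ G / ((n : ℝ) + 1) := fun n ↦ by
    -- The cutoff scale is L = n + 1; a potential close enough to U_c for this scale is selected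
    -- afterwards.
    obtain ⟨ε, hε, hn⟩ := hG ((n : ℝ) + 1) (by linarith [Nat.cast_nonneg (α := ℝ) n])
    obtain ⟨i, hi⟩ := (hk.eventually_lt_const hε).exists
    obtain ⟨E, hE, ψ, hψ, heq⟩ := heig (k i)
    -- Eigenfunctions are rescaled to unit local mass rather than unit L² norm.
    set m := ‖weightMul 1 (ψ : L2R3)‖ with hm
    have hm0 : m ≠ 0 := norm_ne_zero_iff.2
      (weightMul_one_ne_zero fun h ↦ hψ (Subtype.ext h))
    obtain ⟨h1, g, h2⟩ := hn (U (k i)) (hU _) (h0 _) (h _) hi.le E hE.le (((m⁻¹ : ℝ) : ℂ) • ψ) (by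
      rw [map_smul, map_smul, heq, smul_sub, Submodule.coe_smul, smul_comm]) (by
      rw [Submodule.coe_smul, map_smul, norm_smul, Complex.norm_real, norm_inv, Real.norm_eq_abs,
        ← hm, abs_of_nonneg (norm_nonneg _), inv_mul_cancel₀ hm0])
    exact ⟨E, g, hE.le, h1, h2⟩
  choose E g h1 h2 h3 h4 h5 using hstep
  exact exists_eigenvector_of_approximate (hV.neg_add hUc) (VanishesAtInfinity.neg_add hVR hv)
    h1 h2 h3 h4 h5

end

end CriticalCoupling

/-! ### The zero-energy ground state. -/

theorem mainTheorem5
    -- the attraction `V ≥ 0`, supported in the ball of radius `R`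
    (V : R3 → ℝ) (R : ℝ)
    (hV_nonneg : ∀ᵐ x : R3, 0 ≤ V x)
    (hV_supp : ∀ᵐ x : R3, R < ‖x‖ → V x = 0)
    (hV_bdd : InfinitesimallyBounded V)
    -- the nondecreasing family of repulsions `U s > 0`, `s` in an interval `I`
    (I : Set ℝ) (hI : I.OrdConnected) (U : ℝ → R3 → ℝ)
    (hU_pos : ∀ s ∈ I, ∀ᵐ x : R3, 0 < U s x)
    (hU_bdd : ∀ s ∈ I, InfinitesimallyBounded (U s))
    (hU_mono : ∀ s ∈ I, ∀ t ∈ I, s ≤ t → ∀ᵐ x : R3, U s x ≤ U t x)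
    -- every `U s` tends to zero at infinity
    (hU_decay : ∀ s ∈ I, ∀ ε : ℝ, 0 < ε → ∃ ρ : ℝ, ∀ᵐ x : R3, ρ < ‖x‖ → U s x ≤ ε)
    -- the critical parameter `c`, where the family is left-continuous
    (c : ℝ)
    (hc : IsCriticalCoupling (fun s ↦ oneParticleHamiltonian V (U s)) I c)
    (hU_cont : ∀ᵐ x : R3, Tendsto (fun s ↦ U s x) (𝓝[I ∩ Set.Iio c] c) (𝓝 (U c x)))
    -- the repulsion is slowly decaying at the critical parameter
    (hU_long : ∃ δ : ℝ, 0 < δ ∧ ∃ ρ : ℝ, ∀ᵐ x : R3,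
      ρ < ‖x‖ → (3 / 4 + δ) / ‖x‖ ^ 2 ≤ U c x) :
    essentialThreshold (oneParticleHamiltonian V (U c)) = 0 ∧
    spectralBottom (oneParticleHamiltonian V (U c)) = 0 ∧
    ∃ ψ : (oneParticleHamiltonian V (U c)).domain,
      ‖(ψ : L2R3)‖ = 1 ∧ oneParticleHamiltonian V (U c) ψ = 0 := by
  obtain ⟨hcI, ⟨s₀, hs₀, hs₀c⟩, hlt, hge⟩ := hc
  obtain ⟨δ, hδ, ρ, hlong⟩ := hU_long
  have hv : ∀ s ∈ I, VanishesAtInfinity (U s) := fun s hs ε hε ↦ by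
    obtain ⟨r, hr⟩ := hU_decay s hs ε hε
    refine ⟨r, ?_⟩
    filter_upwards [hr, hU_pos s hs] with x h1 h2 hx
    rw [abs_of_pos h2]
    exact h1 hx
  have hW : ∀ s ∈ I, InfinitesimallyBounded fun x ↦ -V x + U s x := fun s hs ↦
    hV_bdd.neg_add (hU_bdd s hs)
  have hWv : ∀ s ∈ I, VanishesAtInfinity fun x ↦ -V x + U s x := fun s hs ↦
    VanishesAtInfinity.neg_add hV_supp (hv s hs)
  have hthr : ∀ s ∈ I, essentialThreshold (oneParticleHamiltonian V (U s)) = 0 := fun s hs ↦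
    essentialThreshold_schrodinger (hW s hs) (hWv s hs)
  have hbot : spectralBottom (oneParticleHamiltonian V (U c)) = 0 :=
    (hge c hcI le_rfl).trans (hthr c hcI)
  refine ⟨hthr c hcI, hbot, ?_⟩
  -- The sequence starts at s₀ and increases to c, so order-convexity keeps it in I and strictly
  -- below c.
  set s : ℕ → ℝ := fun n ↦ c - (c - s₀) * (1 / ((n : ℝ) + 1)) with hs
  have hcs : 0 < c - s₀ := sub_pos.2 hs₀c
  have hsc : ∀ n, s n < c := fun n ↦ sub_lt_self c (by positivity)
  have hsI : ∀ n, s n ∈ I := fun n ↦ hI.out hs₀ hcI ⟨by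
    have h1 : 1 / ((n : ℝ) + 1) ≤ 1 := by
      rw [div_le_one (by positivity)]
      linarith [Nat.cast_nonneg (α := ℝ) n]
    have := mul_le_mul_of_nonneg_left h1 hcs.le
    simp only [hs]
    linarith, (hsc n).le⟩
  have hst : Tendsto s atTop (𝓝[I ∩ Set.Iio c] c) := by
    refine tendsto_nhdsWithin_iff.2 ⟨?_, Eventually.of_forall fun n ↦ ⟨hsI n, hsc n⟩⟩
    have h1 := ((tendsto_one_div_add_atTop_nhds_zero_nat (𝕜 := ℝ)).const_mul (c - s₀)).const_sub c
    rwa [mul_zero, sub_zero] at h1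
  obtain ⟨e, he, ψ, hψ, heq⟩ := exists_eigenvector_of_critical (U := fun n ↦ U (s n)) hV_bdd
    (hU_bdd c hcI) hV_nonneg hV_supp hδ hlong (hv c hcI) (fun n ↦ hU_bdd _ (hsI n))
    (fun n ↦ (hU_pos _ (hsI n)).mono fun _ h ↦ h.le)
    (fun n ↦ hU_mono _ (hsI n) c hcI (hsc n).le)
    (hU_cont.mono fun x hx ↦ hx.comp hst)
    (fun n ↦ exists_eigenvector_of_spectralBottom_lt (hW _ (hsI n)) (hWv _ (hsI n))
      ((hlt _ (hsI n) (hsc n)).trans_eq (hthr _ (hsI n))))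
  -- An eigenvalue is a spectral point, so it cannot lie below the bottom 0 of the spectrum.
  have he0 : e = 0 := by
    refine le_antisymm he (EReal.coe_nonneg.1 ?_)
    rw [← hbot]
    exact sInf_le ⟨e, mem_spectrumOf_of_eigenvector (hW c hcI) hψ heq, rfl⟩
  rw [he0, Complex.ofReal_zero, zero_smul, sub_zero] at heq
  have hn : ‖(ψ : L2R3)‖ ≠ 0 := norm_ne_zero_iff.2 fun h ↦ hψ (Subtype.ext h)
  set φ : H2R3 := ((‖(ψ : L2R3)‖⁻¹ : ℝ) : ℂ) • ψ with hφ
  refine ⟨⟨φ, mem_schrodinger_domain (hW c hcI) φ⟩, ?_, ?_⟩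
  · change ‖(φ : L2R3)‖ = 1
    rw [hφ, Submodule.coe_smul, norm_smul, Complex.norm_real, norm_inv, norm_norm,
      inv_mul_cancel₀ hn]
  · refine (schrodinger_apply (hW c hcI) φ).trans ?_
    rw [hφ, map_smul, map_smul, heq, neg_add_cancel]
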